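/- Let $I=(-1,1)$, $\omega(t)=1+t$, let functions be scalar valued (real or complex), and write $(f,g)_{\omega^p}=\int_I \omega^p f\,\bar g\,dt$, $\|f\|_{\omega^p}^2=(f,f)_{\omega^p}$, $(f,g)=\int_I f\bar g\,dt$. Let $$H^2_{0,\omega,l}(I)=\{u:\ \partial_t^k u\in L^2_{\omega^{2k-2}}(I),\ k=0,1,2,\ u(\pm1)=u'(1)=0\},$$ where $\partial_t$ is the weak derivative and $L^2_{\omega^p}(I)=\{f:\|f\|_{\omega^p}<\infty\}$. Fix an integer $l\ge 1$, a real $R>0$, a real $\tau$, and a measurable function $\tilde n$ on $I$ with $1+\alpha\le\tilde n\le \tilde n^*<\infty$ almost everywhere for some $\alpha>0$. Put $L_lu=\frac1{(t+1)^2}\partial_t\big((t+1)^2\partial_tu\big)-\frac{l(l+1)}{(t+1)^2}u$ and $$A_\tau(u,v)=\Big(\tfrac1{\tilde n-1}\big(L_l+\tfrac{R^2}4\tau\big)u,\big(L_l+\tfrac{R^2}4\tau\big)v\Big)_{\omega^2}+\tau^2\big(\tfrac{R^2}4\big)^2(u,v)_{\omega^2},$$ $$B(u,v)=\tfrac{R^2}4\Big((\partial_tu,\partial_tv)_{\omega^2}+l(l+1)(u,v)\Big).$$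 Consider the eigenvalue problem: find a scalar $\lambda$ and $0\ne u\in H^2_{0,\omega,l}(I)$ with $A_\tau(u,v)=\lambda B(u,v)$ for all $v\in H^2_{0,\omega,l}(I)$; and its discretization: find a scalar $\lambda_N$ and $0\neq u_N\in X_N$ with $A_\tau(u_N,v)=\lambda_NB(u_N,v)$ for all $v\in X_N$, where $X_N=P_N\cap H^2_{0,\omega,l}(I)$ and $P_N$ is the space of polynomials of degree at most $N$. Let $1\le m\le\dim X_N$. Then all eigenvalues of both problems are real and positive; both problems have a first, ..., an $m$-th eigenvalue, in ascending order and counted with multiplicity, with linearly independent eigenfunctions; and there is a unique map $\Pi_N:H^2_{0,\omega,l}(I)\to X_N$ with $A_\tau(u-\Pi_Nu,v)=0$ for all $u\in H^2_{0,\omega,l}(I)$ and $v\in X_N$. Let $\lambda^m(\tau)$ and $\lambda^m_N(\tau)$ be the $m$-th eigenvalues of the two problems, and let $E_{1,m}$ be the span of linearly independent eigenfunctions $u^1,\dots,u^m$ for the first $m$ eigenvalues of the first problem (any choice of them). Then $$0<\lambda^m(\tau)\le\lambda_N^m(\tau)\le\lambda^m(\tau)\max_{0\ne v\in E_{1,m}}\frac{B(v,v)}{B(\Pi_Nv,\Pi_Nv)},$$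 where the maximum is attained in $[0,\infty]$ and the quotient is read as $+\infty$ when $\Pi_Nv=0$. -/

import Mathlib

open MeasureTheory Set Filter Topology
open scoped ContDiff ENNReal ComplexConjugate

namespace TEMode

/-- The open interval `I = (-1, 1)`. -/
abbrev I : Set ℝ := Ioo (-1) 1

/-- Lebesgue measure on `I`. -/
noncomputable abbrev muI : Measure ℝ := volume.restrict I

/-- Almost-everywhere classes of scalar functions on `I` (scalars `𝕜 = ℝ` or `ℂ`). -/
abbrev Fn (𝕜 : Type*) [RCLike 𝕜] : Type _ := ℝ →ₘ[muI] 𝕜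

variable {𝕜 : Type*} [RCLike 𝕜]

/-- The usual vector space structure on classes of functions (restated so that instance search
finds the group structure and the scalar multiplication along one path). -/
noncomputable instance instGroupFn : AddCommGroup (Fn 𝕜) := AEEqFun.instAddCommGroup

noncomputable instance instMonoidFn : AddCommMonoid (Fn 𝕜) := instGroupFn.toAddCommMonoid

noncomputable instance instModuleFn : Module 𝕜 (Fn 𝕜) := AEEqFun.instModule

/-- `g` is the weak derivative of `u` on `I`: both are locally integrable on `I` and
`∫_I φ' u = - ∫_I φ g` for every test function `φ ∈ C_c^∞(I)`. -/
structure IsWeakDeriv (u g : Fn 𝕜) : Prop where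
  locInt : LocallyIntegrableOn u I muI
  locInt' : LocallyIntegrableOn g I muI
  byParts : ∀ φ : ℝ → ℝ, ContDiff ℝ ∞ φ → HasCompactSupport φ → tsupport φ ⊆ I →
    ∫ t in I, deriv φ t • u t = - ∫ t in I, φ t • g t

open Classical in
/-- The weak derivative `∂_t u` (and `0` if `u` has none). -/
noncomputable def wderiv (u : Fn 𝕜) : Fn 𝕜 :=
  if h : ∃ g, IsWeakDeriv u g then h.choose else 0

/-- `u ∈ L²_{ω^p}(I)` with `ω(t) = 1 + t`. -/
def MemWeightedL2 (p : ℤ) (u : Fn 𝕜) : Prop :=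
  Integrable (fun t => (1 + t) ^ p * ‖u t‖ ^ 2) muI

/-- `u` has a continuous representative on `I` which tends to `c` at the point `x`
(an end point of `I`), that is `u(x) = c`. -/
def HasBoundaryValue (u : Fn 𝕜) (x : ℝ) (c : 𝕜) : Prop :=
  ∃ f : ℝ → 𝕜, u =ᵐ[muI] f ∧ ContinuousOn f I ∧ Tendsto f (𝓝[I] x) (𝓝 c)

theorem IsWeakDeriv.integrable_left {u : Fn 𝕜} (h : LocallyIntegrableOn u I muI)
    {φ : ℝ → ℝ} (h1 : Continuous φ) (h2 : HasCompactSupport φ) (h3 : tsupport φ ⊆ I) :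
    Integrable (fun t => φ t • u t) muI := by
  have hK : IsCompact (tsupport φ) := h2
  have hi : IntegrableOn u (tsupport φ) muI := h.integrableOn_compact_subset h3 hK
  have := hi.continuousOn_smul h1.continuousOn hK
  rw [← integrableOn_iff_integrable_of_support_subset (s := tsupport φ)]
  · exact this
  · intro t ht
    apply subset_tsupport
    intro h0
    simp [h0] at ht

theorem locInt_congr {f g : ℝ → 𝕜} (h : f =ᵐ[muI] g) (hf : LocallyIntegrableOn f I muI) :
    LocallyIntegrableOn g I muI := fun x hx => by
  obtain ⟨s, hs, hi⟩ := hf x hx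
  exact ⟨s, hs, hi.congr_fun_ae (ae_restrict_of_ae h)⟩

theorem IsWeakDeriv.add {u v g h : Fn 𝕜} (hu : IsWeakDeriv u g) (hv : IsWeakDeriv v h) :
    IsWeakDeriv (u + v) (g + h) := by
  refine ⟨locInt_congr (AEEqFun.coeFn_add u v).symm (hu.locInt.add hv.locInt),
    locInt_congr (AEEqFun.coeFn_add g h).symm (hu.locInt'.add hv.locInt'), ?_⟩
  intro φ h1 h2 h3
  have hd : Continuous (deriv φ) := h1.continuous_deriv (by simp)
  have hd3 : tsupport (deriv φ) ⊆ I := (tsupport_deriv_subset (𝕜 := ℝ)).trans h3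
  have e1 : ∫ t in I, deriv φ t • (u + v) t
      = ∫ t in I, (deriv φ t • u t + deriv φ t • v t) := by
    refine integral_congr_ae ?_
    filter_upwards [AEEqFun.coeFn_add u v] with t ht
    rw [ht, Pi.add_apply, smul_add]
  have e2 : ∫ t in I, φ t • (g + h) t = ∫ t in I, (φ t • g t + φ t • h t) := by
    refine integral_congr_ae ?_
    filter_upwards [AEEqFun.coeFn_add g h] with t ht
    rw [ht, Pi.add_apply, smul_add]
  rw [e1, e2, integral_add, integral_add, hu.byParts φ h1 h2 h3, hv.byParts φ h1 h2 h3, neg_add]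
  · exact integrable_left hu.locInt' h1.continuous h2 h3
  · exact integrable_left hv.locInt' h1.continuous h2 h3
  · exact integrable_left hu.locInt hd h2.deriv hd3
  · exact integrable_left hv.locInt hd h2.deriv hd3

theorem IsWeakDeriv.smul {u g : Fn 𝕜} (c : 𝕜) (hu : IsWeakDeriv u g) :
    IsWeakDeriv (c • u) (c • g) := by
  refine ⟨locInt_congr (AEEqFun.coeFn_smul c u).symm (hu.locInt.smul c),
    locInt_congr (AEEqFun.coeFn_smul c g).symm (hu.locInt'.smul c), ?_⟩
  intro φ h1 h2 h3
  have e1 : ∫ t in I, deriv φ t • (c • u) t = ∫ t in I, c • (deriv φ t • u t) := by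
    refine integral_congr_ae ?_
    filter_upwards [AEEqFun.coeFn_smul c u] with t ht
    rw [ht, Pi.smul_apply, smul_comm]
  have e2 : ∫ t in I, φ t • (c • g) t = ∫ t in I, c • (φ t • g t) := by
    refine integral_congr_ae ?_
    filter_upwards [AEEqFun.coeFn_smul c g] with t ht
    rw [ht, Pi.smul_apply, smul_comm]
  rw [e1, e2, integral_smul, integral_smul, hu.byParts φ h1 h2 h3, smul_neg]

theorem isWeakDeriv_zero : IsWeakDeriv (0 : Fn 𝕜) 0 := by
  have h0 : LocallyIntegrableOn (⇑(0 : Fn 𝕜)) I muI :=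
    locInt_congr (AEEqFun.coeFn_zero (μ := muI) (β := 𝕜)).symm
      (fun x hx => ⟨univ, univ_mem, by simp [Pi.zero_def]⟩)
  refine ⟨h0, h0, fun φ _ _ _ => ?_⟩
  have e : ∀ ψ : ℝ → ℝ, ∫ t in I, ψ t • (0 : Fn 𝕜) t = 0 := fun ψ => by
    rw [← integral_zero ℝ 𝕜 (μ := muI)]
    refine integral_congr_ae ?_
    filter_upwards [AEEqFun.coeFn_zero (μ := muI) (β := 𝕜)] with t ht
    rw [ht, Pi.zero_apply, smul_zero]
  rw [e, e, neg_zero]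

theorem MemWeightedL2.add {p : ℤ} {u v : Fn 𝕜} (hu : MemWeightedL2 p u)
    (hv : MemWeightedL2 p v) : MemWeightedL2 p (u + v) := by
  have hm : AEStronglyMeasurable (fun t : ℝ => (1 + t) ^ p * ‖(u + v) t‖ ^ 2) muI := by
    have h1 : Measurable fun t : ℝ => (1 + t) ^ p := by fun_prop
    exact h1.aestronglyMeasurable.mul ((u + v).aestronglyMeasurable.norm.pow 2)
  refine ((hu.const_mul 2).add (hv.const_mul 2)).mono' hm ?_
  filter_upwards [AEEqFun.coeFn_add u v, ae_restrict_mem measurableSet_Ioo] with t ht hI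
  have hw : 0 ≤ (1 + t) ^ p := zpow_nonneg (by linarith [hI.1]) p
  rw [ht, Real.norm_of_nonneg (by positivity), Pi.add_apply, Pi.add_apply]
  have h2 : ‖u t + v t‖ ^ 2 ≤ 2 * ‖u t‖ ^ 2 + 2 * ‖v t‖ ^ 2 := by
    nlinarith [norm_add_le (u t) (v t), norm_nonneg (u t + v t), sq_nonneg (‖u t‖ - ‖v t‖)]
  nlinarith [mul_le_mul_of_nonneg_left h2 hw]

theorem MemWeightedL2.smul {p : ℤ} {u : Fn 𝕜} (c : 𝕜) (hu : MemWeightedL2 p u) :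
    MemWeightedL2 p (c • u) := by
  refine (hu.const_mul (‖c‖ ^ 2)).congr ?_
  filter_upwards [AEEqFun.coeFn_smul c u] with t ht
  rw [ht, Pi.smul_apply, norm_smul]
  ring

theorem memWeightedL2_zero (p : ℤ) : MemWeightedL2 p (0 : Fn 𝕜) := by
  refine (integrable_zero ℝ ℝ muI).congr ?_
  filter_upwards [AEEqFun.coeFn_zero (μ := muI) (β := 𝕜)] with t ht
  simp [ht]

theorem HasBoundaryValue.add {u v : Fn 𝕜} {x : ℝ} {c d : 𝕜} (hu : HasBoundaryValue u x c)
    (hv : HasBoundaryValue v x d) : HasBoundaryValue (u + v) x (c + d) := by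
  obtain ⟨f, f1, f2, f3⟩ := hu
  obtain ⟨g, g1, g2, g3⟩ := hv
  exact ⟨f + g, (AEEqFun.coeFn_add u v).trans (f1.add g1), f2.add g2, f3.add g3⟩

theorem HasBoundaryValue.smul {u : Fn 𝕜} {x : ℝ} {c : 𝕜} (a : 𝕜) (hu : HasBoundaryValue u x c) :
    HasBoundaryValue (a • u) x (a • c) := by
  obtain ⟨f, f1, f2, f3⟩ := hu
  exact ⟨a • f, (AEEqFun.coeFn_smul a u).trans (f1.const_smul a), f2.const_smul a,
    f3.const_smul a⟩

theorem hasBoundaryValue_zero (x : ℝ) : HasBoundaryValue (0 : Fn 𝕜) x 0 :=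
  ⟨0, AEEqFun.coeFn_zero, continuousOn_const, tendsto_const_nhds⟩

variable (𝕜) in
/-- The space `H²_{0,ω,l}(I)`: all `u` with weak derivatives `∂_t^k u ∈ L²_{ω^{2k-2}}(I)` for
`k = 0, 1, 2`, and with `u(±1) = 0`, `(∂_t u)(1) = 0`. -/
noncomputable def H2 : Submodule 𝕜 (Fn 𝕜) where
  carrier := {u | ∃ u₁ u₂ : Fn 𝕜, IsWeakDeriv u u₁ ∧ IsWeakDeriv u₁ u₂ ∧
    MemWeightedL2 (-2) u ∧ MemWeightedL2 0 u₁ ∧ MemWeightedL2 2 u₂ ∧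
    HasBoundaryValue u (-1) 0 ∧ HasBoundaryValue u 1 0 ∧ HasBoundaryValue u₁ 1 0}
  add_mem' := by
    rintro u v ⟨u₁, u₂, a1, a2, a3, a4, a5, a6, a7, a8⟩ ⟨v₁, v₂, b1, b2, b3, b4, b5, b6, b7, b8⟩
    refine ⟨u₁ + v₁, u₂ + v₂, a1.add b1, a2.add b2, a3.add b3, a4.add b4, a5.add b5, ?_, ?_, ?_⟩
    · simpa using a6.add b6
    · simpa using a7.add b7
    · simpa using a8.add b8
  zero_mem' := ⟨0, 0, isWeakDeriv_zero, isWeakDeriv_zero, memWeightedL2_zero _,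
    memWeightedL2_zero _, memWeightedL2_zero _, hasBoundaryValue_zero _, hasBoundaryValue_zero _,
    hasBoundaryValue_zero _⟩
  smul_mem' := by
    rintro c u ⟨u₁, u₂, a1, a2, a3, a4, a5, a6, a7, a8⟩
    refine ⟨c • u₁, c • u₂, a1.smul c, a2.smul c, a3.smul c, a4.smul c, a5.smul c, ?_, ?_, ?_⟩
    · simpa using a6.smul c
    · simpa using a7.smul c
    · simpa using a8.smul c

variable (𝕜) in
/-- `P_N`: (classes on `I` of) polynomials of degree at most `N`. -/
noncomputable def PN (N : ℕ) : Submodule 𝕜 (Fn 𝕜) where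
  carrier := {u | ∃ p ∈ Polynomial.degreeLE 𝕜 N, u =ᵐ[muI] fun t => p.eval (t : 𝕜)}
  add_mem' := by
    rintro u v ⟨p, hp, hu⟩ ⟨q, hq, hv⟩
    refine ⟨p + q, add_mem hp hq, ?_⟩
    filter_upwards [AEEqFun.coeFn_add u v, hu, hv] with t h1 h2 h3
    rw [h1, Pi.add_apply, h2, h3, Polynomial.eval_add]
  zero_mem' := ⟨0, zero_mem _, by
    filter_upwards [AEEqFun.coeFn_zero (μ := muI) (β := 𝕜)] with t ht
    simp [ht]⟩
  smul_mem' := by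
    rintro c u ⟨p, hp, hu⟩
    refine ⟨c • p, Submodule.smul_mem _ c hp, ?_⟩
    filter_upwards [AEEqFun.coeFn_smul c u, hu] with t h1 h2
    rw [h1, Pi.smul_apply, h2, Polynomial.eval_smul]

variable (𝕜) in
/-- `X_N = P_N ∩ H²_{0,ω,l}(I)`. -/
noncomputable def XN (N : ℕ) : Submodule 𝕜 (Fn 𝕜) := PN 𝕜 N ⊓ H2 𝕜

/-- The weighted inner product `(f, g)_{ω^p} = ∫_I (1+t)^p f(t) conj(g(t)) dt`. -/
noncomputable def wInner (p : ℤ) (f g : ℝ → 𝕜) : 𝕜 :=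
  ∫ t in I, (((1 + t) ^ p : ℝ) : 𝕜) * (f t * conj (g t))

/-- The operator `L_l u = (1+t)^{-2} ∂_t((1+t)^2 ∂_t u) - l(l+1)(1+t)^{-2} u`, with the first term
written out as `∂_t² u + 2 (1+t)^{-1} ∂_t u`. -/
noncomputable def L (l : ℕ) (u : Fn 𝕜) (t : ℝ) : 𝕜 :=
  wderiv (wderiv u) t + ((2 / (1 + t) : ℝ) : 𝕜) * wderiv u t
    - ((l * (l + 1) / (1 + t) ^ 2 : ℝ) : 𝕜) * u t

/-- The form
`A_τ(u,v) = ((n-1)⁻¹ (L_l + R²τ/4) u, (L_l + R²τ/4) v)_{ω²} + τ² (R²/4)² (u, v)_{ω²}`. -/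
noncomputable def A (l : ℕ) (R τ : ℝ) (n : ℝ → ℝ) (u v : Fn 𝕜) : 𝕜 :=
  wInner 2 (fun t => ((1 / (n t - 1) : ℝ) : 𝕜) * (L l u t + ((R ^ 2 / 4 * τ : ℝ) : 𝕜) * u t))
      (fun t => L l v t + ((R ^ 2 / 4 * τ : ℝ) : 𝕜) * v t)
    + ((τ ^ 2 * (R ^ 2 / 4) ^ 2 : ℝ) : 𝕜) * wInner 2 u v

/-- The form `B(u,v) = (R²/4) ((∂_t u, ∂_t v)_{ω²} + l(l+1) (u, v))`. -/
noncomputable def B (l : ℕ) (R : ℝ) (u v : Fn 𝕜) : 𝕜 :=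
  ((R ^ 2 / 4 : ℝ) : 𝕜) *
    (wInner 2 (wderiv u) (wderiv v) + ((l * (l + 1) : ℝ) : 𝕜) * wInner 0 u v)

/-- `w` solves the eigenvalue equation `a(w, v) = μ b(w, v)` for all `v ∈ V`. -/
def IsEigen {E : Type*} [AddCommGroup E] [Module 𝕜 E] (a b : E → E → 𝕜) (V : Submodule 𝕜 E)
    (μ : 𝕜) (w : E) : Prop :=
  w ∈ V ∧ ∀ v ∈ V, a w v = μ * b w v

/-- `lam 0 ≤ … ≤ lam (m-1)` are the first `m` eigenvalues, in ascending order and counted with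
multiplicity, of the problem `a(w, v) = μ b(w, v)` on `V`, and `u 0, …, u (m-1)` are corresponding
linearly independent eigenfunctions: an eigenfunction outside their span belongs to an eigenvalue
that is not smaller than any of the `lam i`. -/
structure IsFirstEigenpairs {E : Type*} [AddCommGroup E] [Module 𝕜 E] (a b : E → E → 𝕜)
    (V : Submodule 𝕜 E) {m : ℕ} (lam : Fin m → ℝ) (u : Fin m → E) : Prop where
  eigen : ∀ i, IsEigen a b V (lam i : 𝕜) (u i)
  linInd : LinearIndependent 𝕜 u
  mono : Monotone lam
  first : ∀ (μ : 𝕜) (w : E), IsEigen a b V μ w → w ∉ Submodule.span 𝕜 (range u) →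
    ∀ i, lam i ≤ RCLike.re μ

/-- `Pi` is the `a`-orthogonal projection of `V` onto `W`. -/
def IsOrthProj {E : Type*} [AddCommGroup E] [Module 𝕜 E] (a : E → E → 𝕜)
    (V W : Submodule 𝕜 E) (Pi : V → W) : Prop :=
  ∀ (u : V), ∀ v ∈ W, a ((u : E) - (Pi u : E)) v = 0

end TEMode

/-! Abstractly, let `a`, `b` be positive definite Hermitian forms on `V`, and let `W ≤ V` be finite
dimensional. For the lower bound, the span of the first `m` discrete eigenfunctions contains some `w
≠ 0` that is `b`-orthogonal to the first `m - 1` continuous ones, so `λ^m b(w,w) ≤ a(w,w) ≤ λ_N^m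
b(w,w)`. For the upper bound, `E_{1,m}` contains some `v ≠ 0` whose projection `Πv` is
`b`-orthogonal to the first `m - 1` discrete eigenfunctions, so `λ_N^m b(Πv,Πv) ≤ a(Πv,Πv) ≤ a(v,v)
≤ λ^m b(v,v)`; the middle step is Pythagoras. This is `ritz_eigenvalue_bounds`.

Existence of the eigenpairs, and the lower estimate of the Rayleigh quotient on an orthogonal
complement, both rest on the existence of Rayleigh minimizers (`HasMinimizers`). These come from the
direct method (`hasMinimizers_of_weak`): `a` has to be equivalent to a Hilbert norm, and `b` has to
tend to zero along bounded weakly null sequences.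

The Hilbert norm is `‖ω u''‖` in `L²(I)`. The map `u ↦ ω u''` is injective on `H2`, and its range is
the closed space of mean-zero functions (`isClosed_range_secondDeriv`). Hardy inequalities bound
`u'` and `u/ω` by `ω u''`, hence bound `A` from above (`A_bounded`). Integration by parts gives `‖ω
L_l u‖² = ‖ω u''‖² + (2 + 2a)‖u'‖² + (a² - 2a)‖u/ω‖²` with `a = l(l+1) ≥ 2`, hence `A` is coercive
(`Datum.integral_sq_le`, `A_coercive`). Finally, the values of `ω u'` and `u` at a point are
functionals of `ω u''` bounded uniformly in the point, so dominated convergence gives the weak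
continuity of `B` (`B_tendsto_zero`). -/

namespace TEMode

/-! ### Positive definite Hermitian forms on a subspace: calculus, projections, Cauchy-Schwarz. -/

section Forms

variable {𝕜 : Type*} [RCLike 𝕜] {E : Type*} [AddCommGroup E] [Module 𝕜 E]

/-- `a` is a positive definite Hermitian form on the subspace `V`. -/
structure PosForm (a : E → E → 𝕜) (V : Submodule 𝕜 E) : Prop where
  add_left : ∀ u ∈ V, ∀ v ∈ V, ∀ w ∈ V, a (u + v) w = a u w + a v w
  smul_left : ∀ (c : 𝕜), ∀ u ∈ V, ∀ w ∈ V, a (c • u) w = c * a u w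
  conj_symm : ∀ u ∈ V, ∀ v ∈ V, conj (a u v) = a v u
  pos : ∀ u ∈ V, u ≠ 0 → 0 < RCLike.re (a u u)

namespace PosForm

variable {a b : E → E → 𝕜} {V W : Submodule 𝕜 E}

theorem mono (h : PosForm a V) (hW : W ≤ V) : PosForm a W where
  add_left u hu v hv w hw := h.add_left u (hW hu) v (hW hv) w (hW hw)
  smul_left c u hu w hw := h.smul_left c u (hW hu) w (hW hw)
  conj_symm u hu v hv := h.conj_symm u (hW hu) v (hW hv)
  pos u hu := h.pos u (hW hu)

theorem zero_left (h : PosForm a V) {w : E} (hw : w ∈ V) : a 0 w = 0 := by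
  have := h.smul_left 0 0 V.zero_mem w hw
  simpa using this

theorem zero_right (h : PosForm a V) {w : E} (hw : w ∈ V) : a w 0 = 0 := by
  rw [← h.conj_symm 0 V.zero_mem w hw, h.zero_left hw, map_zero]

theorem sub_left (h : PosForm a V) {u v w : E} (hu : u ∈ V) (hv : v ∈ V) (hw : w ∈ V) :
    a (u - v) w = a u w - a v w := by
  have e : u - v = u + (-1 : 𝕜) • v := by simp [sub_eq_add_neg]
  rw [e, h.add_left u hu _ (V.smul_mem _ hv) w hw, h.smul_left _ v hv w hw]
  ring

theorem add_right (h : PosForm a V) {u v w : E} (hu : u ∈ V) (hv : v ∈ V) (hw : w ∈ V) :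
    a w (u + v) = a w u + a w v := by
  rw [← h.conj_symm _ (V.add_mem hu hv) w hw, h.add_left u hu v hv w hw, map_add,
    h.conj_symm u hu w hw, h.conj_symm v hv w hw]

theorem sub_right (h : PosForm a V) {u v w : E} (hu : u ∈ V) (hv : v ∈ V) (hw : w ∈ V) :
    a w (u - v) = a w u - a w v := by
  rw [← h.conj_symm _ (V.sub_mem hu hv) w hw, h.sub_left hu hv hw, map_sub,
    h.conj_symm u hu w hw, h.conj_symm v hv w hw]

theorem smul_right (h : PosForm a V) (c : 𝕜) {u w : E} (hu : u ∈ V) (hw : w ∈ V) :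
    a w (c • u) = conj c * a w u := by
  rw [← h.conj_symm _ (V.smul_mem c hu) w hw, h.smul_left c u hu w hw, map_mul,
    h.conj_symm u hu w hw]

theorem sum_left (h : PosForm a V) {ι : Type*} (s : Finset ι) (f : ι → E) (hf : ∀ i, f i ∈ V)
    {w : E} (hw : w ∈ V) : a (∑ i ∈ s, f i) w = ∑ i ∈ s, a (f i) w := by
  classical
  induction s using Finset.induction_on with
  | empty => simp [h.zero_left hw]
  | insert i s hi ih =>
    rw [Finset.sum_insert hi, Finset.sum_insert hi,
      h.add_left _ (hf i) _ (V.sum_mem fun j _ => hf j) w hw, ih]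

theorem sum_right (h : PosForm a V) {ι : Type*} (s : Finset ι) (f : ι → E) (hf : ∀ i, f i ∈ V)
    {w : E} (hw : w ∈ V) : a w (∑ i ∈ s, f i) = ∑ i ∈ s, a w (f i) := by
  rw [← h.conj_symm _ (V.sum_mem fun j _ => hf j) w hw, h.sum_left s f hf hw, map_sum]
  exact Finset.sum_congr rfl fun i _ => h.conj_symm _ (hf i) w hw

theorem ofReal_re (h : PosForm a V) {u : E} (hu : u ∈ V) : ((RCLike.re (a u u) : ℝ) : 𝕜) = a u u :=
  RCLike.conj_eq_iff_re.mp (h.conj_symm u hu u hu)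

theorem nonneg (h : PosForm a V) {u : E} (hu : u ∈ V) : 0 ≤ RCLike.re (a u u) := by
  by_cases h0 : u = 0
  · simp [h0, h.zero_left V.zero_mem]
  · exact (h.pos u hu h0).le

theorem eq_zero (h : PosForm a V) {u : E} (hu : u ∈ V) (h0 : a u u = 0) : u = 0 := by
  by_contra hne
  have := h.pos u hu hne
  simp [h0] at this

theorem symm_zero (h : PosForm a V) {u v : E} (hu : u ∈ V) (hv : v ∈ V) (h0 : a u v = 0) :
    a v u = 0 := by
  rw [← h.conj_symm u hu v hv, h0, map_zero]

theorem span_le {ι : Type*} {u : ι → E} (hu : ∀ i, u i ∈ V) : Submodule.span 𝕜 (range u) ≤ V :=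
  Submodule.span_le.mpr (by rintro _ ⟨i, rfl⟩; exact hu i)

theorem span_right_zero (h : PosForm a V) {ι : Type*} {u : ι → E} (hu : ∀ i, u i ∈ V) {v : E}
    (hv : v ∈ V) (h0 : ∀ i, a v (u i) = 0) {w : E} (hw : w ∈ Submodule.span 𝕜 (range u)) :
    a v w = 0 := by
  induction hw using Submodule.span_induction with
  | mem x hx => obtain ⟨i, rfl⟩ := hx; exact h0 i
  | zero => exact h.zero_right hv
  | add x y hx hy h1 h2 => rw [h.add_right (span_le hu hx) (span_le hu hy) hv, h1, h2, add_zero]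
  | smul c x hx h1 => rw [h.smul_right c (span_le hu hx) hv, h1, mul_zero]

/-- Existence and uniqueness of the `a`-orthogonal projection onto a finite dimensional space. -/
theorem exists_proj (h : PosForm a V) (hW : W ≤ V) [FiniteDimensional 𝕜 W] {u : E} (hu : u ∈ V) :
    ∃ p : W, ∀ v ∈ W, a (u - p) v = 0 := by
  let e := Module.finBasis 𝕜 W
  let T : W →ₗ[𝕜] (Fin (Module.finrank 𝕜 W) → 𝕜) :=
    { toFun := fun w i => a w (e i)
      map_add' := fun x y => by
        ext i
        exact h.add_left _ (hW x.2) _ (hW y.2) _ (hW (e i).2)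
      map_smul' := fun c x => by
        ext i
        exact h.smul_left c _ (hW x.2) _ (hW (e i).2) }
  have key : ∀ x ∈ V, (∀ i, a x (e i) = 0) → ∀ v ∈ W, a x v = 0 := by
    intro x hx h0 v hv
    have hv' : v = ((∑ i, e.repr ⟨v, hv⟩ i • e i : W) : E) := by rw [e.sum_repr]
    rw [hv', Submodule.coe_sum, h.sum_right _ _ (fun i => hW (Submodule.coe_mem _)) hx]
    refine Finset.sum_eq_zero fun i _ => ?_
    rw [Submodule.coe_smul, h.smul_right _ (hW (e i).2) hx, h0, mul_zero]
  -- A vector of `W` whose pairings with the basis all vanish is `a`-orthogonal to itself; equality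
  -- of dimensions then makes `T` onto.
  have inj : Function.Injective T := by
    rw [← LinearMap.ker_eq_bot, LinearMap.ker_eq_bot']
    intro x hx
    have := key x (hW x.2) (fun i => congrFun hx i) x x.2
    exact Subtype.ext (h.eq_zero (hW x.2) this)
  have surj : Function.Surjective T :=
    (LinearMap.injective_iff_surjective_of_finrank_eq_finrank (by simp)).mp inj
  obtain ⟨p, hp⟩ := surj fun i => a u (e i)
  refine ⟨p, key _ (V.sub_mem hu (hW p.2)) fun i => ?_⟩
  rw [h.sub_left hu (hW p.2) (hW (e i).2), ← congrFun hp i]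
  exact sub_self _

theorem proj_unique (h : PosForm a V) (hW : W ≤ V) {u : E} (hu : u ∈ V) {p q : W}
    (hp : ∀ v ∈ W, a (u - p) v = 0) (hq : ∀ v ∈ W, a (u - q) v = 0) : p = q := by
  have h1 : ((p : E) - q) ∈ W := W.sub_mem p.2 q.2
  have h2 : a ((p : E) - q) ((p : E) - q) = 0 := by
    have e : (p : E) - q = (u - q) - (u - p) := by abel
    nth_rw 1 [e]
    rw [h.sub_left (V.sub_mem hu (hW q.2)) (V.sub_mem hu (hW p.2)) (hW h1), hp _ h1, hq _ h1,
      sub_zero]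
  exact Subtype.ext (sub_eq_zero.mp (h.eq_zero (hW h1) h2))

/-- The Cauchy-Schwarz inequality. -/
theorem norm_sq_le (h : PosForm a V) {u v : E} (hu : u ∈ V) (hv : v ∈ V) :
    ‖a u v‖ ^ 2 ≤ RCLike.re (a u u) * RCLike.re (a v v) := by
  by_cases h0 : v = 0
  · simp [h0, h.zero_right hu, h.zero_right V.zero_mem]
  have hp := h.pos v hv h0
  -- With this `c`, the vector `u - c • v` is `a`-orthogonal to `v`.
  set c : 𝕜 := a u v / a v v with hc
  have hne : a v v ≠ 0 := fun h1 => h0 (h.eq_zero hv h1)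
  have hcv : c • v ∈ V := V.smul_mem c hv
  have h1 := h.nonneg (V.sub_mem hu hcv)
  have h2 : a (u - c • v) (u - c • v) = a u u - a u v * conj (a u v) / a v v := by
    have hs : a v u = conj (a u v) := (h.conj_symm u hu v hv).symm
    have hr : conj (a v v) = a v v := h.conj_symm v hv v hv
    rw [h.sub_left hu hcv (V.sub_mem hu hcv), h.sub_right hu hcv hu, h.sub_right hu hcv hcv,
      h.smul_right c hv hu, h.smul_right c hv hcv, h.smul_left c v hv u hu,
      h.smul_left c v hv v hv, hs, hc, map_div₀, hr]
    field_simp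
    ring
  rw [h2, RCLike.mul_conj, ← h.ofReal_re hv, map_sub] at h1
  have h3 : RCLike.re (((‖a u v‖ : 𝕜) ^ 2 / ((RCLike.re (a v v) : ℝ) : 𝕜))) =
      ‖a u v‖ ^ 2 / RCLike.re (a v v) := by
    rw [← RCLike.ofReal_pow, ← RCLike.ofReal_div, RCLike.ofReal_re]
  rw [h3, sub_nonneg, div_le_iff₀ hp] at h1
  exact h1

end PosForm

/-- A quadratic expression `t c + t² d` that is nonnegative for all real `t` has `c = 0`. -/
theorem eq_zero_of_forall_quadratic_nonneg {c d : ℝ} (h : ∀ t : ℝ, 0 ≤ t * c + t ^ 2 * d) :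
    c = 0 := by
  -- Since the constant term is zero, the discriminant is `c²`.
  have h1 := discrim_le_zero (a := d) (b := c) (c := 0) fun t => by linarith [h t]
  simp only [discrim] at h1
  nlinarith [sq_nonneg c]

/-- For each finite family `f` in `V`, the Rayleigh quotient `a(v, v) / b(v, v)` has a minimizer
on the `b`-orthogonal complement of `f` in `V`, unless this complement is zero. -/
def HasMinimizers (a b : E → E → 𝕜) (V : Submodule 𝕜 E) : Prop :=
  ∀ (k : ℕ) (f : Fin k → E), (∀ i, f i ∈ V) → (∃ v ∈ V, v ≠ 0 ∧ ∀ i, b v (f i) = 0) →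
    ∃ v ∈ V, v ≠ 0 ∧ (∀ i, b v (f i) = 0) ∧ ∀ w ∈ V, (∀ i, b w (f i) = 0) →
      RCLike.re (a v v) * RCLike.re (b w w) ≤ RCLike.re (a w w) * RCLike.re (b v v)

/-! ### Eigenpairs and Rayleigh quotients. -/

section Eigen

variable {a b : E → E → 𝕜} {V W : Submodule 𝕜 E}

/-- Testing the eigenvalue equation with `w` itself identifies the eigenvalue with the Rayleigh
quotient of `w`. -/
theorem IsEigen.eq_ofReal (ha : PosForm a V) (hb : PosForm b V) {μ : 𝕜} {w : E}
    (h : IsEigen a b V μ w) (hw : w ≠ 0) :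
    0 < RCLike.re (a w w) / RCLike.re (b w w) ∧
      μ = ((RCLike.re (a w w) / RCLike.re (b w w) : ℝ) : 𝕜) := by
  have h1 := ha.pos w h.1 hw
  have h2 := hb.pos w h.1 hw
  refine ⟨div_pos h1 h2, ?_⟩
  rw [RCLike.ofReal_div, ha.ofReal_re h.1, hb.ofReal_re h.1, h.2 w h.1, mul_div_cancel_right₀]
  exact fun h3 => hw (hb.eq_zero h.1 h3)

theorem IsEigen.orth (ha : PosForm a V) (hb : PosForm b V) {x y : ℝ} {v w : E}
    (hv : IsEigen a b V (x : 𝕜) v) (hw : IsEigen a b V (y : 𝕜) w) (hxy : x ≠ y) : b v w = 0 := by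
  have h1 : (x : 𝕜) * b v w = y * b v w := by
    rw [← hv.2 w hw.1, ← ha.conj_symm w hw.1 v hv.1, hw.2 v hv.1, map_mul, RCLike.conj_ofReal,
      hb.conj_symm w hw.1 v hv.1]
  have h2 : ((x : 𝕜) - y) * b v w = 0 := by rw [sub_mul, h1, sub_self]
  refine (mul_eq_zero.mp h2).resolve_left fun h3 => hxy ?_
  exact_mod_cast sub_eq_zero.mp h3

/-- A minimizer of the Rayleigh quotient on the `b`-orthogonal complement of eigenvectors is an
eigenvector. -/
theorem isEigen_of_minimizer (ha : PosForm a V) (hb : PosForm b V) {k : ℕ} {f : Fin k → E}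
    {lam : Fin k → ℝ} (hf : ∀ i, IsEigen a b V (lam i : 𝕜) (f i)) {v : E} (hv : v ∈ V)
    (hv0 : v ≠ 0) (hvf : ∀ i, b v (f i) = 0)
    (hmin : ∀ w ∈ V, (∀ i, b w (f i) = 0) →
      RCLike.re (a v v) * RCLike.re (b w w) ≤ RCLike.re (a w w) * RCLike.re (b v v)) :
    IsEigen a b V ((RCLike.re (a v v) / RCLike.re (b v v) : ℝ) : 𝕜) v := by
  refine ⟨hv, ?_⟩
  set μ : ℝ := RCLike.re (a v v) / RCLike.re (b v v) with hμ
  have hbv := hb.pos v hv hv0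
  have hμv : RCLike.re (a v v) = μ * RCLike.re (b v v) := by rw [hμ]; field_simp
  have hfV : ∀ i, f i ∈ V := fun i => (hf i).1
  have hmin' : ∀ w ∈ V, (∀ i, b w (f i) = 0) →
      0 ≤ RCLike.re (a w w) - μ * RCLike.re (b w w) := by
    intro w hw hwf
    have h1 := hmin w hw hwf
    rw [hμv] at h1
    nlinarith
  -- First variation: along `v + t w` with real `t`, the nonnegative quantity `a - μ b` has no
  -- constant term, so its linear coefficient vanishes.
  have key : ∀ w ∈ V, (∀ i, b w (f i) = 0) → RCLike.re (a v w - μ * b v w) = 0 := by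
    intro w hw hwf
    refine (mul_eq_zero.mp (eq_zero_of_forall_quadratic_nonneg
      (c := 2 * RCLike.re (a v w - μ * b v w))
      (d := RCLike.re (a w w) - μ * RCLike.re (b w w)) fun t => ?_)).resolve_left two_ne_zero
    have htw : (t : 𝕜) • w ∈ V := V.smul_mem _ hw
    have h1 := hmin' (v + (t : 𝕜) • w) (V.add_mem hv htw) fun i => by
      rw [hb.add_left _ hv _ htw _ (hfV i), hb.smul_left _ _ hw _ (hfV i), hvf, hwf]
      simp
    have expand : ∀ c : E → E → 𝕜, PosForm c V → RCLike.re (c (v + (t : 𝕜) • w) (v + (t : 𝕜) • w))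
        = RCLike.re (c v v) + 2 * t * RCLike.re (c v w) + t ^ 2 * RCLike.re (c w w) := by
      intro c hc
      have hs : RCLike.re (c w v) = RCLike.re (c v w) := by
        rw [← hc.conj_symm v hv w hw, RCLike.conj_re]
      rw [hc.add_left _ hv _ htw _ (V.add_mem hv htw), hc.add_right hv htw hv,
        hc.add_right hv htw htw, hc.smul_right _ hw hv, hc.smul_right _ hw htw,
        hc.smul_left _ _ hw _ hv, hc.smul_left _ _ hw _ hw, RCLike.conj_ofReal]
      simp only [map_add, RCLike.re_ofReal_mul, hs]
      ring
    rw [expand a ha, expand b hb] at h1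
    simp only [map_sub, RCLike.re_ofReal_mul]
    rw [hμv] at h1
    linarith
  have key2 : ∀ w ∈ V, (∀ i, b w (f i) = 0) → a v w - μ * b v w = 0 := by
    intro w hw hwf
    set z := a v w - μ * b v w with hz
    have hzw : (z : 𝕜) • w ∈ V := V.smul_mem _ hw
    -- The test vector `z • w` turns the real part into `conj z * z = ‖z‖²`, so `z` itself vanishes.
    have h1 := key (z • w) hzw fun i => by rw [hb.smul_left _ _ hw _ (hfV i), hwf, mul_zero]
    rw [ha.smul_right _ hw hv, hb.smul_right _ hw hv] at h1
    have h2 : conj z * a v w - (μ : 𝕜) * (conj z * b v w) = conj z * z := by rw [hz]; ring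
    rw [h2, RCLike.conj_mul, ← RCLike.ofReal_pow, RCLike.ofReal_re] at h1
    exact norm_eq_zero.mp (pow_eq_zero_iff two_ne_zero |>.mp h1)
  have hspan := PosForm.span_le hfV
  have : FiniteDimensional 𝕜 (Submodule.span 𝕜 (range f)) :=
    FiniteDimensional.span_of_finite 𝕜 (finite_range f)
  intro w hw
  -- A general test vector splits into a part `b`-orthogonal to the `f i`, covered by `key2`, and a
  -- part `p` in their span. Since the `f i` are eigenvectors `b`-orthogonal to `v`, both `a v p`
  -- and `b v p` vanish.
  obtain ⟨p, hp⟩ := hb.exists_proj hspan hw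
  have hpV := hspan p.2
  have hd : w - p ∈ V := V.sub_mem hw hpV
  have h1 := key2 (w - p) hd fun i => hp _ (Submodule.subset_span ⟨i, rfl⟩)
  have h2 : b v p = 0 := hb.span_right_zero hfV hv hvf p.2
  have h3 : a v p = 0 := ha.span_right_zero hfV hv (fun i => ?_) p.2
  · rw [ha.sub_right hw hpV hv, hb.sub_right hw hpV hv, h2, h3, sub_zero, sub_zero] at h1
    exact sub_eq_zero.mp h1
  · apply ha.symm_zero (hfV i) hv
    rw [(hf i).2 v hv, hb.symm_zero hv (hfV i) (hvf i), mul_zero]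

namespace IsFirstEigenpairs

variable {m : ℕ} {lam : Fin m → ℝ} {u : Fin m → E}

theorem mem (h : IsFirstEigenpairs a b V lam u) (i : Fin m) : u i ∈ V := (h.eigen i).1

theorem pos (ha : PosForm a V) (hb : PosForm b V) (h : IsFirstEigenpairs a b V lam u)
    (i : Fin m) : 0 < lam i := by
  obtain ⟨h1, h2⟩ := (h.eigen i).eq_ofReal ha hb (h.linInd.ne_zero i)
  have h3 : lam i = _ := RCLike.ofReal_injective h2
  exact h3 ▸ h1

/-- On the `b`-orthogonal complement of the first `m - 1` eigenfunctions the Rayleigh quotient is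
at least the `m`-th eigenvalue. -/
theorem le_rayleigh (ha : PosForm a V) (hb : PosForm b V) (hmin : HasMinimizers a b V)
    (h : IsFirstEigenpairs a b V lam u) (hm : 1 ≤ m) {w : E} (hw : w ∈ V)
    (hwu : ∀ i : Fin (m - 1), b w (u ⟨i, by omega⟩) = 0) :
    lam ⟨m - 1, by omega⟩ * RCLike.re (b w w) ≤ RCLike.re (a w w) := by
  by_cases hw0 : w = 0
  · simp [hw0, ha.zero_left V.zero_mem, hb.zero_left V.zero_mem]
  obtain ⟨v, hv, hv0, hvf, hvm⟩ := hmin (m - 1) (fun i => u ⟨i, by omega⟩) (fun i => h.mem _)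
    ⟨w, hw, hw0, hwu⟩
  have hev := isEigen_of_minimizer ha hb (fun i => h.eigen _) hv hv0 hvf hvm
  have hbv := hb.pos v hv hv0
  have hbw := hb.nonneg hw
  set μ : ℝ := RCLike.re (a v v) / RCLike.re (b v v) with hμ
  have hμv : RCLike.re (a v v) = μ * RCLike.re (b v v) := by rw [hμ]; field_simp
  -- If `μ` were below the `m`-th eigenvalue, `first` would put `v` in the span of all the `u i`.
  -- But `v` is `b`-orthogonal to the first `m - 1` by construction and to the last because the
  -- eigenvalues differ, so `v = 0`.
  have hle : lam ⟨m - 1, by omega⟩ ≤ μ := by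
    by_contra! hlt
    have hmem : v ∈ Submodule.span 𝕜 (range u) := by
      by_contra hn
      have := h.first _ v hev hn ⟨m - 1, by omega⟩
      rw [RCLike.ofReal_re] at this
      linarith
    have hz : ∀ i, b v (u i) = 0 := by
      intro i
      by_cases hi : i.1 < m - 1
      · exact hvf ⟨i, hi⟩
      · have : i = ⟨m - 1, by omega⟩ := Fin.ext (by simp only; omega)
        rw [this]
        exact hev.orth ha hb (h.eigen _) hlt.ne
    exact hv0 (hb.eq_zero hv (hb.span_right_zero h.mem hv hz hmem))
  have h1 := hvm w hw hwu
  rw [hμv] at h1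
  have h2 : μ * RCLike.re (b w w) ≤ RCLike.re (a w w) := by
    refine le_of_mul_le_mul_right ?_ hbv
    linarith
  nlinarith

/-- On the span of the first `m` eigenfunctions the Rayleigh quotient is at most the `m`-th
eigenvalue. -/
theorem rayleigh_le (ha : PosForm a V) (hb : PosForm b V) (h : IsFirstEigenpairs a b V lam u)
    (hm : 1 ≤ m) {w : E} (hw : w ∈ Submodule.span 𝕜 (range u)) :
    RCLike.re (a w w) ≤ lam ⟨m - 1, by omega⟩ * RCLike.re (b w w) := by
  set M := lam ⟨m - 1, by omega⟩ with hM
  have hle : ∀ i, lam i ≤ M := fun i => h.mono (Fin.mk_le_mk.mpr (by omega))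
  obtain ⟨c, rfl⟩ := (Submodule.mem_span_range_iff_exists_fun 𝕜).mp hw
  have hcu : ∀ (d : Fin m → 𝕜) i, d i • u i ∈ V := fun d i => V.smul_mem _ (h.mem i)
  have expand : ∀ (f : E → E → 𝕜), PosForm f V → ∀ d : Fin m → 𝕜,
      f (∑ i, d i • u i) (∑ i, d i • u i) = ∑ i, ∑ j, d i * conj (d j) * f (u i) (u j) := by
    intro f hf d
    rw [hf.sum_left _ _ (hcu d) (V.sum_mem fun i _ => hcu d i)]
    refine Finset.sum_congr rfl fun i _ => ?_
    rw [hf.sum_right _ _ (hcu d) (hcu d i)]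
    refine Finset.sum_congr rfl fun j _ => ?_
    rw [hf.smul_left _ _ (h.mem i) _ (hcu d j), hf.smul_right _ (h.mem j) (h.mem i)]
    ring
  have h1 := hb.nonneg (V.sum_mem (t := Finset.univ)
    fun i _ => hcu (fun i => ((√(M - lam i) : ℝ) : 𝕜) * c i) i)
  -- The difference is `b` evaluated at the vector with coefficients `√(M - λ_i) c_i`. The `u i`
  -- need not be `b`-orthogonal within an eigenspace: a cross term can survive only when `λ_i =
  -- λ_j`, and then the two square roots multiply to `M - λ_j`.
  have h2 : (M : 𝕜) * b (∑ i, c i • u i) (∑ i, c i • u i) - a (∑ i, c i • u i) (∑ i, c i • u i)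
      = b (∑ i, (((√(M - lam i) : ℝ) : 𝕜) * c i) • u i)
          (∑ i, (((√(M - lam i) : ℝ) : 𝕜) * c i) • u i) := by
    rw [expand a ha, expand b hb, expand b hb, Finset.mul_sum, ← Finset.sum_sub_distrib]
    refine Finset.sum_congr rfl fun i _ => ?_
    rw [Finset.mul_sum, ← Finset.sum_sub_distrib]
    refine Finset.sum_congr rfl fun j _ => ?_
    rw [(h.eigen i).2 _ (h.mem j)]
    by_cases hij : lam i = lam j
    · have hs : ((√(M - lam j) : ℝ) : 𝕜) * ((√(M - lam j) : ℝ) : 𝕜) = (M : 𝕜) - lam j := by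
        rw [← RCLike.ofReal_mul, Real.mul_self_sqrt (by linarith [hle j]), RCLike.ofReal_sub]
      rw [hij, map_mul, RCLike.conj_ofReal]
      linear_combination (-c i * conj (c j) * b (u i) (u j)) * hs
    · rw [(h.eigen i).orth ha hb (h.eigen j) hij]
      ring
  rw [← h2, map_sub, RCLike.re_ofReal_mul] at h1
  linarith

end IsFirstEigenpairs

/-- Fewer linear conditions than parameters have a common nontrivial solution. -/
theorem exists_ne_zero_of_lt {k m : ℕ} (hkm : k < m) (T : (Fin m → 𝕜) →ₗ[𝕜] (Fin k → 𝕜)) :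
    ∃ c : Fin m → 𝕜, c ≠ 0 ∧ T c = 0 := by
  by_contra! hn
  have : Function.Injective T := by
    rw [← LinearMap.ker_eq_bot, LinearMap.ker_eq_bot']
    intro c hc
    by_contra h0
    exact hn c h0 hc
  have := LinearMap.finrank_le_finrank_of_injective this
  simp at this
  omega

/-- Orthogonality to `k` vectors imposes `k` linear conditions on `m > k` coefficients. This serves
both to keep complements nonzero in the construction of eigenpairs and to choose the trial function
for the lower bound. -/
theorem exists_orth_mem_span (hb : PosForm b V) {m k : ℕ} (hkm : k < m) {e : Fin m → E}
    (he : ∀ i, e i ∈ V) (hli : LinearIndependent 𝕜 e) {f : Fin k → E} (hf : ∀ i, f i ∈ V) :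
    ∃ v ∈ Submodule.span 𝕜 (range e), v ≠ 0 ∧ ∀ i, b v (f i) = 0 := by
  obtain ⟨c, hc, h0⟩ := exists_ne_zero_of_lt hkm
    (LinearMap.pi fun j => ∑ i, (b (e i) (f j)) • LinearMap.proj (R := 𝕜) (φ := fun _ => 𝕜) i)
  refine ⟨∑ i, c i • e i, (Submodule.mem_span_range_iff_exists_fun 𝕜).mpr ⟨c, rfl⟩, ?_, ?_⟩
  · intro h1
    exact hc (funext (Fintype.linearIndependent_iff.mp hli c h1))
  · intro j
    have h1 := congrFun h0 j
    rw [hb.sum_left _ _ (fun i => V.smul_mem _ (he i)) (hf j)]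
    simp only [LinearMap.pi_apply, LinearMap.sum_apply, LinearMap.smul_apply, LinearMap.proj_apply,
      smul_eq_mul, Pi.zero_apply] at h1
    rw [← h1]
    refine Finset.sum_congr rfl fun i _ => ?_
    rw [hb.smul_left _ _ (he i) _ (hf j), mul_comm]

/-- Greedy construction: each new eigenvector minimizes the Rayleigh quotient on the `b`-orthogonal
complement of its predecessors. The independent family `e` only ensures that this complement is
nonzero. The last clause records the minimality, which the induction needs for monotonicity. -/
theorem exists_orthogonal_eigenpairs (ha : PosForm a V) (hb : PosForm b V)
    (hmin : HasMinimizers a b V) {m : ℕ} {e : Fin m → E} (he : ∀ i, e i ∈ V)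
    (hli : LinearIndependent 𝕜 e) (k : ℕ) (hk : k ≤ m) :
    ∃ (lam : Fin k → ℝ) (u : Fin k → E), (∀ i, IsEigen a b V (lam i : 𝕜) (u i)) ∧
      (∀ i, u i ≠ 0) ∧ (∀ i j, i ≠ j → b (u i) (u j) = 0) ∧ Monotone lam ∧
      ∀ i, ∀ v ∈ V, (∀ j, j < i → b v (u j) = 0) →
        lam i * RCLike.re (b v v) ≤ RCLike.re (a v v) := by
  induction k with
  | zero => exact ⟨fun _ => 0, fun _ => 0, fun i => i.elim0, fun i => i.elim0, fun i => i.elim0,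
      fun i => i.elim0, fun i => i.elim0⟩
  | succ k ih =>
    obtain ⟨lam, u, h1, h2, h3, h4, h5⟩ := ih (by omega)
    have huV : ∀ i, u i ∈ V := fun i => (h1 i).1
    obtain ⟨x, hx, hx0, hxu⟩ := exists_orth_mem_span hb (by omega) he hli huV
    obtain ⟨v, hv, hv0, hvf, hvm⟩ := hmin k u huV ⟨x, PosForm.span_le he hx, hx0, hxu⟩
    have hev := isEigen_of_minimizer ha hb h1 hv hv0 hvf hvm
    have hbv := hb.pos v hv hv0
    set μ : ℝ := RCLike.re (a v v) / RCLike.re (b v v) with hμ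
    have hμv : RCLike.re (a v v) = μ * RCLike.re (b v v) := by rw [hμ]; field_simp
    refine ⟨Fin.snoc (α := fun _ => ℝ) lam μ, Fin.snoc (α := fun _ => E) u v, ?_, ?_, ?_, ?_, ?_⟩
    · intro i
      refine Fin.lastCases ?_ (fun i => ?_) i
      · simpa using hev
      · simpa using h1 i
    · intro i
      refine Fin.lastCases ?_ (fun i => ?_) i
      · simpa using hv0
      · simpa using h2 i
    · intro i j
      refine Fin.lastCases ?_ (fun i => ?_) i <;> refine Fin.lastCases ?_ (fun j => ?_) j
      · simp
      · intro _
        simpa using hvf j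
      · intro _
        simpa using hb.symm_zero hv (huV i) (hvf i)
      · intro hij
        simpa using h3 i j (fun h => hij (by rw [h]))
    · intro i j
      refine Fin.lastCases ?_ (fun i => ?_) i <;> refine Fin.lastCases ?_ (fun j => ?_) j
      · simp
      · intro hij
        exact absurd hij (not_le.mpr (Fin.castSucc_lt_last j))
      · intro _
        -- The new minimizer was already admissible when the `i`-th eigenvalue was chosen.
        have := h5 i v hv fun j _ => hvf j
        rw [hμv] at this
        simpa using le_of_mul_le_mul_right this hbv
      · intro hij
        simpa using h4 (Fin.castSucc_le_castSucc_iff.mp hij)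
    · intro i
      refine Fin.lastCases ?_ (fun i => ?_) i
      · intro w hw hwu
        have := hvm w hw fun i => by simpa using hwu i.castSucc (Fin.castSucc_lt_last i)
        rw [hμv] at this
        simp only [Fin.snoc_last]
        refine le_of_mul_le_mul_right ?_ hbv
        linarith
      · intro w hw hwu
        simp only [Fin.snoc_castSucc]
        exact h5 i w hw fun j hj => by
          simpa using hwu j.castSucc (Fin.castSucc_lt_castSucc_iff.mpr hj)

theorem exists_isFirstEigenpairs (ha : PosForm a V) (hb : PosForm b V)
    (hmin : HasMinimizers a b V) {m : ℕ} {e : Fin m → E} (he : ∀ i, e i ∈ V)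
    (hli : LinearIndependent 𝕜 e) :
    ∃ (lam : Fin m → ℝ) (u : Fin m → E), IsFirstEigenpairs a b V lam u := by
  obtain ⟨lam, u, h1, h2, h3, h4, h5⟩ := exists_orthogonal_eigenpairs ha hb hmin he hli m le_rfl
  have huV : ∀ i, u i ∈ V := fun i => (h1 i).1
  refine ⟨lam, u, ⟨h1, ?_, h4, ?_⟩⟩
  · rw [Fintype.linearIndependent_iff]
    intro c hc i
    have h6 : b (∑ j, c j • u j) (u i) = c i * b (u i) (u i) := by
      rw [hb.sum_left _ _ (fun j => V.smul_mem _ (huV j)) (huV i), Finset.sum_eq_single i]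
      · rw [hb.smul_left _ _ (huV i) _ (huV i)]
      · intro j _ hj
        rw [hb.smul_left _ _ (huV j) _ (huV i), h3 j i hj, mul_zero]
      · simp
    rw [hc, hb.zero_left (huV i)] at h6
    exact (mul_eq_zero.mp h6.symm).resolve_right fun h => h2 i (hb.eq_zero (huV i) h)
  · intro μ w hw hws i
    have hspan := PosForm.span_le (V := V) huV
    have : FiniteDimensional 𝕜 (Submodule.span 𝕜 (range u)) :=
      FiniteDimensional.span_of_finite 𝕜 (finite_range u)
    obtain ⟨p, hp⟩ := hb.exists_proj hspan hw.1
    have hpV := hspan p.2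
    have hdV : w - p ∈ V := V.sub_mem hw.1 hpV
    have hd0 : w - p ≠ 0 := fun h => hws (by rw [sub_eq_zero.mp h]; exact p.2)
    have hbd := hb.pos _ hdV hd0
    have hw0 : w ≠ 0 := fun h => hws (h ▸ Submodule.zero_mem _)
    obtain ⟨-, hμ⟩ := hw.eq_ofReal ha hb hw0
    have h6 : ∀ j, b (w - p) (u j) = 0 := fun j => hp _ (Submodule.subset_span ⟨j, rfl⟩)
    have h7 : b (w - p) p = 0 := hp p p.2
    have h8 : a (w - p) p = 0 := ha.span_right_zero huV hdV (fun j => by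
      apply ha.symm_zero (huV j) hdV
      rw [(h1 j).2 _ hdV, hb.symm_zero hdV (huV j) (h6 j), mul_zero]) p.2
    -- Removing from `w` its `b`-projection onto the span keeps the Rayleigh quotient equal to `μ`,
    -- and the remainder is `b`-orthogonal to every `u j`, so the minimality of each `lam i` applies
    -- to it.
    have h9 : a (w - p) (w - p) = μ * b (w - p) (w - p) := by
      rw [ha.sub_left hw.1 hpV hdV, hb.sub_left hw.1 hpV hdV, hw.2 _ hdV,
        ha.symm_zero hdV hpV h8, hb.symm_zero hdV hpV h7, sub_zero, sub_zero]
    have h10 := h5 i _ hdV fun j _ => h6 j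
    rw [h9, hμ, RCLike.re_ofReal_mul] at h10
    rw [hμ, RCLike.ofReal_re]
    exact le_of_mul_le_mul_right h10 hbd

end Eigen

end Forms

/-! ### Comparison of continuous and discrete eigenvalues. -/

section Ritz

variable {𝕜 : Type*} [RCLike 𝕜] {E : Type*} [AddCommGroup E] [Module 𝕜 E]
variable {a b : E → E → 𝕜} {V W : Submodule 𝕜 E}

theorem existsUnique_isOrthProj (ha : PosForm a V) (hW : W ≤ V) [FiniteDimensional 𝕜 W] :
    ∃! Pi : V → W, IsOrthProj a V W Pi := by
  choose p hp using fun u : V => ha.exists_proj hW u.2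
  refine ⟨p, hp, fun q hq => funext fun u => ?_⟩
  exact ha.proj_unique hW u.2 (hq u) (hp u)

/-- `Pi` is a bare function; its linearity follows from uniqueness of the projection. -/
theorem IsOrthProj.map_sum_smul (ha : PosForm a V) (hW : W ≤ V) {Pi : V → W}
    (hPi : IsOrthProj a V W Pi) {m : ℕ} (c : Fin m → 𝕜) (u : Fin m → V) :
    Pi (∑ i, c i • u i) = ∑ i, c i • Pi (u i) := by
  refine ha.proj_unique hW (∑ i, c i • u i).2 (hPi _) fun v hv => ?_
  have e : ((∑ i, c i • u i : V) : E) - ((∑ i, c i • Pi (u i) : W) : E)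
      = ∑ i, c i • ((u i : E) - Pi (u i)) := by
    simp [smul_sub, Finset.sum_sub_distrib]
  have hd : ∀ i, (u i : E) - Pi (u i) ∈ V := fun i => V.sub_mem (u i).2 (hW (Pi (u i)).2)
  rw [e, ha.sum_left _ _ (fun i => V.smul_mem _ (hd i)) (hW hv)]
  refine Finset.sum_eq_zero fun i _ => ?_
  rw [ha.smul_left _ _ (hd i) _ (hW hv), hPi (u i) v hv, mul_zero]

/-- Pythagoras for `a`: the cross terms between `Pi u` and `u - Pi u` vanish. -/
theorem IsOrthProj.rayleigh_le (ha : PosForm a V) (hW : W ≤ V) {Pi : V → W}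
    (hPi : IsOrthProj a V W Pi) (u : V) :
    RCLike.re (a (Pi u) (Pi u)) ≤ RCLike.re (a (u : E) u) := by
  have hp := hW (Pi u).2
  have hd : (u : E) - Pi u ∈ V := V.sub_mem u.2 hp
  have h1 := ha.nonneg hd
  have h2 := hPi u (Pi u) (Pi u).2
  have h3 : a (Pi u) ((u : E) - Pi u) = 0 := ha.symm_zero hd hp h2
  have h4 : a (u : E) u = a ((u : E) - Pi u) ((u : E) - Pi u) + a (Pi u) (Pi u) := by
    have e1 := ha.sub_left u.2 hp hd
    have e2 := ha.sub_right u.2 hp u.2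
    have e3 := ha.sub_left u.2 hp hp
    rw [h2] at e3
    rw [e1, h3, e2]
    linear_combination -e3
  rw [h4, map_add]
  linarith

/-- `E` carries no topology, so compactness is used in coordinates, where the form is a polynomial
in the coefficients and their conjugates. -/
theorem PosForm.continuous_sum (hb : PosForm b V) {m : ℕ} {u : Fin m → E} (hu : ∀ i, u i ∈ V) :
    Continuous fun c : Fin m → 𝕜 => RCLike.re (b (∑ i, c i • u i) (∑ i, c i • u i)) := by
  have hcu : ∀ (d : Fin m → 𝕜) i, d i • u i ∈ V := fun d i => V.smul_mem _ (hu i)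
  have e : (fun c : Fin m → 𝕜 => RCLike.re (b (∑ i, c i • u i) (∑ i, c i • u i)))
      = fun c => RCLike.re (∑ i, ∑ j, c i * (conj (c j) * b (u i) (u j))) := by
    funext d
    rw [hb.sum_left _ _ (hcu d) (V.sum_mem fun i _ => hcu d i)]
    congr 1
    refine Finset.sum_congr rfl fun i _ => ?_
    rw [hb.sum_right _ _ (hcu d) (hcu d i)]
    refine Finset.sum_congr rfl fun j _ => ?_
    rw [hb.smul_left _ _ (hu i) _ (hcu d j), hb.smul_right _ (hu j) (hu i)]
  rw [e]
  refine RCLike.continuous_re.comp ?_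
  refine continuous_finsetSum _ fun i _ => continuous_finsetSum _ fun j _ => ?_
  exact (continuous_apply i).mul
    ((RCLike.continuous_conj.comp (continuous_apply j)).mul continuous_const)

/-- The quotient of two positive definite quadratic forms on a finite dimensional space has a
maximum; here the second one is composed with a linear map and may degenerate. -/
theorem exists_isGreatest_ratio (ha : PosForm a V) (hb : PosForm b V) (hW : W ≤ V) {Pi : V → W}
    (hPi : IsOrthProj a V W Pi) {m : ℕ} (hm : 1 ≤ m) {u : Fin m → E} (hu : ∀ i, u i ∈ V)
    (hli : LinearIndependent 𝕜 u) :
    ∃ M, IsGreatest {q : ENNReal | ∃ v : V, (v : E) ∈ Submodule.span 𝕜 (Set.range u) ∧ v ≠ 0 ∧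
      q = ENNReal.ofReal (RCLike.re (b (v : E) v)) /
        ENNReal.ofReal (RCLike.re (b (Pi v : E) (Pi v)))} M := by
  by_cases hdeg : ∃ v : V, (v : E) ∈ Submodule.span 𝕜 (Set.range u) ∧ v ≠ 0 ∧ Pi v = 0
  · obtain ⟨v, hv, hv0, hpv⟩ := hdeg
    refine ⟨⊤, ⟨v, hv, hv0, ?_⟩, fun _ _ => le_top⟩
    have h0 := hb.pos v v.2 (fun h => hv0 (Subtype.ext h))
    rw [hpv, Submodule.coe_zero, hb.zero_left V.zero_mem, map_zero, ENNReal.ofReal_zero,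
      ENNReal.div_zero]
    exact (ENNReal.ofReal_pos.mpr h0).ne'
  · push Not at hdeg
    let u' : Fin m → V := fun i => ⟨u i, hu i⟩
    let x : (Fin m → 𝕜) → V := fun c => ∑ i, c i • u' i
    have hx : ∀ c, (x c : E) = ∑ i, c i • u i := fun c => by simp [x, u']
    have hpx : ∀ c, (Pi (x c) : E) = ∑ i, c i • (Pi (u' i) : E) := fun c => by
      rw [hPi.map_sum_smul ha hW]
      simp
    have hspan : ∀ c, (x c : E) ∈ Submodule.span 𝕜 (Set.range u) := fun c =>
      (Submodule.mem_span_range_iff_exists_fun 𝕜).mpr ⟨c, (hx c).symm⟩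
    have hx0 : ∀ c, c ≠ 0 → x c ≠ 0 := by
      intro c hc h0
      have h1 : ∑ i, c i • u i = 0 := by rw [← hx, h0, Submodule.coe_zero]
      exact hc (funext (Fintype.linearIndependent_iff.mp hli c h1))
    have hD : ∀ c, c ≠ 0 → 0 < RCLike.re (b (Pi (x c) : E) (Pi (x c))) := by
      intro c hc
      refine hb.pos _ (hW (Pi _).2) fun h => hdeg (x c) (hspan c) (hx0 c hc) (Subtype.ext h)
    have c1 : Continuous fun c => RCLike.re (b (x c : E) (x c)) := by
      simp_rw [hx]
      exact hb.continuous_sum hu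
    have c2 : Continuous fun c => RCLike.re (b (Pi (x c) : E) (Pi (x c))) := by
      simp_rw [hpx]
      exact hb.continuous_sum fun i => hW (Pi (u' i)).2
    have hne : (Metric.sphere (0 : Fin m → 𝕜) 1).Nonempty :=
      ⟨fun _ => 1, by
        have : Nonempty (Fin m) := ⟨⟨0, by omega⟩⟩
        simp⟩
    have hs0 : ∀ c ∈ Metric.sphere (0 : Fin m → 𝕜) 1, c ≠ 0 := by
      rintro c hc rfl
      simp at hc
    -- The quotient is invariant under scaling, so its maximum over the compact unit sphere of
    -- coefficients is the global one. The denominator is positive there because the degenerate case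
    -- was split off.
    obtain ⟨c₀, hc₀, hmax⟩ := (isCompact_sphere (0 : Fin m → 𝕜) 1).exists_isMaxOn hne
      (c1.continuousOn.div c2.continuousOn fun c hc => (hD c (hs0 c hc)).ne')
    refine ⟨_, ⟨x c₀, hspan c₀, hx0 c₀ (hs0 c₀ hc₀), rfl⟩, ?_⟩
    rintro q ⟨v, hv, hv0, rfl⟩
    obtain ⟨c, hc⟩ := (Submodule.mem_span_range_iff_exists_fun 𝕜).mp hv
    have hvx : v = x c := Subtype.ext (by rw [hx, hc])
    have hcne : c ≠ 0 := by
      rintro rfl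
      exact hv0 (by rw [hvx]; simp [x])
    have hcn : 0 < ‖c‖ := norm_pos_iff.mpr hcne
    set d : Fin m → 𝕜 := ((‖c‖⁻¹ : ℝ) : 𝕜) • c with hd
    have hds : d ∈ Metric.sphere (0 : Fin m → 𝕜) 1 := by
      rw [mem_sphere_zero_iff_norm, hd, norm_smul, RCLike.norm_ofReal, abs_of_pos (by positivity)]
      field_simp
    have hxd : (x d : E) = ((‖c‖⁻¹ : ℝ) : 𝕜) • (x c : E) := by
      rw [hx, hx, Finset.smul_sum]
      exact Finset.sum_congr rfl fun i _ => by simp [hd, smul_smul]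
    have hpd : (Pi (x d) : E) = ((‖c‖⁻¹ : ℝ) : 𝕜) • (Pi (x c) : E) := by
      rw [hpx, hpx, Finset.smul_sum]
      exact Finset.sum_congr rfl fun i _ => by simp [hd, smul_smul]
    have hscale : ∀ (r : ℝ) (y : E), y ∈ V →
        RCLike.re (b ((r : 𝕜) • y) ((r : 𝕜) • y)) = r ^ 2 * RCLike.re (b y y) := by
      intro r y hy
      rw [hb.smul_left _ _ hy _ (V.smul_mem _ hy), hb.smul_right _ hy hy, RCLike.conj_ofReal,
        RCLike.re_ofReal_mul, RCLike.re_ofReal_mul]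
      ring
    have h1 := isMaxOn_iff.mp hmax d hds
    change RCLike.re (b (x d : E) (x d)) / RCLike.re (b (Pi (x d) : E) (Pi (x d))) ≤
      RCLike.re (b (x c₀ : E) (x c₀)) / RCLike.re (b (Pi (x c₀) : E) (Pi (x c₀))) at h1
    rw [hxd, hpd, hscale _ _ (x c).2, hscale _ _ (hW (Pi (x c)).2),
      mul_div_mul_left _ _ (by positivity)] at h1
    rw [hvx, ← ENNReal.ofReal_div_of_pos (hD c hcne),
      ← ENNReal.ofReal_div_of_pos (hD c₀ (hs0 c₀ hc₀))]
    exact ENNReal.ofReal_le_ofReal h1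

/-- Each inequality compares an upper Rayleigh bound on one `m`-dimensional span with a lower
Rayleigh bound on the complement of `m - 1` eigenfunctions of the other problem. The index `m - 1`
is the zero-based position of the `m`-th eigenvalue. -/
theorem ritz_eigenvalue_bounds (ha : PosForm a V) (hb : PosForm b V) (hW : W ≤ V)
    (hminV : HasMinimizers a b V) (hminW : HasMinimizers a b W) {m : ℕ} (hm : 1 ≤ m)
    {lam lamN : Fin m → ℝ} {u uN : Fin m → E} (hV : IsFirstEigenpairs a b V lam u)
    (hN : IsFirstEigenpairs a b W lamN uN) {Pi : V → W} (hPi : IsOrthProj a V W Pi) :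
    0 < lam ⟨m - 1, by omega⟩ ∧
    lam ⟨m - 1, by omega⟩ ≤ lamN ⟨m - 1, by omega⟩ ∧
    ∃ M : ENNReal,
      IsGreatest {q : ENNReal | ∃ v : V,
        (v : E) ∈ Submodule.span 𝕜 (Set.range u) ∧ v ≠ 0 ∧
        q = ENNReal.ofReal (RCLike.re (b (v : E) v)) /
          ENNReal.ofReal (RCLike.re (b (Pi v : E) (Pi v)))} M ∧
      ENNReal.ofReal (lamN ⟨m - 1, by omega⟩) ≤ ENNReal.ofReal (lam ⟨m - 1, by omega⟩) * M := by
  have hpos := hV.pos ha hb ⟨m - 1, by omega⟩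
  have haW := ha.mono hW
  have hbW := hb.mono hW
  refine ⟨hpos, ?_, ?_⟩
  · obtain ⟨w, hw, hw0, hwu⟩ := exists_orth_mem_span hb (k := m - 1) (by omega)
      (fun i => hW (hN.mem i)) hN.linInd (f := fun i => u ⟨i, by omega⟩) fun i => hV.mem _
    have hwW := PosForm.span_le hN.mem hw
    have h1 := hV.le_rayleigh ha hb hminV hm (hW hwW) hwu
    have h2 := hN.rayleigh_le haW hbW hm hw
    exact le_of_mul_le_mul_right (h1.trans h2) (hb.pos w (hW hwW) hw0)
  · obtain ⟨M, hM⟩ := exists_isGreatest_ratio ha hb hW hPi hm hV.mem hV.linInd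
    refine ⟨M, hM, ?_⟩
    let u' : Fin m → V := fun i => ⟨u i, hV.mem i⟩
    -- The coefficients are chosen so that the projection of `∑ c_i u_i`, rather than the sum
    -- itself, is `b`-orthogonal to the first `m - 1` discrete eigenfunctions.
    obtain ⟨c, hc, h0⟩ := exists_ne_zero_of_lt (𝕜 := 𝕜) (k := m - 1) (m := m) (by omega)
      (LinearMap.pi fun j => ∑ i, (b (Pi (u' i)) (uN ⟨j, by omega⟩)) •
        LinearMap.proj (R := 𝕜) (φ := fun _ => 𝕜) i)
    set v : V := ∑ i, c i • u' i with hv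
    have hvE : (v : E) = ∑ i, c i • u i := by simp [hv, u']
    have hvs : (v : E) ∈ Submodule.span 𝕜 (Set.range u) :=
      (Submodule.mem_span_range_iff_exists_fun 𝕜).mpr ⟨c, hvE.symm⟩
    have hv0 : v ≠ 0 := by
      intro h
      have h1 : ∑ i, c i • u i = 0 := by rw [← hvE, h, Submodule.coe_zero]
      exact hc (funext (Fintype.linearIndependent_iff.mp hV.linInd c h1))
    have hbv := hb.pos v v.2 (fun h => hv0 (Subtype.ext h))
    have horth : ∀ j : Fin (m - 1), b (Pi v) (uN ⟨j, by omega⟩) = 0 := by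
      intro j
      have h1 := congrFun h0 j
      rw [hv, hPi.map_sum_smul ha hW, Submodule.coe_sum,
        hbW.sum_left _ _ (fun i => Submodule.coe_mem _) (hN.mem _)]
      simp only [LinearMap.pi_apply, LinearMap.sum_apply, LinearMap.smul_apply,
        LinearMap.proj_apply, smul_eq_mul] at h1
      refine Eq.trans ?_ h1
      refine Finset.sum_congr rfl fun i _ => ?_
      rw [Submodule.coe_smul, hbW.smul_left _ _ (Submodule.coe_mem _) _ (hN.mem _), mul_comm]
    have h1 := hN.le_rayleigh haW hbW hminW hm (Pi v).2 horth
    have h2 := hPi.rayleigh_le ha hW v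
    have h3 := hV.rayleigh_le ha hb hm hvs
    refine le_trans ?_ (mul_le_mul_right (hM.2 ⟨v, hvs, hv0, rfl⟩) _)
    -- If the projection vanishes, the quotient of this `v` is infinite, and `λ^m > 0` keeps the
    -- product with it infinite.
    by_cases hp0 : (Pi v : E) = 0
    · rw [hp0, hb.zero_left V.zero_mem, map_zero, ENNReal.ofReal_zero,
        ENNReal.div_zero (ENNReal.ofReal_pos.mpr hbv).ne', ENNReal.mul_top]
      · exact le_top
      · exact (ENNReal.ofReal_pos.mpr hpos).ne'
    · have hbp := hb.pos _ (hW (Pi v).2) hp0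
      rw [← ENNReal.ofReal_div_of_pos hbp, ← ENNReal.ofReal_mul hpos.le]
      refine ENNReal.ofReal_le_ofReal ?_
      rw [← mul_div_assoc, le_div_iff₀ hbp]
      linarith

end Ritz

/-! ### Rayleigh minimizers by the direct method. -/

section Minimizer

variable {𝕜 : Type*} [RCLike 𝕜] {E : Type*} [AddCommGroup E] [Module 𝕜 E]
variable {a b : E → E → 𝕜} {V : Submodule 𝕜 E}

/-- Bounded sequences in a separable Hilbert space have weakly convergent subsequences. -/
theorem exists_weak_subseq {H : Type*} [NormedAddCommGroup H] [InnerProductSpace 𝕜 H]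
    [CompleteSpace H] [TopologicalSpace.SeparableSpace H] {x : ℕ → H} {C : ℝ}
    (hx : ∀ n, ‖x n‖ ≤ C) :
    ∃ (z : H) (φ : ℕ → ℕ), StrictMono φ ∧
      ∀ y, Tendsto (fun n => inner 𝕜 y (x (φ n) - z)) atTop (𝓝 0) := by
  let D : ℕ → WeakDual 𝕜 H := fun n =>
    StrongDual.toWeakDual (InnerProductSpace.toDual 𝕜 H (x n))
  -- Riesz' theorem turns the vectors into functionals, to which the sequential Banach-Alaoglu
  -- theorem applies.
  obtain ⟨L, -, φ, hφ, hL⟩ := WeakDual.isSeqCompact_closedBall 𝕜 H 0 C (x := D) fun n => by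
    simpa [D] using hx n
  refine ⟨(InnerProductSpace.toDual 𝕜 H).symm (WeakDual.toStrongDual L), φ, hφ, fun y => ?_⟩
  have h1 : Tendsto (fun n => D (φ n) y) atTop (𝓝 (L y)) :=
    ((WeakDual.eval_continuous y).tendsto L).comp hL
  have h2 : Tendsto (fun n => conj (D (φ n) y) - conj (L y)) atTop (𝓝 0) := by
    rw [← sub_self (conj (L y))]
    exact ((RCLike.continuous_conj.tendsto _).comp h1).sub_const _
  refine h2.congr fun n => ?_
  rw [inner_sub_right, ← inner_conj_symm y (x (φ n)), ← inner_conj_symm y]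
  congr 2
  simp [InnerProductSpace.toDual_symm_apply]

/-- A minimizing sequence normalized by `b = 1` is bounded in `H` and has a weak limit. The
hypothesis `hweak` carries both the normalization and the orthogonality constraints to the limit,
and `a` is weakly lower semicontinuous because it is nonnegative and bounded. -/
theorem hasMinimizers_of_weak {H : Type*} [NormedAddCommGroup H] [InnerProductSpace 𝕜 H]
    [CompleteSpace H] [TopologicalSpace.SeparableSpace H] (ha : PosForm a V) (hb : PosForm b V)
    (Ψ : V ≃ₗ[𝕜] H) {C : ℝ} (hC : 0 ≤ C)
    (hlow : ∀ v : V, ‖Ψ v‖ ^ 2 ≤ C * RCLike.re (a v v))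
    (hup : ∀ v : V, RCLike.re (a v v) ≤ C * ‖Ψ v‖ ^ 2)
    (hweak : ∀ (x : ℕ → V) (K : ℝ), (∀ n, ‖Ψ (x n)‖ ≤ K) →
      (∀ y, Tendsto (fun n => inner 𝕜 y (Ψ (x n))) atTop (𝓝 0)) →
      Tendsto (fun n => RCLike.re (b (x n) (x n))) atTop (𝓝 0)) :
    HasMinimizers a b V := by
  intro k f hf ⟨v₀, hv₀, hne₀, hvf₀⟩
  let S : Set ℝ := {r | ∃ v : V, (∀ i, b v (f i) = 0) ∧ RCLike.re (b (v : E) v) = 1 ∧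
    r = RCLike.re (a (v : E) v)}
  have hscale : ∀ (c : E → E → 𝕜), PosForm c V → ∀ (r : ℝ) (y : E), y ∈ V →
      RCLike.re (c ((r : 𝕜) • y) ((r : 𝕜) • y)) = r ^ 2 * RCLike.re (c y y) := by
    intro c hc r y hy
    rw [hc.smul_left _ _ hy _ (V.smul_mem _ hy), hc.smul_right _ hy hy, RCLike.conj_ofReal,
      RCLike.re_ofReal_mul, RCLike.re_ofReal_mul]
    ring
  have hnormalize : ∀ w ∈ V, w ≠ 0 → (∀ i, b w (f i) = 0) →
      RCLike.re (a w w) / RCLike.re (b w w) ∈ S := by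
    intro w hw hw0 hwf
    have hbw := hb.pos w hw hw0
    set r : ℝ := (√(RCLike.re (b w w)))⁻¹ with hr
    have hr2 : r ^ 2 = (RCLike.re (b w w))⁻¹ := by rw [hr, inv_pow, Real.sq_sqrt hbw.le]
    refine ⟨⟨(r : 𝕜) • w, V.smul_mem _ hw⟩, fun i => ?_, ?_, ?_⟩
    · rw [hb.smul_left _ _ hw _ (hf i), hwf, mul_zero]
    · rw [hscale b hb r w hw, hr2, inv_mul_cancel₀ hbw.ne']
    · rw [hscale a ha r w hw, hr2]
      ring
  have hSne : S.Nonempty := ⟨_, hnormalize v₀ hv₀ hne₀ hvf₀⟩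
  have hSbdd : BddBelow S := ⟨0, by
    rintro _ ⟨v, -, -, rfl⟩
    exact ha.nonneg v.2⟩
  set μ := sInf S with hμ
  obtain ⟨s, -, hs, hsS⟩ := exists_seq_tendsto_sInf hSne hSbdd
  choose x hxf hxb hxa using hsS
  obtain ⟨K, hK⟩ := hs.bddAbove_range
  -- The square of the norm is at most `C * K`, and `r² ≤ s` implies `r ≤ s + 1`.
  have hbound : ∀ n, ‖Ψ (x n)‖ ≤ C * K + 1 := by
    intro n
    have h1 := hlow (x n)
    rw [← hxa n] at h1
    have h2 : s n ≤ K := hK ⟨n, rfl⟩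
    nlinarith [mul_le_mul_of_nonneg_left h2 hC, norm_nonneg (Ψ (x n))]
  obtain ⟨z, φ, hφ, hz⟩ := exists_weak_subseq (𝕜 := 𝕜) hbound
  set w : V := Ψ.symm z with hw
  have hΨw : Ψ w = z := by simp [hw]
  set d : ℕ → V := fun n => x (φ n) - w with hd
  have hΨd : ∀ n, Ψ (d n) = Ψ (x (φ n)) - z := fun n => by rw [hd, map_sub, hΨw]
  have hbd : Tendsto (fun n => RCLike.re (b (d n) (d n))) atTop (𝓝 0) := by
    refine hweak d (C * K + 1 + ‖z‖) (fun n => ?_) fun y => ?_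
    · rw [hΨd]
      exact (norm_sub_le _ _).trans (by linarith [hbound (φ n)])
    · simpa only [hΨd] using hz y
  have hbdy : ∀ y ∈ V, Tendsto (fun n => b (d n) y) atTop (𝓝 0) := by
    intro y hy
    have h1 : Tendsto (fun n => ‖b (d n) y‖ ^ 2) atTop (𝓝 0) := by
      refine squeeze_zero (fun n => by positivity) (fun n => hb.norm_sq_le (d n).2 hy) ?_
      simpa using hbd.mul_const (RCLike.re (b y y))
    rw [tendsto_zero_iff_norm_tendsto_zero]
    have h2 := h1.sqrt
    simpa using h2
  have hxd : ∀ n, (x (φ n) : E) = w + d n := fun n => by simp [hd]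
  have hwf : ∀ i, b w (f i) = 0 := by
    intro i
    have h1 := hbdy (f i) (hf i)
    have h2 : ∀ n, b (d n) (f i) = - b w (f i) := fun n => by
      have := hxf (φ n) i
      rw [hxd, hb.add_left _ w.2 _ (d n).2 _ (hf i)] at this
      linear_combination this
    simp only [h2] at h1
    have h3 := tendsto_nhds_unique h1 tendsto_const_nhds
    exact neg_eq_zero.mp h3.symm
  have expand : ∀ (c : E → E → 𝕜), PosForm c V → ∀ n, RCLike.re (c (x (φ n)) (x (φ n))) =
      RCLike.re (c w w) + 2 * RCLike.re (c (d n) w) + RCLike.re (c (d n) (d n)) := by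
    intro c hc n
    have hsym : RCLike.re (c w (d n)) = RCLike.re (c (d n) w) := by
      rw [← hc.conj_symm _ (d n).2 _ w.2, RCLike.conj_re]
    rw [hxd, hc.add_left _ w.2 _ (d n).2 _ (V.add_mem w.2 (d n).2), hc.add_right w.2 (d n).2 w.2,
      hc.add_right w.2 (d n).2 (d n).2]
    simp only [map_add, hsym]
    ring
  have hre0 : Tendsto (fun n => RCLike.re (b (d n) w)) atTop (𝓝 0) := by
    simpa [Function.comp_def] using (RCLike.continuous_re.tendsto (0 : 𝕜)).comp (hbdy w w.2)
  have hwb : RCLike.re (b (w : E) w) = 1 := by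
    have h1 : Tendsto (fun n => RCLike.re (b (w : E) w) + 2 * RCLike.re (b (d n) w)
        + RCLike.re (b (d n) (d n))) atTop (𝓝 (RCLike.re (b (w : E) w) + 2 * 0 + 0)) :=
      (tendsto_const_nhds.add (hre0.const_mul 2)).add hbd
    have h2 : ∀ n, RCLike.re (b (w : E) w) + 2 * RCLike.re (b (d n) w)
        + RCLike.re (b (d n) (d n)) = 1 := fun n => by rw [← expand b hb, hxb]
    simp only [h2] at h1
    have h3 := tendsto_nhds_unique h1 tendsto_const_nhds
    linarith
  -- By Cauchy-Schwarz and `hup`, `a(·, w)` is a bounded functional on `H`; its Riesz representative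
  -- is tested against the weak convergence.
  have had : Tendsto (fun n => a (d n) w) atTop (𝓝 0) := by
    let g : H →ₗ[𝕜] 𝕜 :=
      { toFun := fun y => a (Ψ.symm y) w
        map_add' := fun y y' => by
          rw [map_add, Submodule.coe_add, ha.add_left _ (Ψ.symm y).2 _ (Ψ.symm y').2 _ w.2]
        map_smul' := fun c y => by
          rw [map_smul, Submodule.coe_smul, ha.smul_left _ _ (Ψ.symm y).2 _ w.2]
          rfl }
    have hg : ∀ y, ‖g y‖ ≤ √(C * RCLike.re (a (w : E) w)) * ‖y‖ := by
      intro y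
      have h1 := ha.norm_sq_le (Ψ.symm y).2 w.2
      have h2 := hup (Ψ.symm y)
      rw [LinearEquiv.apply_symm_apply] at h2
      have h3 := ha.nonneg w.2
      refine le_of_sq_le_sq ?_ (by positivity)
      rw [mul_pow, Real.sq_sqrt (by positivity)]
      exact h1.trans (by nlinarith)
    let G : StrongDual 𝕜 H := g.mkContinuous _ hg
    have h1 := hz ((InnerProductSpace.toDual 𝕜 H).symm G)
    refine h1.congr fun n => ?_
    rw [InnerProductSpace.toDual_symm_apply, ← hΨd]
    change a (Ψ.symm (Ψ (d n))) w = _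
    rw [LinearEquiv.symm_apply_apply]
  -- Expanding `a` at `w + d n`, the cross term tends to zero and the term `a(d n, d n) ≥ 0` is
  -- dropped.
  have hwa : RCLike.re (a (w : E) w) ≤ μ := by
    have hre : Tendsto (fun n => RCLike.re (a (d n) w)) atTop (𝓝 0) := by
      simpa [Function.comp_def] using (RCLike.continuous_re.tendsto (0 : 𝕜)).comp had
    have h1 : Tendsto (fun n => s (φ n) - 2 * RCLike.re (a (d n) w)) atTop (𝓝 (μ - 2 * 0)) :=
      (hs.comp hφ.tendsto_atTop).sub (hre.const_mul 2)
    rw [mul_zero, sub_zero] at h1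
    refine ge_of_tendsto' h1 fun n => ?_
    rw [hxa, expand a ha]
    linarith [ha.nonneg (d n).2]
  refine ⟨w, w.2, ?_, hwf, fun y hy hyf => ?_⟩
  · intro h0
    rw [h0, hb.zero_left V.zero_mem, map_zero] at hwb
    exact zero_ne_one hwb
  · rw [hwb, mul_one]
    by_cases hy0 : y = 0
    · simp [hy0, ha.zero_left V.zero_mem, hb.zero_left V.zero_mem]
    · have h1 := csInf_le hSbdd (hnormalize y hy hy0 hyf)
      rw [le_div_iff₀ (hb.pos y hy hy0)] at h1
      exact (mul_le_mul_of_nonneg_right hwa (hb.nonneg hy)).trans h1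

end Minimizer

/-! ### Locally absolutely continuous functions and weak derivatives. -/

section AbsolutelyContinuous

variable {𝕜 : Type*} [RCLike 𝕜]

/-- The increments of the primitive of `f` are dominated by those of the primitive of `‖f‖`, which
reduces the claim to real functions. -/
theorem absolutelyContinuousOnInterval_integral {f : ℝ → 𝕜} {x y : ℝ}
    (hf : IntervalIntegrable f volume x y) :
    AbsolutelyContinuousOnInterval (fun t => ∫ s in x..t, f s) x y := by
  have h1 := hf.norm.absolutelyContinuousOnInterval_intervalIntegral (c := x) left_mem_uIcc
  unfold AbsolutelyContinuousOnInterval at h1 ⊢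
  refine squeeze_zero' (Eventually.of_forall fun _ => Finset.sum_nonneg fun _ _ => dist_nonneg)
    ?_ h1
  rw [eventually_inf_principal]
  refine Eventually.of_forall fun ⟨n, J⟩ hJ => Finset.sum_le_sum fun i hi => ?_
  obtain ⟨h2, h3⟩ := hJ.1 i hi
  have i1 : ∀ s ∈ uIcc x y, IntervalIntegrable f volume x s := fun s hs =>
    hf.mono_set (uIcc_subset_uIcc left_mem_uIcc hs)
  rw [dist_comm, dist_comm (∫ s in x..(J i).1, ‖f s‖), dist_eq_norm, Real.dist_eq,
    intervalIntegral.integral_interval_sub_left (i1 _ h3) (i1 _ h2),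
    intervalIntegral.integral_interval_sub_left (i1 _ h3).norm (i1 _ h2).norm]
  exact intervalIntegral.norm_integral_le_abs_integral_norm

/-- Integration by parts for two primitives of integrable functions. -/
theorem integral_mul_add_mul_of_primitive {f g : ℝ → 𝕜} {x y : ℝ} (c d : 𝕜)
    (hf : IntervalIntegrable f volume x y) (hg : IntervalIntegrable g volume x y) :
    ∫ t in x..y, (f t * (d + ∫ s in x..t, g s) + (c + ∫ s in x..t, f s) * g t)
      = (c + ∫ s in x..y, f s) * (d + ∫ s in x..y, g s) - c * d := by
  set F : ℝ → 𝕜 := fun t => c + ∫ s in x..t, f s with hF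
  set G : ℝ → 𝕜 := fun t => d + ∫ s in x..t, g s with hG
  have hc : ∀ e : 𝕜, AbsolutelyContinuousOnInterval (fun _ : ℝ => e) x y := fun e =>
    (LipschitzWith.const e).lipschitzOnWith.absolutelyContinuousOnInterval
  have aF : AbsolutelyContinuousOnInterval F x y :=
    (hc c).add (absolutelyContinuousOnInterval_integral hf)
  have aG : AbsolutelyContinuousOnInterval G x y :=
    (hc d).add (absolutelyContinuousOnInterval_integral hg)
  have hk : IntervalIntegrable (fun t => f t * G t + F t * g t) volume x y :=
    (hf.mul_continuousOn aG.continuousOn).add (hg.continuousOn_mul aF.continuousOn)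
  have aH := (aF.smul aG).sub (absolutelyContinuousOnInterval_integral hk)
  -- `F G` minus the primitive of `f G + F g` is absolutely continuous with derivative zero almost
  -- everywhere, hence constant.
  obtain ⟨e, he⟩ := aH.const_of_ae_hasDerivAt_zero (by
    filter_upwards [hf.ae_hasDerivAt_integral, hg.ae_hasDerivAt_integral,
      hk.ae_hasDerivAt_integral] with t h1 h2 h3 ht
    have d1 := (h1 ht x left_mem_uIcc).const_add c
    have d2 := (h2 ht x left_mem_uIcc).const_add d
    have d3 := (d1.mul d2).sub (h3 ht x left_mem_uIcc)
    convert! d3 using 1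
    simp [hF, hG])
  have e1 := he x left_mem_uIcc
  have e2 := he y right_mem_uIcc
  rw [← e1] at e2
  simp only [Pi.sub_apply, smul_eq_mul, Pi.mul_apply, intervalIntegral.integral_same, sub_zero,
    hF, hG, add_zero] at e2
  linear_combination -e2

/-- `F` is locally absolutely continuous on `I` with derivative `f`. -/
def IsAC (F f : ℝ → 𝕜) : Prop :=
  ∀ x ∈ I, ∀ y ∈ I, IntervalIntegrable f volume x y ∧ F y - F x = ∫ t in x..y, f t

theorem uIcc_subset_I {x y : ℝ} (hx : x ∈ I) (hy : y ∈ I) : uIcc x y ⊆ I :=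
  ordConnected_Ioo.uIcc_subset hx hy

theorem uIoc_subset_I {x y : ℝ} (hx : x ∈ I) (hy : y ∈ I) : uIoc x y ⊆ I :=
  uIoc_subset_uIcc.trans (uIcc_subset_I hx hy)

theorem zero_mem_I : (0 : ℝ) ∈ I := by constructor <;> norm_num

theorem one_add_pos {t : ℝ} (ht : t ∈ I) : 0 < 1 + t := by linarith [ht.1]

namespace IsAC

variable {F G f g : ℝ → 𝕜}

theorem continuousOn (h : IsAC F f) : ContinuousOn F I := by
  intro x hx
  obtain ⟨y, hy1, hy2⟩ := exists_between hx.1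
  obtain ⟨z, hz1, hz2⟩ := exists_between hx.2
  have hy : y ∈ I := ⟨hy1, hy2.trans hx.2⟩
  have hz : z ∈ I := ⟨hx.1.trans hz1, hz2⟩
  have h1 := intervalIntegral.continuousOn_primitive_interval' (h y hy z hz).1 left_mem_uIcc
  have h2 : ContinuousAt (fun t => F y + ∫ s in y..t, f s) x := by
    refine continuousAt_const.add (h1.continuousAt ?_)
    rw [uIcc_of_le (hy2.trans hz1).le]
    exact Icc_mem_nhds hy2 hz1
  refine (h2.congr ?_).continuousWithinAt
  filter_upwards [Ioo_mem_nhds hx.1 hx.2] with t ht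
  rw [← (h y hy t ht).2]
  ring

theorem congr_deriv (h : IsAC F f) (hfg : ∀ t ∈ I, f t = g t) : IsAC F g := by
  intro x hx y hy
  obtain ⟨h1, h2⟩ := h x hx y hy
  refine ⟨h1.congr fun t ht => hfg t (uIoc_subset_I hx hy ht), ?_⟩
  rw [h2]
  exact intervalIntegral.integral_congr fun t ht => hfg t (uIcc_subset_I hx hy ht)

theorem congr_deriv_ae (h : IsAC F f) (hfg : f =ᵐ[muI] g) : IsAC F g := by
  intro x hx y hy
  obtain ⟨h1, h2⟩ := h x hx y hy
  have h3 : ∀ᵐ t, t ∈ uIoc x y → f t = g t := by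
    filter_upwards [(ae_restrict_iff' measurableSet_Ioo).mp hfg] with t ht hxy
    exact ht (uIoc_subset_I hx hy hxy)
  refine ⟨h1.congr_ae ((ae_restrict_iff' measurableSet_uIoc).mpr h3), ?_⟩
  rw [h2]
  exact intervalIntegral.integral_congr_ae h3

theorem congr (h : IsAC F f) (hFG : ∀ t ∈ I, F t = G t) : IsAC G f := by
  intro x hx y hy
  rw [← hFG x hx, ← hFG y hy]
  exact h x hx y hy

theorem add (hF : IsAC F f) (hG : IsAC G g) :
    IsAC (fun t => F t + G t) (fun t => f t + g t) := by
  intro x hx y hy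
  obtain ⟨h1, h2⟩ := hF x hx y hy
  obtain ⟨h3, h4⟩ := hG x hx y hy
  refine ⟨h1.add h3, ?_⟩
  rw [intervalIntegral.integral_add h1 h3, ← h2, ← h4]
  ring

theorem sub (hF : IsAC F f) (hG : IsAC G g) :
    IsAC (fun t => F t - G t) (fun t => f t - g t) := by
  intro x hx y hy
  obtain ⟨h1, h2⟩ := hF x hx y hy
  obtain ⟨h3, h4⟩ := hG x hx y hy
  refine ⟨h1.sub h3, ?_⟩
  rw [intervalIntegral.integral_sub h1 h3, ← h2, ← h4]
  ring

theorem star (hF : IsAC F f) : IsAC (fun t => conj (F t)) (fun t => conj (f t)) := by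
  intro x hx y hy
  obtain ⟨h1, h2⟩ := hF x hx y hy
  refine ⟨⟨(RCLike.conjCLE (K := 𝕜)).toContinuousLinearMap.integrable_comp h1.1,
    (RCLike.conjCLE (K := 𝕜)).toContinuousLinearMap.integrable_comp h1.2⟩, ?_⟩
  rw [← map_sub, h2]
  exact ((RCLike.conjCLE (K := 𝕜)).toContinuousLinearMap.intervalIntegral_comp_comm h1).symm

theorem mul (hF : IsAC F f) (hG : IsAC G g) :
    IsAC (fun t => F t * G t) (fun t => f t * G t + F t * g t) := by
  intro x hx y hy
  obtain ⟨h1, h2⟩ := hF x hx y hy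
  obtain ⟨h3, h4⟩ := hG x hx y hy
  refine ⟨(h1.mul_continuousOn (hG.continuousOn.mono (uIcc_subset_I hx hy))).add
    (h3.continuousOn_mul (hF.continuousOn.mono (uIcc_subset_I hx hy))), ?_⟩
  have e := integral_mul_add_mul_of_primitive (F x) (G x) h1 h3
  rw [← h2, ← h4, add_sub_cancel, add_sub_cancel] at e
  rw [← e]
  refine intervalIntegral.integral_congr fun t ht => ?_
  have ht' := uIcc_subset_I hx hy ht
  rw [← (hF x hx t ht').2, ← (hG x hx t ht').2, add_sub_cancel, add_sub_cancel]

theorem of_hasDerivAt (h : ∀ t ∈ I, HasDerivAt F (f t) t) (hf : ContinuousOn f I) :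
    IsAC F f := by
  intro x hx y hy
  have hi : IntervalIntegrable f volume x y :=
    (hf.mono (uIcc_subset_I hx hy)).intervalIntegrable
  exact ⟨hi, (intervalIntegral.integral_eq_sub_of_hasDerivAt
    (fun t ht => h t (uIcc_subset_I hx hy ht)) hi).symm⟩

theorem const (c : 𝕜) : IsAC (fun _ => c) (fun _ => 0) :=
  of_hasDerivAt (fun t _ => hasDerivAt_const t c) continuousOn_const

theorem ofReal {φ ψ : ℝ → ℝ} (h : ∀ t ∈ I, HasDerivAt φ (ψ t) t) (hψ : ContinuousOn ψ I) :
    IsAC (fun t => (φ t : 𝕜)) (fun t => (ψ t : 𝕜)) :=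
  of_hasDerivAt (fun t ht => (RCLike.ofRealCLM (K := 𝕜)).hasFDerivAt.comp_hasDerivAt t (h t ht))
    (RCLike.continuous_ofReal.comp_continuousOn hψ)

theorem weight : IsAC (fun t : ℝ => ((1 + t : ℝ) : 𝕜)) (fun _ => 1) := by
  refine (IsAC.ofReal (φ := fun t => 1 + t) (ψ := fun _ => 1)
    (fun t _ => (hasDerivAt_id t).const_add 1) continuousOn_const).congr_deriv fun t _ => ?_
  simp

theorem inv_weight :
    IsAC (fun t : ℝ => (((1 + t)⁻¹ : ℝ) : 𝕜)) (fun t => ((-((1 + t) ^ 2)⁻¹ : ℝ) : 𝕜)) := by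
  refine IsAC.ofReal (φ := fun t => (1 + t)⁻¹) (fun t ht => ?_) ?_
  · have h := ((hasDerivAt_id t).const_add 1).inv (one_add_pos ht).ne'
    convert! h using 1
    simp [div_eq_mul_inv]
  · refine ContinuousOn.neg (ContinuousOn.inv₀ (by fun_prop) fun t ht => ?_)
    exact (pow_pos (one_add_pos ht) 2).ne'

end IsAC

/-- A function which is integrable on compact subintervals is a derivative. -/
theorem isAC_primitive {f : ℝ → 𝕜} (hf : ∀ x ∈ I, ∀ y ∈ I, IntervalIntegrable f volume x y) :
    IsAC (fun t => ∫ s in (0 : ℝ)..t, f s) f := fun x hx y hy =>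
  ⟨hf x hx y hy, intervalIntegral.integral_interval_sub_left (hf 0 zero_mem_I y hy)
    (hf 0 zero_mem_I x hx)⟩

theorem intervalIntegrable_of_locInt {f : ℝ → 𝕜} (hf : LocallyIntegrableOn f I muI) {x y : ℝ}
    (hx : x ∈ I) (hy : y ∈ I) : IntervalIntegrable f volume x y := by
  have h1 := hf.integrableOn_compact_subset (uIcc_subset_I hx hy) isCompact_uIcc
  rw [IntegrableOn, muI, Measure.restrict_restrict_of_subset (uIcc_subset_I hx hy)] at h1
  exact IntegrableOn.intervalIntegrable h1

theorem locInt_of_intervalIntegrable {f : ℝ → 𝕜}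
    (hf : ∀ x ∈ I, ∀ y ∈ I, IntervalIntegrable f volume x y) :
    LocallyIntegrableOn f I muI := by
  intro x hx
  obtain ⟨y, hy1, hy2⟩ := exists_between hx.1
  obtain ⟨z, hz1, hz2⟩ := exists_between hx.2
  have h1 := hf y ⟨hy1, hy2.trans hx.2⟩ z ⟨hx.1.trans hz1, hz2⟩
  refine ⟨Ioc y z, mem_nhdsWithin_of_mem_nhds (Ioc_mem_nhds hy2 hz1), ?_⟩
  rw [IntegrableOn, muI, Measure.restrict_restrict measurableSet_Ioc]
  exact h1.1.mono_set inter_subset_left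

theorem integrable_smul_of_locInt {f : ℝ → 𝕜} (h : LocallyIntegrableOn f I muI)
    {φ : ℝ → ℝ} (h1 : Continuous φ) (h2 : HasCompactSupport φ) (h3 : tsupport φ ⊆ I) :
    Integrable (fun t => φ t • f t) muI := by
  have hK : IsCompact (tsupport φ) := h2
  rw [← integrableOn_iff_integrable_of_support_subset (s := tsupport φ)]
  · exact (h.integrableOn_compact_subset h3 hK).continuousOn_smul h1.continuousOn hK
  · intro t ht
    apply subset_tsupport
    intro h0
    simp [h0] at ht

theorem exists_Icc_of_tsupport {φ : ℝ → ℝ} (h2 : HasCompactSupport φ) (h3 : tsupport φ ⊆ I) :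
    ∃ x ∈ I, ∃ y ∈ I, x < y ∧ tsupport φ ⊆ Ioo x y := by
  rcases (tsupport φ).eq_empty_or_nonempty with h | h
  · exact ⟨0, zero_mem_I, 1 / 2, by constructor <;> norm_num, by norm_num, by simp [h]⟩
  · have hK : IsCompact (tsupport φ) := h2
    have m1 := h3 (hK.sInf_mem h)
    have m2 := h3 (hK.sSup_mem h)
    obtain ⟨x, hx1, hx2⟩ := exists_between m1.1
    obtain ⟨y, hy1, hy2⟩ := exists_between m2.2
    have hle : sInf (tsupport φ) ≤ sSup (tsupport φ) :=
      csInf_le_csSup h hK.bddBelow hK.bddAbove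
    refine ⟨x, ⟨hx1, by linarith [m1.2]⟩, y, ⟨by linarith [m2.1], hy2⟩, by linarith,
      fun t ht => ?_⟩
    exact ⟨hx2.trans_le (csInf_le hK.bddBelow ht), (le_csSup hK.bddAbove ht).trans_lt hy1⟩

theorem setIntegral_I_eq {F : ℝ → 𝕜} {x y : ℝ} (hx : x ∈ I) (hy : y ∈ I) (hxy : x ≤ y)
    (h0 : ∀ t, t ∉ Ioo x y → F t = 0) : ∫ t in I, F t = ∫ t in x..y, F t := by
  rw [intervalIntegral.integral_of_le hxy]
  refine setIntegral_eq_of_subset_of_forall_sdiff_eq_zero (f := F) (t := I) measurableSet_Ioo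
    ?_ ?_
  · exact Ioc_subset_Icc_self.trans (uIcc_of_le hxy ▸ uIcc_subset_I hx hy)
  · intro t ht
    exact h0 t fun h => ht.2 ⟨h.1, h.2.le⟩

/-- Product rule for `φ F` on a compact interval containing the support of `φ`, where the boundary
terms vanish. -/
theorem IsAC.isWeakDeriv {F f : ℝ → 𝕜} (h : IsAC F f) {u g : Fn 𝕜} (hu : u =ᵐ[muI] F)
    (hg : g =ᵐ[muI] f) : IsWeakDeriv u g := by
  refine ⟨locInt_congr hu.symm (h.continuousOn.locallyIntegrableOn measurableSet_Ioo),
    locInt_congr hg.symm (locInt_of_intervalIntegrable fun x hx y hy => (h x hx y hy).1), ?_⟩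
  intro φ h1 h2 h3
  obtain ⟨x, hx, y, hy, hxy, hs⟩ := exists_Icc_of_tsupport h2 h3
  have z0 : ∀ t, t ∉ Ioo x y → φ t = 0 := fun t ht =>
    image_eq_zero_of_notMem_tsupport fun h => ht (hs h)
  have z1 : ∀ t, t ∉ Ioo x y → deriv φ t = 0 := fun t ht =>
    image_eq_zero_of_notMem_tsupport fun h => ht (hs (tsupport_deriv_subset (𝕜 := ℝ) h))
  have hφ : IsAC (fun t => (φ t : 𝕜)) (fun t => ((deriv φ t : ℝ) : 𝕜)) :=
    IsAC.ofReal (ψ := deriv φ) (fun t _ => (h1.differentiable (by simp) t).hasDerivAt)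
      (h1.continuous_deriv (by simp)).continuousOn
  have e1 : ∫ t in I, deriv φ t • u t = ∫ t in I, ((deriv φ t : ℝ) : 𝕜) * F t := by
    refine integral_congr_ae ?_
    filter_upwards [hu] with t ht
    rw [ht, RCLike.real_smul_eq_coe_mul]
  have e2 : ∫ t in I, φ t • g t = ∫ t in I, (φ t : 𝕜) * f t := by
    refine integral_congr_ae ?_
    filter_upwards [hg] with t ht
    rw [ht, RCLike.real_smul_eq_coe_mul]
  rw [e1, e2, setIntegral_I_eq hx hy hxy.le fun t ht => by simp [z1 t ht],
    setIntegral_I_eq hx hy hxy.le fun t ht => by simp [z0 t ht], eq_neg_iff_add_eq_zero,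
    ← intervalIntegral.integral_add, ← ((hφ.mul h) x hx y hy).2]
  · simp [z0 x (by simp), z0 y (by simp)]
  · exact (hφ x hx y hy).1.mul_continuousOn (h.continuousOn.mono (uIcc_subset_I hx hy))
  · exact (h x hx y hy).1.continuousOn_mul (hφ.continuousOn.mono (uIcc_subset_I hx hy))

theorem ae_eq_zero_of_test {v : ℝ → 𝕜} (hv : LocallyIntegrableOn v I muI)
    (h : ∀ φ : ℝ → ℝ, ContDiff ℝ ∞ φ → HasCompactSupport φ → tsupport φ ⊆ I →
      ∫ t in I, φ t • v t = 0) : v =ᵐ[muI] 0 := by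
  have h1 := isOpen_Ioo.ae_eq_zero_of_integral_contDiff_smul_eq_zero (U := I) hv h
  filter_upwards [h1, ae_restrict_mem measurableSet_Ioo] with t ht hI
  exact ht hI

theorem IsWeakDeriv.unique {u g h : Fn 𝕜} (hg : IsWeakDeriv u g) (hh : IsWeakDeriv u h) :
    g = h := by
  have h0 : (fun t => g t - h t) =ᵐ[muI] 0 := by
    refine ae_eq_zero_of_test (hg.locInt'.sub hh.locInt') fun φ h1 h2 h3 => ?_
    have e : ∀ t, φ t • (g t - h t) = φ t • g t - φ t • h t := fun t => smul_sub _ _ _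
    simp_rw [e]
    rw [integral_sub (IsWeakDeriv.integrable_left hg.locInt' h1.continuous h2 h3)
      (IsWeakDeriv.integrable_left hh.locInt' h1.continuous h2 h3), sub_eq_zero,
      ← neg_inj, ← hg.byParts φ h1 h2 h3, ← hh.byParts φ h1 h2 h3]
  refine AEEqFun.ext ?_
  filter_upwards [h0] with t ht
  exact sub_eq_zero.mp ht

theorem IsWeakDeriv.wderiv_eq {u g : Fn 𝕜} (hg : IsWeakDeriv u g) : wderiv u = g := by
  have h : ∃ g, IsWeakDeriv u g := ⟨g, hg⟩
  rw [wderiv, dif_pos h]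
  exact h.choose_spec.unique hg

/-- A function whose weak derivative vanishes is constant. -/
theorem ae_eq_const_of_test {v : ℝ → 𝕜} (hv : LocallyIntegrableOn v I muI)
    (h : ∀ φ : ℝ → ℝ, ContDiff ℝ ∞ φ → HasCompactSupport φ → tsupport φ ⊆ I →
      ∫ t in I, deriv φ t • v t = 0) : ∃ c : 𝕜, v =ᵐ[muI] fun _ => c := by
  let β : ContDiffBump (0 : ℝ) := ⟨1 / 4, 1 / 2, by norm_num, by norm_num⟩
  set ψ : ℝ → ℝ := β.normed volume with hψ
  have p1 : ContDiff ℝ ∞ ψ := β.contDiff_normed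
  have p2 : HasCompactSupport ψ := β.hasCompactSupport_normed
  have p3 : tsupport ψ ⊆ I := by
    rw [hψ, β.tsupport_normed_eq, Real.closedBall_eq_Icc]
    exact Icc_subset_Ioo (by norm_num [β]) (by norm_num [β])
  have p4 : ∫ t in I, ψ t = 1 := by
    rw [← β.integral_normed (μ := (volume : Measure ℝ))]
    refine setIntegral_eq_integral_of_forall_compl_eq_zero fun t ht => ?_
    exact image_eq_zero_of_notMem_tsupport fun h => ht (p3 h)
  set c : 𝕜 := ∫ t in I, ψ t • v t with hc
  refine ⟨c, ?_⟩
  have hconst : LocallyIntegrableOn (fun _ : ℝ => c) I muI :=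
    continuousOn_const.locallyIntegrableOn measurableSet_Ioo
  have h0 : (fun t => v t - c) =ᵐ[muI] 0 := by
    refine ae_eq_zero_of_test (hv.sub hconst) fun φ h1 h2 h3 => ?_
    have i1 := integrable_smul_of_locInt hv h1.continuous h2 h3
    have i2 := integrable_smul_of_locInt hconst h1.continuous h2 h3
    have i3 := integrable_smul_of_locInt hv p1.continuous p2 p3
    set r : ℝ := ∫ t in I, φ t with hr
    obtain ⟨x₁, hx₁, y₁, hy₁, -, hs₁⟩ := exists_Icc_of_tsupport h2 h3
    obtain ⟨x₂, hx₂, y₂, hy₂, -, hs₂⟩ := exists_Icc_of_tsupport p2 p3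
    set x := min x₁ x₂ with hx
    set y := max y₁ y₂ with hy
    have hxI : x ∈ I := by rcases min_choice x₁ x₂ with h | h <;> rw [hx, h] <;> assumption
    have hyI : y ∈ I := by rcases max_choice y₁ y₂ with h | h <;> rw [hy, h] <;> assumption
    -- Subtracting `(∫ φ) ψ` makes the mean zero, so the primitive `Φ` of `θ` has compact support in
    -- `I` and is itself a test function. Testing with it gives `∫ φ v = (∫ φ) c`.
    set θ : ℝ → ℝ := fun t => φ t - r * ψ t with hθ
    have hθc : ContDiff ℝ ∞ θ := h1.sub (contDiff_const.mul p1)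
    have hxy : x ≤ y := by
      by_contra! hlt
      have : tsupport ψ = ∅ := by
        refine eq_empty_of_forall_notMem fun t ht => ?_
        have := hs₂ ht
        have e1 := min_le_right x₁ x₂
        have e2 := le_max_right y₁ y₂
        linarith [this.1, this.2]
      have : ψ = 0 := tsupport_eq_empty_iff.mp this
      simp [this] at p4
    have hθ0 : ∀ t, t ∉ Ioo x y → θ t = 0 := by
      intro t ht
      have e1 : φ t = 0 := image_eq_zero_of_notMem_tsupport fun h => ht
        ⟨(min_le_left _ _).trans_lt (hs₁ h).1, (hs₁ h).2.trans_le (le_max_left _ _)⟩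
      have e2 : ψ t = 0 := image_eq_zero_of_notMem_tsupport fun h => ht
        ⟨(min_le_right _ _).trans_lt (hs₂ h).1, (hs₂ h).2.trans_le (le_max_right _ _)⟩
      simp [hθ, e1, e2]
    have hint : ∀ {χ : ℝ → ℝ}, Continuous χ → HasCompactSupport χ → IntegrableOn χ I volume :=
      fun a1 a2 => (a1.integrable_of_hasCompactSupport a2).integrableOn
    have hθI : ∫ t in x..y, θ t = 0 := by
      rw [← setIntegral_I_eq hxI hyI hxy hθ0, hθ, integral_sub (hint h1.continuous h2)
        ((hint p1.continuous p2).const_mul r), integral_const_mul, p4, mul_one, sub_self]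
    set Φ : ℝ → ℝ := fun t => ∫ s in x..t, θ s with hΦ
    have hΦd : ∀ t, HasDerivAt Φ (θ t) t := fun t =>
      intervalIntegral.integral_hasDerivAt_right (hθc.continuous.intervalIntegrable _ _)
        hθc.continuous.stronglyMeasurable.stronglyMeasurableAtFilter hθc.continuous.continuousAt
    have hΦ' : deriv Φ = θ := funext fun t => (hΦd t).deriv
    have hΦc : ContDiff ℝ ∞ Φ := by
      rw [contDiff_infty_iff_deriv, hΦ']
      exact ⟨fun t => (hΦd t).differentiableAt, hθc⟩
    have hΦ0 : ∀ t, t ∉ Icc x y → Φ t = 0 := by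
      intro t ht
      rcases lt_or_ge t x with h | h
      · refine intervalIntegral.integral_zero_ae (Eventually.of_forall fun s hs => hθ0 s ?_)
        rw [uIoc_of_ge h.le] at hs
        exact fun h' => absurd h'.1 (not_lt.mpr hs.2)
      · have hyt : y < t := by
          by_contra! h'
          exact ht ⟨h, h'⟩
        simp only [hΦ]
        rw [← intervalIntegral.integral_add_adjacent_intervals
          (hθc.continuous.intervalIntegrable x y) (hθc.continuous.intervalIntegrable y t), hθI,
          zero_add]
        refine intervalIntegral.integral_zero_ae (Eventually.of_forall fun s hs => hθ0 s ?_)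
        rw [uIoc_of_le hyt.le] at hs
        exact fun h' => absurd h'.2 (not_lt.mpr hs.1.le)
    have hΦs : tsupport Φ ⊆ Icc x y := by
      refine closure_minimal (fun t ht => ?_) isClosed_Icc
      by_contra h'
      exact ht (hΦ0 t h')
    have hfin := h Φ hΦc (isCompact_Icc.of_isClosed_subset (isClosed_tsupport Φ) hΦs)
      (hΦs.trans (uIcc_of_le hxy ▸ uIcc_subset_I hxI hyI))
    rw [hΦ'] at hfin
    have e : ∀ t, θ t • v t = φ t • v t - r • (ψ t • v t) := fun t => by
      rw [hθ, sub_smul, mul_smul]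
    simp_rw [e] at hfin
    rw [integral_sub i1 (show Integrable (fun t => r • (ψ t • v t)) muI from i3.smul r),
      integral_smul, sub_eq_zero] at hfin
    have e' : ∀ t, φ t • (v t - c) = φ t • v t - φ t • c := fun t => smul_sub _ _ _
    simp_rw [e']
    rw [integral_sub i1 i2, integral_smul_const, hfin, sub_self]
  filter_upwards [h0] with t ht
  exact sub_eq_zero.mp ht

/-- `u` and the primitive of `g` have the same weak derivative, so they differ by a constant. -/
theorem IsWeakDeriv.exists_isAC {u g : Fn 𝕜} (h : IsWeakDeriv u g) :
    ∃ F : ℝ → 𝕜, u =ᵐ[muI] F ∧ IsAC F g := by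
  have hG : IsAC (fun t => ∫ s in (0 : ℝ)..t, g s) g :=
    isAC_primitive fun x hx y hy => intervalIntegrable_of_locInt h.locInt' hx hy
  set G : ℝ → 𝕜 := fun t => ∫ s in (0 : ℝ)..t, g s with hGdef
  have hGl : LocallyIntegrableOn G I muI := hG.continuousOn.locallyIntegrableOn measurableSet_Ioo
  have hGm : AEStronglyMeasurable G muI :=
    hG.continuousOn.aestronglyMeasurable measurableSet_Ioo
  have hw : IsWeakDeriv (AEEqFun.mk G hGm : Fn 𝕜) g :=
    hG.isWeakDeriv (AEEqFun.coeFn_mk G hGm) (ae_eq_refl _)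
  obtain ⟨c, hc⟩ := ae_eq_const_of_test (h.locInt.sub hw.locInt) fun φ h1 h2 h3 => by
    have hd : Continuous (deriv φ) := h1.continuous_deriv (by simp)
    have hd3 : tsupport (deriv φ) ⊆ I := (tsupport_deriv_subset (𝕜 := ℝ)).trans h3
    have e : ∀ t, deriv φ t • ((u : ℝ → 𝕜) - (AEEqFun.mk G hGm : Fn 𝕜)) t =
        deriv φ t • u t - deriv φ t • (AEEqFun.mk G hGm : Fn 𝕜) t := fun t => smul_sub _ _ _
    simp_rw [e]
    rw [integral_sub (IsWeakDeriv.integrable_left h.locInt hd h2.deriv hd3)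
      (IsWeakDeriv.integrable_left hw.locInt hd h2.deriv hd3), h.byParts φ h1 h2 h3,
      hw.byParts φ h1 h2 h3, sub_self]
  refine ⟨fun t => G t + c, ?_, (hG.add (IsAC.const c)).congr_deriv fun t _ => add_zero _⟩
  filter_upwards [hc, AEEqFun.coeFn_mk G hGm] with t h1 h2
  rw [Pi.sub_apply, h2] at h1
  rw [← h1]
  ring

end AbsolutelyContinuous

/-! ### Limits at the end points of `I`. -/

section BoundaryLimits

variable {𝕜 : Type*} [RCLike 𝕜]

theorem intervalIntegrable_of_integrable {k : ℝ → 𝕜} (hk : Integrable k muI) :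
    IntervalIntegrable k volume (-1) 1 :=
  (intervalIntegrable_iff_integrableOn_Ioo_of_le (by norm_num)).mpr hk

theorem intervalIntegrable_mono {k : ℝ → 𝕜} (hk : IntervalIntegrable k volume (-1) 1) {x y : ℝ}
    (hx : x ∈ Icc (-1 : ℝ) 1) (hy : y ∈ Icc (-1 : ℝ) 1) : IntervalIntegrable k volume x y := by
  refine hk.mono_set (uIcc_subset_uIcc ?_ ?_) <;> rwa [uIcc_of_le (by norm_num)]

theorem setIntegral_I_eq_interval (k : ℝ → 𝕜) : ∫ t in I, k t = ∫ t in (-1 : ℝ)..1, k t := by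
  rw [intervalIntegral.integral_of_le (by norm_num), integral_Ioc_eq_integral_Ioo]

theorem mem_Icc_of_mem_I {t : ℝ} (ht : t ∈ I) : t ∈ Icc (-1 : ℝ) 1 := Ioo_subset_Icc_self ht

theorem I_mem_nhdsGT : I ∈ 𝓝[>] (-1 : ℝ) := Ioo_mem_nhdsGT (by norm_num)

theorem I_mem_nhdsLT : I ∈ 𝓝[<] (1 : ℝ) := Ioo_mem_nhdsLT (by norm_num)

/-- A function with integrable derivative has limits at both end points. -/
theorem IsAC.exists_tendsto {h k : ℝ → 𝕜} (hh : IsAC h k) (hk : Integrable k muI) :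
    ∃ α, Tendsto h (𝓝[>] (-1)) (𝓝 α) ∧ Tendsto h (𝓝[<] 1) (𝓝 (α + ∫ t in I, k t)) := by
  have hi := intervalIntegrable_of_integrable hk
  have hc : ContinuousOn (fun t => ∫ s in (-1 : ℝ)..t, k s) (Icc (-1) 1) := by
    have := intervalIntegral.continuousOn_primitive_interval' hi left_mem_uIcc
    rwa [uIcc_of_le (by norm_num)] at this
  have e : ∀ t ∈ I, h t = h 0 - (∫ s in (-1 : ℝ)..0, k s) + ∫ s in (-1 : ℝ)..t, k s := by
    intro t ht
    have h1 := (hh 0 zero_mem_I t ht).2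
    have h2 := intervalIntegral.integral_add_adjacent_intervals
      (intervalIntegrable_mono hi (left_mem_Icc.mpr (by norm_num)) (mem_Icc_of_mem_I zero_mem_I))
      (intervalIntegrable_mono hi (mem_Icc_of_mem_I zero_mem_I) (mem_Icc_of_mem_I ht))
    rw [← h2, ← h1]
    ring
  refine ⟨h 0 - ∫ s in (-1 : ℝ)..0, k s, ?_, ?_⟩
  · have h1 : Tendsto (fun t => ∫ s in (-1 : ℝ)..t, k s) (𝓝[>] (-1)) (𝓝 0) := by
      have := hc (-1) (left_mem_Icc.mpr (by norm_num))
      rw [ContinuousWithinAt, intervalIntegral.integral_same] at this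
      exact this.mono_left (nhdsWithin_le_of_mem
        (mem_of_superset I_mem_nhdsGT Ioo_subset_Icc_self))
    have h2 := h1.const_add (h 0 - ∫ s in (-1 : ℝ)..0, k s)
    rw [add_zero] at h2
    refine h2.congr' ?_
    filter_upwards [I_mem_nhdsGT] with t ht using (e t ht).symm
  · rw [setIntegral_I_eq_interval]
    have h1 : Tendsto (fun t => ∫ s in (-1 : ℝ)..t, k s) (𝓝[<] 1)
        (𝓝 (∫ s in (-1 : ℝ)..1, k s)) := by
      have := hc 1 (right_mem_Icc.mpr (by norm_num))
      exact this.mono_left (nhdsWithin_le_of_mem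
        (mem_of_superset I_mem_nhdsLT Ioo_subset_Icc_self))
    have h2 := h1.const_add (h 0 - ∫ s in (-1 : ℝ)..0, k s)
    refine h2.congr' ?_
    filter_upwards [I_mem_nhdsLT] with t ht using (e t ht).symm

/-- If `h / ω` is integrable, then the only possible limit of `h` at `-1` is zero. -/
theorem eq_zero_of_integrable_div {h : ℝ → 𝕜} {α : 𝕜} (hlim : Tendsto h (𝓝[>] (-1)) (𝓝 α))
    (hi : Integrable (fun t => (1 + t)⁻¹ * ‖h t‖) muI) : α = 0 := by
  by_contra hα
  have hc : 0 < ‖α‖ / 2 := half_pos (norm_pos_iff.mpr hα)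
  have h1 : ∀ᶠ t in 𝓝[>] (-1 : ℝ), ‖α‖ / 2 < ‖h t‖ :=
    hlim.norm.eventually (lt_mem_nhds (half_lt_self (norm_pos_iff.mpr hα)))
  obtain ⟨δ, hδ, hsub⟩ := (mem_nhdsGT_iff_exists_Ioo_subset' (show (-1 : ℝ) < 1 by norm_num)).mp
    (inter_mem h1 I_mem_nhdsGT)
  have hδ' : (-1 : ℝ) < δ := hδ
  -- A nonzero limit keeps `‖h‖` above `‖α‖ / 2` near `-1`, which would make `1/ω` integrable at its
  -- singularity.
  have h2 : IntegrableOn (fun t : ℝ => (1 + t)⁻¹) (Ioo (-1) δ) volume := by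
    have h3 : IntegrableOn (fun t => (1 + t)⁻¹ * ‖h t‖) (Ioo (-1) δ) volume := by
      refine IntegrableOn.mono_set (t := I) hi fun t ht => (hsub ht).2
    refine (h3.const_mul (‖α‖ / 2)⁻¹).mono' ?_ ?_
    · exact (by fun_prop : Measurable fun t : ℝ => (1 + t)⁻¹).aestronglyMeasurable
    · filter_upwards [ae_restrict_mem measurableSet_Ioo] with t ht
      have hp : 0 < 1 + t := by linarith [ht.1]
      have h4 : ‖α‖ / 2 < ‖h t‖ := (hsub ht).1
      rw [Real.norm_of_nonneg (by positivity)]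
      have h5 : 1 ≤ (‖α‖ / 2)⁻¹ * ‖h t‖ := by
        rw [← div_eq_inv_mul, one_le_div hc]
        exact h4.le
      calc (1 + t)⁻¹ = (1 + t)⁻¹ * 1 := (mul_one _).symm
        _ ≤ (1 + t)⁻¹ * ((‖α‖ / 2)⁻¹ * ‖h t‖) := by gcongr
        _ = _ := by ring
  have h6 : IntervalIntegrable (fun t : ℝ => (t - (-1))⁻¹) volume (-1) δ := by
    rw [intervalIntegrable_iff_integrableOn_Ioo_of_le hδ'.le]
    refine h2.congr_fun (fun t _ => ?_) measurableSet_Ioo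
    simp only [sub_neg_eq_add]
    rw [add_comm]
  rw [intervalIntegrable_sub_inv_iff] at h6
  rcases h6 with h6 | h6
  · exact absurd h6 hδ'.ne
  · exact h6 left_mem_uIcc

/-- Integrability of `h / ω` removes the boundary term at `-1`, so only the one at `1` remains. All
the integral identities below are instances of this. -/
theorem IsAC.integral_eq {h k : ℝ → 𝕜} (hh : IsAC h k) (hk : Integrable k muI) {β : 𝕜}
    (hi : Integrable (fun t => (1 + t)⁻¹ * ‖h t‖) muI) (hβ : Tendsto h (𝓝[<] 1) (𝓝 β)) :
    ∫ t in I, k t = β := by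
  obtain ⟨α, h1, h2⟩ := hh.exists_tendsto hk
  rw [eq_zero_of_integrable_div h1 hi, zero_add] at h2
  exact tendsto_nhds_unique h2 hβ

theorem IsAC.eq_neg_integral {h k : ℝ → 𝕜} (hh : IsAC h k) {t : ℝ} (ht : t ∈ I)
    (hk : IntervalIntegrable k volume t 1) (hlim : Tendsto h (𝓝[<] 1) (𝓝 0)) :
    h t = - ∫ s in t..1, k s := by
  have hc := intervalIntegral.continuousOn_primitive_interval' hk left_mem_uIcc
  rw [uIcc_of_le ht.2.le] at hc
  have h1 : Tendsto (fun y => ∫ s in t..y, k s) (𝓝[<] 1) (𝓝 (∫ s in t..1, k s)) :=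
    (hc 1 (right_mem_Icc.mpr ht.2.le)).mono_left
      (nhdsWithin_le_of_mem (Icc_mem_nhdsLT ht.2))
  have h2 : Tendsto (fun y => ∫ s in t..y, k s) (𝓝[<] 1) (𝓝 (0 - h t)) := by
    refine (hlim.sub_const (h t)).congr' ?_
    filter_upwards [I_mem_nhdsLT] with y hy using (hh t ht y hy).2
  rw [tendsto_nhds_unique h1 h2]
  ring

theorem isAC_neg_integral {k : ℝ → 𝕜} (hk : ∀ t ∈ I, IntervalIntegrable k volume t 1) :
    IsAC (fun t => - ∫ s in t..1, k s) k ∧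
      Tendsto (fun t => - ∫ s in t..1, k s) (𝓝[<] 1) (𝓝 0) := by
  constructor
  · intro x hx y hy
    have h1 : IntervalIntegrable k volume x y := (hk x hx).trans (hk y hy).symm
    refine ⟨h1, ?_⟩
    simp only
    rw [← intervalIntegral.integral_add_adjacent_intervals h1 (hk y hy)]
    ring
  · have hc := intervalIntegral.continuousOn_primitive_interval' (hk 0 zero_mem_I) right_mem_uIcc
    rw [uIcc_of_le zero_le_one] at hc
    have h1 := (hc 1 (right_mem_Icc.mpr zero_le_one)).mono_left
      (nhdsWithin_le_of_mem (Icc_mem_nhdsLT (zero_lt_one' ℝ)))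
    simp only [intervalIntegral.integral_same] at h1
    refine h1.congr fun t => ?_
    rw [intervalIntegral.integral_symm]

/-- A nonnegative function whose integrals over compact subintervals are bounded is integrable. -/
theorem integrable_of_bounded {f : ℝ → ℝ} (h0 : ∀ t ∈ I, 0 ≤ f t)
    (hi : ∀ x ∈ I, ∀ y ∈ I, IntervalIntegrable f volume x y) {K y₀ : ℝ} (hy₀ : y₀ < 1)
    (hK : ∀ x ∈ I, ∀ y ∈ I, x ≤ y → y₀ ≤ y → ∫ t in x..y, f t ≤ K) : Integrable f muI := by
  -- The intervals `[-1 + ε n, 1 - ε n]` exhaust `I`, and `ε n ≤ 1/2` keeps their end points ordered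
  -- and inside `I`. The right end points eventually pass `y₀`, where `hK` applies.
  set ε : ℕ → ℝ := fun n => ((n : ℝ) + 2)⁻¹ with hε
  have hεp : ∀ n, 0 < ε n ∧ ε n ≤ 1 / 2 := by
    intro n
    have : (2 : ℝ) ≤ (n : ℝ) + 2 := by linarith [n.cast_nonneg (α := ℝ)]
    refine ⟨by positivity, ?_⟩
    rw [hε, one_div]
    exact inv_anti₀ (by norm_num) this
  have hε0 : Tendsto ε atTop (𝓝 0) :=
    tendsto_inv_atTop_zero.comp (tendsto_atTop_add_const_right _ _ tendsto_natCast_atTop_atTop)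
  have ha : Tendsto (fun n => -1 + ε n) atTop (𝓝 (-1)) := by simpa using hε0.const_add (-1)
  have hb : Tendsto (fun n => 1 - ε n) atTop (𝓝 1) := by simpa using hε0.const_sub 1
  have haI : ∀ n, -1 + ε n ∈ I := fun n => ⟨by linarith [hεp n], by linarith [hεp n]⟩
  have hbI : ∀ n, 1 - ε n ∈ I := fun n => ⟨by linarith [hεp n], by linarith [hεp n]⟩
  have hab : ∀ n, -1 + ε n ≤ 1 - ε n := fun n => by linarith [hεp n]
  have key := integrableOn_Ioc_of_intervalIntegral_norm_bounded (f := f) (I := K)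
    (fun n => (hi _ (haI n) _ (hbI n)).1) ha hb (by
      filter_upwards [hb.eventually (lt_mem_nhds hy₀)] with n hn
      have h1 := hK _ (haI n) _ (hbI n) (hab n) hn.le
      rw [intervalIntegral.integral_of_le (hab n)] at h1
      refine le_trans (le_of_eq ?_) h1
      refine setIntegral_congr_fun measurableSet_Ioc fun t ht => ?_
      rw [← uIoc_of_le (hab n)] at ht
      exact Real.norm_of_nonneg (h0 t (uIoc_subset_I (haI n) (hbI n) ht)))
  exact key.mono_set Ioo_subset_Ioc_self

end BoundaryLimits

/-! ### Hardy inequalities and the triples `u`, `u'`, `ω u''`. -/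

section Hardy

variable {𝕜 : Type*} [RCLike 𝕜]

/-- The real part of `x * conj y`. -/
noncomputable def reInner (x y : 𝕜) : ℝ := RCLike.re (x * conj y)

theorem abs_reInner_le (x y : 𝕜) : |reInner x y| ≤ ‖x‖ * ‖y‖ := by
  refine (RCLike.abs_re_le_norm _).trans ?_
  rw [norm_mul, RCLike.norm_conj]

theorem reInner_self (x : 𝕜) : reInner x x = ‖x‖ ^ 2 := by
  rw [reInner, RCLike.mul_conj, ← RCLike.ofReal_pow, RCLike.ofReal_re]

theorem reInner_comm (x y : 𝕜) : reInner x y = reInner y x := by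
  rw [reInner, reInner, ← RCLike.conj_re, map_mul, RCLike.conj_conj, mul_comm]

theorem reInner_smul_left (r : ℝ) (x y : 𝕜) : reInner ((r : 𝕜) * x) y = r * reInner x y := by
  rw [reInner, mul_assoc, RCLike.re_ofReal_mul, reInner]

theorem reInner_smul_right (r : ℝ) (x y : 𝕜) : reInner x ((r : 𝕜) * y) = r * reInner x y := by
  rw [reInner_comm, reInner_smul_left, reInner_comm]

theorem IsAC.reInner {F f G g : ℝ → 𝕜} (hF : IsAC F f) (hG : IsAC G g) :
    IsAC (𝕜 := ℝ) (fun t => reInner (F t) (G t))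
      (fun t => TEMode.reInner (f t) (G t) + TEMode.reInner (F t) (g t)) := by
  intro x hx y hy
  obtain ⟨h1, h2⟩ := (hF.mul hG.star) x hx y hy
  refine ⟨⟨?_, ?_⟩, ?_⟩
  · refine Integrable.congr (Integrable.re h1.1) (Eventually.of_forall fun t => ?_)
    simp [TEMode.reInner]
  · refine Integrable.congr (Integrable.re h1.2) (Eventually.of_forall fun t => ?_)
    simp [TEMode.reInner]
  · have h3 := congrArg RCLike.re h2
    have h4 := (RCLike.reCLM (K := 𝕜)).intervalIntegral_comp_comm h1
    simp only [RCLike.reCLM_apply] at h4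
    rw [map_sub] at h3
    simp only [TEMode.reInner]
    rw [h3, ← h4]
    simp

theorem isAC_weight_real : IsAC (𝕜 := ℝ) (fun t => 1 + t) (fun _ => 1) := IsAC.weight

theorem isAC_inv_weight_real :
    IsAC (𝕜 := ℝ) (fun t => (1 + t)⁻¹) (fun t => -((1 + t) ^ 2)⁻¹) := IsAC.inv_weight

/-- `P` has the derivative `g / ω` with `g ∈ L²(I)`, and vanishes at `1`. -/
structure HalfDatum (P g : ℝ → 𝕜) : Prop where
  ac : IsAC P (fun t => (((1 + t)⁻¹ : ℝ) : 𝕜) * g t)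
  mem : MemLp g 2 muI
  lim : Tendsto P (𝓝[<] 1) (𝓝 0)

theorem integrable_sq {f : ℝ → 𝕜} (hf : MemLp f 2 muI) : Integrable (fun t => ‖f t‖ ^ 2) muI :=
  hf.integrable_norm_pow two_ne_zero

theorem integrable_of_memLp_two {f : ℝ → 𝕜} (hf : MemLp f 2 muI) : Integrable f muI :=
  hf.integrable one_le_two

theorem integrable_mul_conj {f g : ℝ → 𝕜} (hf : MemLp f 2 muI) (hg : MemLp g 2 muI) :
    Integrable (fun t => f t * conj (g t)) muI := by
  have : MemLp (fun t => conj (g t)) 2 muI := hg.star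
  exact hf.integrable_mul this

theorem integrable_reInner {f g : ℝ → 𝕜} (hf : MemLp f 2 muI) (hg : MemLp g 2 muI) :
    Integrable (fun t => reInner (f t) (g t)) muI :=
  (integrable_mul_conj hf hg).re

theorem integral_sq_mono {f : ℝ → 𝕜} (hf : MemLp f 2 muI) {x y : ℝ} (hx : x ∈ I) (hy : y ∈ I)
    (hxy : x ≤ y) : ∫ t in x..y, ‖f t‖ ^ 2 ≤ ∫ t in I, ‖f t‖ ^ 2 := by
  rw [intervalIntegral.integral_of_le hxy]
  refine setIntegral_mono_set (integrable_sq hf) (Eventually.of_forall fun t => by positivity) ?_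
  exact (uIoc_of_le hxy ▸ uIoc_subset_I hx hy : Ioc x y ⊆ I).eventuallyLE

theorem intervalIntegrable_sq {f : ℝ → 𝕜} (hf : MemLp f 2 muI) {x y : ℝ} (hx : x ∈ I)
    (hy : y ∈ I) : IntervalIntegrable (fun t => ‖f t‖ ^ 2) volume x y :=
  intervalIntegrable_mono (intervalIntegrable_of_integrable (𝕜 := ℝ) (integrable_sq hf))
    (mem_Icc_of_mem_I hx) (mem_Icc_of_mem_I hy)

theorem weight_mul_inv {t : ℝ} (ht : t ∈ I) (x : 𝕜) :
    ((1 + t : ℝ) : 𝕜) * ((((1 + t)⁻¹ : ℝ) : 𝕜) * x) = x := by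
  rw [← mul_assoc, ← RCLike.ofReal_mul, mul_inv_cancel₀ (one_add_pos ht).ne', RCLike.ofReal_one,
    one_mul]

namespace HalfDatum

variable {P g : ℝ → 𝕜}

theorem aesm (h : HalfDatum P g) : AEStronglyMeasurable P muI :=
  h.ac.continuousOn.aestronglyMeasurable measurableSet_Ioo

/-- Since `P' = g / ω`, the weight cancels in the derivative; integrating this formula produces
Hardy's inequality for `P`. -/
theorem isAC_weight_sq (h : HalfDatum P g) : IsAC (𝕜 := ℝ) (fun t => (1 + t) * ‖P t‖ ^ 2)
    (fun t => ‖P t‖ ^ 2 + 2 * reInner (g t) (P t)) := by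
  have h1 := isAC_weight_real.mul (h.ac.reInner h.ac)
  refine (h1.congr fun t _ => ?_).congr_deriv fun t ht => ?_
  · rw [reInner_self]
  · have := one_add_pos ht
    rw [reInner_self, reInner_smul_left, reInner_smul_right, reInner_comm (P t)]
    field_simp
    ring

/-- Hardy's inequality: `P` is square integrable. -/
theorem memLp (h : HalfDatum P g) : MemLp P 2 muI := by
  rw [memLp_two_iff_integrable_sq_norm h.aesm]
  have h1 : ∀ᶠ t in 𝓝[<] (1 : ℝ), ‖P t‖ < 1 := by
    have := h.lim.norm
    rw [norm_zero] at this
    exact this.eventually (gt_mem_nhds one_pos)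
  obtain ⟨y₀, hy₀, hsub⟩ := (mem_nhdsLT_iff_exists_Ioo_subset' (show (-1 : ℝ) < 1 by norm_num)).mp
    (inter_mem h1 I_mem_nhdsLT)
  have hcs : ContinuousOn (fun t => ‖P t‖ ^ 2) I := h.ac.continuousOn.norm.pow 2
  obtain ⟨y₁, hy₁, hy₁'⟩ := exists_between (show y₀ < 1 from hy₀)
  -- Young's inequality gives `∫ (‖P‖²/2 - 2‖g‖²) ≤ (1+y)‖P y‖² - (1+x)‖P x‖²` over `[x, y]`. The
  -- term at `x` has a favourable sign and the one at `y` is at most `2`, because `‖P‖ < 1` near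
  -- `1`; this yields `K`.
  refine integrable_of_bounded (fun t _ => by positivity)
    (fun x hx y hy => (hcs.mono (uIcc_subset_I hx hy)).intervalIntegrable)
    (K := 4 + 4 * ∫ t in I, ‖g t‖ ^ 2) hy₁' fun x hx y hy hxy hy' => ?_
  have hPy : ‖P y‖ < 1 := (hsub ⟨hy₁.trans_le hy', hy.2⟩).1
  obtain ⟨i1, e1⟩ := h.isAC_weight_sq x hx y hy
  have i2 : IntervalIntegrable (fun t => ‖P t‖ ^ 2) volume x y :=
    (hcs.mono (uIcc_subset_I hx hy)).intervalIntegrable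
  have i3 := intervalIntegrable_sq h.mem hx hy
  have hle : ∫ t in x..y, (1 / 2 * ‖P t‖ ^ 2 - 2 * ‖g t‖ ^ 2) ≤
      ∫ t in x..y, (‖P t‖ ^ 2 + 2 * reInner (g t) (P t)) := by
    refine intervalIntegral.integral_mono_on hxy ((i2.const_mul _).sub (i3.const_mul _)) i1
      fun t _ => ?_
    have := (abs_le.mp (abs_reInner_le (g t) (P t))).1
    nlinarith [sq_nonneg (‖P t‖ - 2 * ‖g t‖)]
  rw [← e1, intervalIntegral.integral_sub (i2.const_mul _) (i3.const_mul _),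
    intervalIntegral.integral_const_mul, intervalIntegral.integral_const_mul] at hle
  have h2 := integral_sq_mono h.mem hx hy hxy
  have h3 : (1 + y) * ‖P y‖ ^ 2 ≤ 2 := by
    have : ‖P y‖ ^ 2 ≤ 1 := by nlinarith [norm_nonneg (P y)]
    nlinarith [hy.2, one_add_pos hy]
  have h4 : 0 ≤ (1 + x) * ‖P x‖ ^ 2 := mul_nonneg (one_add_pos hx).le (by positivity)
  linarith

/-- `ω P` has the integrable derivative `P + g`, so the limit exists; it is zero because `(ω P) / ω
= P` is integrable. -/
theorem weight_tendsto (h : HalfDatum P g) :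
    Tendsto (fun t => ((1 + t : ℝ) : 𝕜) * P t) (𝓝[>] (-1)) (𝓝 0) := by
  have h1 := IsAC.weight.mul h.ac
  have h2 : IsAC (fun t => ((1 + t : ℝ) : 𝕜) * P t) (fun t => P t + g t) :=
    h1.congr_deriv fun t ht => by rw [one_mul, weight_mul_inv ht]
  obtain ⟨α, h3, -⟩ := h2.exists_tendsto
    ((integrable_of_memLp_two h.memLp).add (integrable_of_memLp_two h.mem))
  have h4 : α = 0 := by
    refine eq_zero_of_integrable_div h3 ((integrable_of_memLp_two h.memLp).norm.congr ?_)
    filter_upwards [ae_restrict_mem measurableSet_Ioo] with t ht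
    have := one_add_pos ht
    rw [norm_mul, RCLike.norm_ofReal, abs_of_pos this]
    field_simp
  rwa [h4] at h3

theorem integral_identity (h : HalfDatum P g) :
    ∫ t in I, (‖P t‖ ^ 2 + 2 * reInner (g t) (P t)) = 0 := by
  refine h.isAC_weight_sq.integral_eq
    ((integrable_sq h.memLp).add ((integrable_reInner h.mem h.memLp).const_mul 2)) ?_ ?_
  · refine (integrable_sq h.memLp).congr ?_
    filter_upwards [ae_restrict_mem measurableSet_Ioo] with t ht
    have := one_add_pos ht
    rw [Real.norm_of_nonneg (by positivity)]
    field_simp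
  · have h1 : Tendsto (fun t : ℝ => 1 + t) (𝓝[<] 1) (𝓝 (1 + 1)) :=
      ((continuous_const.add continuous_id).tendsto (1 : ℝ)).mono_left nhdsWithin_le_nhds
    simpa using h1.mul (h.lim.norm.pow 2)

theorem intervalIntegrable (hg : MemLp g 2 muI) {t : ℝ} (ht : t ∈ I) :
    IntervalIntegrable (fun s => (((1 + s)⁻¹ : ℝ) : 𝕜) * g s) volume t 1 := by
  have h1 : IntervalIntegrable g volume t 1 := intervalIntegrable_mono
    (intervalIntegrable_of_integrable (integrable_of_memLp_two hg)) (mem_Icc_of_mem_I ht)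
    (right_mem_Icc.mpr (by norm_num))
  refine h1.continuousOn_mul (RCLike.continuous_ofReal.comp_continuousOn ?_)
  rw [uIcc_of_le ht.2.le]
  refine ContinuousOn.inv₀ (by fun_prop) fun s hs => ?_
  linarith [hs.1, ht.1]

theorem eq_neg_integral (h : HalfDatum P g) {t : ℝ} (ht : t ∈ I) :
    P t = - ∫ s in t..1, (((1 + s)⁻¹ : ℝ) : 𝕜) * g s :=
  h.ac.eq_neg_integral ht (intervalIntegrable h.mem ht) h.lim

end HalfDatum

theorem halfDatum_integral {g : ℝ → 𝕜} (hg : MemLp g 2 muI) :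
    HalfDatum (fun t => - ∫ s in t..1, (((1 + s)⁻¹ : ℝ) : 𝕜) * g s) g := by
  obtain ⟨h1, h2⟩ := isAC_neg_integral fun t ht => HalfDatum.intervalIntegrable hg ht
  exact ⟨h1, hg, h2⟩

/-- `U' = P`, `P' = g / ω` with `g ∈ L²(I)`, and `U(±1) = P(1) = 0`. -/
structure Datum (U P g : ℝ → 𝕜) : Prop where
  half : HalfDatum P g
  ac : IsAC U P
  limL : Tendsto U (𝓝[>] (-1)) (𝓝 0)
  limR : Tendsto U (𝓝[<] 1) (𝓝 0)

namespace Datum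

variable {U P g : ℝ → 𝕜}

/-- `U` vanishes at `-1` and `U' = P` is square integrable, so `U` grows at most like `√(1+t)`.
Young's inequality with parameter `r = √(1+t)` plays the role of Cauchy-Schwarz. As a result `‖U‖² /
ω` stays bounded, as `memLp_quot` requires. -/
theorem norm_le (h : Datum U P g) {t : ℝ} (ht : t ∈ I) :
    ‖U t‖ ≤ √(1 + t) * (((∫ s in I, ‖P s‖ ^ 2) + 1) / 2) := by
  set J := ∫ s in I, ‖P s‖ ^ 2 with hJ
  set r := √(1 + t) with hr
  have hp := one_add_pos ht
  have hrp : 0 < r := Real.sqrt_pos.mpr hp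
  have hr2 : r ^ 2 = 1 + t := Real.sq_sqrt hp.le
  have h1 : Tendsto (fun x => ‖U t - U x‖) (𝓝[>] (-1)) (𝓝 ‖U t - 0‖) := (h.limL.const_sub _).norm
  rw [sub_zero] at h1
  refine le_of_tendsto h1 ?_
  filter_upwards [Ioo_mem_nhdsGT ht.1] with x hx
  have hxI : x ∈ I := ⟨hx.1, hx.2.trans ht.2⟩
  obtain ⟨i1, e1⟩ := h.ac x hxI t ht
  have i2 := intervalIntegrable_sq h.half.memLp hxI ht
  rw [e1]
  calc ‖∫ s in x..t, P s‖ ≤ ∫ s in x..t, ‖P s‖ :=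
        intervalIntegral.norm_integral_le_integral_norm hx.2.le
    _ ≤ ∫ s in x..t, (r / 2 * ‖P s‖ ^ 2 + 1 / (2 * r)) := by
        refine intervalIntegral.integral_mono_on hx.2.le i1.norm
          ((i2.const_mul _).add intervalIntegrable_const) fun s _ => ?_
        have h2 : r / 2 * ‖P s‖ ^ 2 + 1 / (2 * r) - ‖P s‖ = (r * ‖P s‖ - 1) ^ 2 / (2 * r) := by
          field_simp
          ring
        have h3 : 0 ≤ (r * ‖P s‖ - 1) ^ 2 / (2 * r) := by positivity
        linarith
    _ = r / 2 * (∫ s in x..t, ‖P s‖ ^ 2) + (t - x) / (2 * r) := by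
        rw [intervalIntegral.integral_add (i2.const_mul _) intervalIntegrable_const,
          intervalIntegral.integral_const_mul, intervalIntegral.integral_const, smul_eq_mul]
        ring
    _ ≤ r / 2 * J + r ^ 2 / (2 * r) := by
        gcongr
        · exact integral_sq_mono h.half.memLp hxI ht hx.2.le
        · rw [hr2]
          linarith [hx.1]
    _ = r * ((J + 1) / 2) := by
        field_simp

/-- The quotient `U / ω`. -/
noncomputable def quot (U : ℝ → 𝕜) (t : ℝ) : 𝕜 := (((1 + t)⁻¹ : ℝ) : 𝕜) * U t

theorem continuousOn_quot (h : Datum U P g) : ContinuousOn (quot U) I :=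
  IsAC.inv_weight.continuousOn.mul h.ac.continuousOn

theorem isAC_div_sq (h : Datum U P g) : IsAC (𝕜 := ℝ) (fun t => (1 + t)⁻¹ * ‖U t‖ ^ 2)
    (fun t => 2 * reInner (P t) (quot U t) - ‖quot U t‖ ^ 2) := by
  have h1 := isAC_inv_weight_real.mul (h.ac.reInner h.ac)
  refine (h1.congr fun t _ => ?_).congr_deriv fun t ht => ?_
  · rw [reInner_self]
  · have := one_add_pos ht
    rw [reInner_self, quot, reInner_smul_right, reInner_comm (U t), norm_mul, RCLike.norm_ofReal,
      mul_pow, sq_abs]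
    field_simp
    ring

theorem memLp_quot (h : Datum U P g) : MemLp (quot U) 2 muI := by
  rw [memLp_two_iff_integrable_sq_norm
    (h.continuousOn_quot.aestronglyMeasurable measurableSet_Ioo)]
  have hcs : ContinuousOn (fun t => ‖quot U t‖ ^ 2) I := h.continuousOn_quot.norm.pow 2
  set J := ∫ s in I, ‖P s‖ ^ 2 with hJ
  -- Here the boundary term at `y` has the favourable sign and the one at `x` is controlled by
  -- `norm_le`; Young's inequality absorbs half of `‖U/ω‖²`.
  refine integrable_of_bounded (fun t _ => by positivity)
    (fun x hx y hy => (hcs.mono (uIcc_subset_I hx hy)).intervalIntegrable)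
    (K := 4 * J + 2 * ((J + 1) / 2) ^ 2) zero_lt_one fun x hx y hy hxy _ => ?_
  obtain ⟨i1, e1⟩ := h.isAC_div_sq x hx y hy
  have i2 : IntervalIntegrable (fun t => ‖quot U t‖ ^ 2) volume x y :=
    (hcs.mono (uIcc_subset_I hx hy)).intervalIntegrable
  have i3 := intervalIntegrable_sq h.half.memLp hx hy
  have hle : ∫ t in x..y, (2 * reInner (P t) (quot U t) - ‖quot U t‖ ^ 2) ≤
      ∫ t in x..y, (2 * ‖P t‖ ^ 2 - 1 / 2 * ‖quot U t‖ ^ 2) := by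
    refine intervalIntegral.integral_mono_on hxy i1 ((i3.const_mul _).sub (i2.const_mul _))
      fun t _ => ?_
    have := (abs_le.mp (abs_reInner_le (P t) (quot U t))).2
    nlinarith [sq_nonneg (‖quot U t‖ - 2 * ‖P t‖)]
  rw [← e1, intervalIntegral.integral_sub (i3.const_mul _) (i2.const_mul _),
    intervalIntegral.integral_const_mul, intervalIntegral.integral_const_mul] at hle
  have h2 := integral_sq_mono h.half.memLp hx hy hxy
  have hpx := one_add_pos hx
  have h3 : 0 ≤ (1 + y)⁻¹ * ‖U y‖ ^ 2 := mul_nonneg (inv_nonneg.mpr (one_add_pos hy).le) (by positivity)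
  have h4 : (1 + x)⁻¹ * ‖U x‖ ^ 2 ≤ ((J + 1) / 2) ^ 2 := by
    have h5 := pow_le_pow_left₀ (norm_nonneg _) (h.norm_le hx) 2
    rw [mul_pow, Real.sq_sqrt hpx.le] at h5
    rw [inv_mul_le_iff₀ hpx]
    exact h5
  linarith

theorem inv_tendsto : Tendsto (fun t : ℝ => (1 + t)⁻¹) (𝓝[<] 1) (𝓝 ((1 + 1 : ℝ)⁻¹)) :=
  (((continuous_const.add continuous_id).tendsto (1 : ℝ)).inv₀ (by norm_num)).mono_left
    nhdsWithin_le_nhds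

theorem integral_identity_quot (h : Datum U P g) :
    ∫ t in I, (2 * reInner (P t) (quot U t) - ‖quot U t‖ ^ 2) = 0 := by
  refine h.isAC_div_sq.integral_eq
    (((integrable_reInner h.half.memLp h.memLp_quot).const_mul 2).sub
      (integrable_sq h.memLp_quot)) ?_ ?_
  · refine (integrable_sq h.memLp_quot).congr ?_
    filter_upwards [ae_restrict_mem measurableSet_Ioo] with t ht
    have := one_add_pos ht
    rw [Real.norm_of_nonneg (by positivity), quot, norm_mul, RCLike.norm_ofReal, mul_pow, sq_abs]
    ring
  · simpa using inv_tendsto.mul (h.limR.norm.pow 2)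

/-- Integration by parts of `u''` against `u`, with the factor `1/ω` moved from `g / ω` onto `U`. -/
theorem integral_identity_mixed (h : Datum U P g) :
    ∫ t in I, (reInner (g t) (quot U t) + ‖P t‖ ^ 2) = 0 := by
  have h1 : IsAC (𝕜 := ℝ) (fun t => reInner (P t) (U t))
      (fun t => reInner (g t) (quot U t) + ‖P t‖ ^ 2) := by
    refine (h.half.ac.reInner h.ac).congr_deriv fun t _ => ?_
    rw [reInner_self, quot, reInner_smul_left, reInner_smul_right]
  refine h1.integral_eq ((integrable_reInner h.half.mem h.memLp_quot).add
    (integrable_sq h.half.memLp)) ?_ ?_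
  · refine (integrable_reInner h.half.memLp h.memLp_quot).norm.congr ?_
    filter_upwards [ae_restrict_mem measurableSet_Ioo] with t ht
    have := one_add_pos ht
    rw [quot, reInner_smul_right, norm_mul, Real.norm_of_nonneg (by positivity)]
  · have h2 := (h.half.lim.mul ((RCLike.continuous_conj.tendsto (0 : 𝕜)).comp h.limR))
    rw [zero_mul] at h2
    simpa [reInner, Function.comp_def] using (RCLike.continuous_re.tendsto (0 : 𝕜)).comp h2

/-- `ω U' - U` is a primitive of `g = ω U''`. This gives the mean-zero condition on `g`, the formula
for `U` in terms of `g`, and the recipe that recovers `U` from `g`. -/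
theorem isAC_weight_sub (h : Datum U P g) :
    IsAC (fun t => ((1 + t : ℝ) : 𝕜) * P t - U t) g :=
  ((IsAC.weight.mul h.half.ac).sub h.ac).congr_deriv fun t ht => by
    rw [one_mul, weight_mul_inv ht]
    ring

theorem weight_sub_tendsto (h : Datum U P g) :
    Tendsto (fun t => ((1 + t : ℝ) : 𝕜) * P t - U t) (𝓝[<] 1) (𝓝 0) := by
  have h1 : Tendsto (fun t : ℝ => ((1 + t : ℝ) : 𝕜)) (𝓝[<] 1) (𝓝 ((1 + 1 : ℝ) : 𝕜)) :=
    ((RCLike.continuous_ofReal.comp (continuous_const.add continuous_id)).tendsto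
      (1 : ℝ)).mono_left nhdsWithin_le_nhds
  simpa using (h1.mul h.half.lim).sub h.limR

/-- The primitive `ω P - U` of `g` vanishes at both end points. By `exists_datum` this is the only
compatibility condition. -/
theorem integral_eq_zero (h : Datum U P g) : ∫ t in I, g t = 0 := by
  obtain ⟨α, h1, h2⟩ := h.isAC_weight_sub.exists_tendsto (integrable_of_memLp_two h.half.mem)
  have h3 : Tendsto (fun t => ((1 + t : ℝ) : 𝕜) * P t - U t) (𝓝[>] (-1)) (𝓝 (0 - 0)) :=
    h.half.weight_tendsto.sub h.limL
  rw [tendsto_nhds_unique h1 h3, sub_zero, zero_add] at h2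
  exact tendsto_nhds_unique h2 h.weight_sub_tendsto

theorem eq_add_integral (h : Datum U P g) {t : ℝ} (ht : t ∈ I) :
    U t = ((1 + t : ℝ) : 𝕜) * P t + ∫ s in t..1, g s := by
  have h1 := h.isAC_weight_sub.eq_neg_integral ht (intervalIntegrable_mono
    (intervalIntegrable_of_integrable (integrable_of_memLp_two h.half.mem)) (mem_Icc_of_mem_I ht)
    (right_mem_Icc.mpr (by norm_num))) h.weight_sub_tendsto
  linear_combination -h1

end Datum

/-- Every `g ∈ L²(I)` with mean zero comes from a function `U`. -/
theorem exists_datum {g : ℝ → 𝕜} (hg : MemLp g 2 muI) (h0 : ∫ t in I, g t = 0) :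
    ∃ U P, Datum U P g := by
  have hP := halfDatum_integral hg
  set P : ℝ → 𝕜 := fun t => - ∫ s in t..1, (((1 + s)⁻¹ : ℝ) : 𝕜) * g s with hPdef
  obtain ⟨h1, h2⟩ := isAC_neg_integral (k := g) fun t ht => intervalIntegrable_mono
    (intervalIntegrable_of_integrable (integrable_of_memLp_two hg)) (mem_Icc_of_mem_I ht)
    (right_mem_Icc.mpr (by norm_num))
  -- `U` is solved from `ω P - U = -∫_t^1 g`. The right side vanishes at `1` by its form and at `-1`
  -- because `g` has mean zero.
  refine ⟨fun t => ((1 + t : ℝ) : 𝕜) * P t - (- ∫ s in t..1, g s), P, hP, ?_, ?_, ?_⟩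
  · exact ((IsAC.weight.mul hP.ac).sub h1).congr_deriv fun t ht => by
      rw [one_mul, weight_mul_inv ht]
      ring
  · obtain ⟨α, h3, h4⟩ := h1.exists_tendsto (integrable_of_memLp_two hg)
    rw [h0, add_zero] at h4
    rw [tendsto_nhds_unique h4 h2] at h3
    simpa using hP.weight_tendsto.sub h3
  · have h3 : Tendsto (fun t : ℝ => ((1 + t : ℝ) : 𝕜)) (𝓝[<] 1) (𝓝 ((1 + 1 : ℝ) : 𝕜)) :=
      ((RCLike.continuous_ofReal.comp (continuous_const.add continuous_id)).tendsto
        (1 : ℝ)).mono_left nhdsWithin_le_nhds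
    simpa using (h3.mul hP.lim).sub h2

end Hardy

/-! ### `H2` as a closed subspace of `L²(I)` through `u ↦ ω u''`. -/

section Representation

variable {𝕜 : Type*} [RCLike 𝕜]

/-- `U`, `P`, `g` represent `u`, `∂_t u`, `ω ∂_t² u`. -/
structure Rep (u : Fn 𝕜) (U P g : ℝ → 𝕜) : Prop where
  datum : Datum U P g
  weak₁ : IsWeakDeriv u (wderiv u)
  weak₂ : IsWeakDeriv (wderiv u) (wderiv (wderiv u))
  eq₀ : u =ᵐ[muI] U
  eq₁ : wderiv u =ᵐ[muI] P
  eq₂ : ∀ᵐ t ∂muI, ((1 + t : ℝ) : 𝕜) * wderiv (wderiv u) t = g t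

theorem zpow_two_eq (x : ℝ) : x ^ (2 : ℤ) = x ^ 2 := zpow_ofNat x 2

/-- Continuous representatives that agree almost everywhere on an open set agree everywhere on it,
so the boundary value passes from one to any other. -/
theorem HasBoundaryValue.tendsto {u : Fn 𝕜} {x : ℝ} {c : 𝕜} (h : HasBoundaryValue u x c)
    {F : ℝ → 𝕜} (hu : u =ᵐ[muI] F) (hF : ContinuousOn F I) : Tendsto F (𝓝[I] x) (𝓝 c) := by
  obtain ⟨f, h1, h2, h3⟩ := h
  have h4 : EqOn f F I := Measure.eqOn_open_of_ae_eq (h1.symm.trans hu) isOpen_Ioo h2 hF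
  exact h3.congr' (eventually_nhdsWithin_of_forall h4)

theorem nhdsWithin_I_left : 𝓝[I] (-1 : ℝ) = 𝓝[>] (-1) :=
  nhdsWithin_Ioo_eq_nhdsGT (by norm_num)

theorem nhdsWithin_I_right : 𝓝[I] (1 : ℝ) = 𝓝[<] 1 :=
  nhdsWithin_Ioo_eq_nhdsLT (by norm_num)

theorem exists_rep {u : Fn 𝕜} (hu : u ∈ H2 𝕜) : ∃ U P g, Rep u U P g := by
  obtain ⟨u₁, u₂, a1, a2, -, -, a5, a6, a7, a8⟩ := hu
  obtain ⟨U, hU, acU⟩ := a1.exists_isAC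
  obtain ⟨P, hP, acP⟩ := a2.exists_isAC
  have e1 : wderiv u = u₁ := a1.wderiv_eq
  have e2 : wderiv u₁ = u₂ := a2.wderiv_eq
  have acU' := acU.congr_deriv_ae hP
  refine ⟨U, P, fun t => ((1 + t : ℝ) : 𝕜) * u₂ t, ⟨⟨?_, ?_, ?_⟩, acU', ?_, ?_⟩, ?_, ?_, hU, ?_, ?_⟩
  · refine acP.congr_deriv fun t ht => ?_
    rw [mul_left_comm, weight_mul_inv ht]
  · have hm : AEStronglyMeasurable (fun t : ℝ => ((1 + t : ℝ) : 𝕜) * u₂ t) muI :=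
      (RCLike.continuous_ofReal.comp
        (continuous_const.add continuous_id)).aestronglyMeasurable.mul u₂.aestronglyMeasurable
    rw [memLp_two_iff_integrable_sq_norm hm]
    refine Integrable.congr a5 (Eventually.of_forall fun t => ?_)
    simp only [norm_mul, RCLike.norm_ofReal, mul_pow, sq_abs, zpow_two_eq]
  · rw [← nhdsWithin_I_right]
    exact a8.tendsto hP acP.continuousOn
  · rw [← nhdsWithin_I_left]
    exact a6.tendsto hU acU.continuousOn
  · rw [← nhdsWithin_I_right]
    exact a7.tendsto hU acU.continuousOn
  · rw [e1]
    exact a1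
  · rw [e1, e2]
    exact a2
  · rw [e1]
    exact hP
  · rw [e1, e2]
    exact Eventually.of_forall fun _ => rfl

/-- The integrability of `u/ω` and `u'` demanded by `H2` is supplied by `memLp_quot` and
`HalfDatum.memLp`. -/
theorem Datum.exists_mem {U P g : ℝ → 𝕜} (h : Datum U P g) : ∃ u ∈ H2 𝕜, Rep u U P g := by
  have mU : AEStronglyMeasurable U muI :=
    h.ac.continuousOn.aestronglyMeasurable measurableSet_Ioo
  have mP := h.half.aesm
  have mg : AEStronglyMeasurable (fun t : ℝ => (((1 + t)⁻¹ : ℝ) : 𝕜) * g t) muI :=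
    (IsAC.inv_weight.continuousOn.aestronglyMeasurable measurableSet_Ioo).mul
      h.half.mem.aestronglyMeasurable
  set u : Fn 𝕜 := AEEqFun.mk U mU with hu
  set u₁ : Fn 𝕜 := AEEqFun.mk P mP with hu₁
  set u₂ : Fn 𝕜 := AEEqFun.mk _ mg with hu₂
  have c0 : u =ᵐ[muI] U := AEEqFun.coeFn_mk _ _
  have c1 : u₁ =ᵐ[muI] P := AEEqFun.coeFn_mk _ _
  have c2 : u₂ =ᵐ[muI] fun t : ℝ => (((1 + t)⁻¹ : ℝ) : 𝕜) * g t := AEEqFun.coeFn_mk _ _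
  have w1 : IsWeakDeriv u u₁ := h.ac.isWeakDeriv c0 c1
  have w2 : IsWeakDeriv u₁ u₂ := h.half.ac.isWeakDeriv c1 c2
  refine ⟨u, ⟨u₁, u₂, w1, w2, ?_, ?_, ?_, ?_, ?_, ?_⟩, h, ?_, ?_, c0, ?_, ?_⟩
  · refine (integrable_sq h.memLp_quot).congr ?_
    filter_upwards [c0] with t h0
    rw [h0, Datum.quot, norm_mul, RCLike.norm_ofReal, mul_pow, sq_abs, zpow_neg, zpow_two_eq,
      inv_pow]
  · refine (integrable_sq h.half.memLp).congr ?_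
    filter_upwards [c1] with t h0
    rw [h0, zpow_zero, one_mul]
  · refine (integrable_sq h.half.mem).congr ?_
    filter_upwards [c2, ae_restrict_mem measurableSet_Ioo] with t h0 ht
    have := one_add_pos ht
    rw [h0, norm_mul, RCLike.norm_ofReal, mul_pow, sq_abs, zpow_two_eq]
    field_simp
  · exact ⟨U, c0, h.ac.continuousOn, nhdsWithin_I_left ▸ h.limL⟩
  · exact ⟨U, c0, h.ac.continuousOn, nhdsWithin_I_right ▸ h.limR⟩
  · exact ⟨P, c1, h.half.ac.continuousOn, nhdsWithin_I_right ▸ h.half.lim⟩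
  · rw [w1.wderiv_eq]
    exact w1
  · rw [w1.wderiv_eq, w2.wderiv_eq]
    exact w2
  · rw [w1.wderiv_eq]
    exact c1
  · rw [w1.wderiv_eq, w2.wderiv_eq]
    filter_upwards [c2, ae_restrict_mem measurableSet_Ioo] with t h0 ht
    rw [h0, weight_mul_inv ht]

theorem wderiv_add {u v : Fn 𝕜} (hu : u ∈ H2 𝕜) (hv : v ∈ H2 𝕜) :
    wderiv (u + v) = wderiv u + wderiv v ∧
      wderiv (wderiv (u + v)) = wderiv (wderiv u) + wderiv (wderiv v) := by
  obtain ⟨U, P, g, ru⟩ := exists_rep hu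
  obtain ⟨U', P', g', rv⟩ := exists_rep hv
  have h1 := (ru.weak₁.add rv.weak₁).wderiv_eq
  exact ⟨h1, by rw [h1, (ru.weak₂.add rv.weak₂).wderiv_eq]⟩

theorem wderiv_smul (c : 𝕜) {u : Fn 𝕜} (hu : u ∈ H2 𝕜) :
    wderiv (c • u) = c • wderiv u ∧ wderiv (wderiv (c • u)) = c • wderiv (wderiv u) := by
  obtain ⟨U, P, g, ru⟩ := exists_rep hu
  have h1 := (ru.weak₁.smul c).wderiv_eq
  exact ⟨h1, by rw [h1, (ru.weak₂.smul c).wderiv_eq]⟩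

/-- The weighted second derivative `ω ∂_t² u`. -/
noncomputable def wd2 (u : Fn 𝕜) (t : ℝ) : 𝕜 := ((1 + t : ℝ) : 𝕜) * wderiv (wderiv u) t

theorem memLp_wd2 {u : Fn 𝕜} (hu : u ∈ H2 𝕜) : MemLp (wd2 u) 2 muI := by
  obtain ⟨U, P, g, ru⟩ := exists_rep hu
  exact ru.datum.half.mem.ae_eq (ru.eq₂.mono fun t ht => ht.symm)

variable (𝕜) in
/-- The map `u ↦ ω ∂_t² u` from `H²_{0,ω,l}(I)` to `L²(I)`. -/
noncomputable def secondDeriv : H2 𝕜 →ₗ[𝕜] Lp 𝕜 2 muI where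
  toFun u := (memLp_wd2 u.2).toLp
  map_add' u v := by
    rw [← MemLp.toLp_add]
    refine MemLp.toLp_congr _ _ ?_
    have h := (wderiv_add u.2 v.2).2
    filter_upwards [AEEqFun.coeFn_add (wderiv (wderiv (u : Fn 𝕜))) (wderiv (wderiv (v : Fn 𝕜)))]
      with t ht
    simp only [wd2, Pi.add_apply, Submodule.coe_add]
    rw [h, ht, Pi.add_apply, mul_add]
  map_smul' c u := by
    rw [RingHom.id_apply, ← MemLp.toLp_const_smul]
    refine MemLp.toLp_congr _ _ ?_
    have h := (wderiv_smul c u.2).2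
    filter_upwards [AEEqFun.coeFn_smul c (wderiv (wderiv (u : Fn 𝕜)))] with t ht
    simp only [wd2, Pi.smul_apply, Submodule.coe_smul, smul_eq_mul]
    rw [h, ht, Pi.smul_apply, smul_eq_mul]
    ring

theorem secondDeriv_ae {u : H2 𝕜} {U P g : ℝ → 𝕜} (h : Rep (u : Fn 𝕜) U P g) :
    secondDeriv 𝕜 u =ᵐ[muI] g := by
  filter_upwards [(memLp_wd2 u.2).coeFn_toLp, h.eq₂] with t h1 h2
  rw [← h2]
  exact h1

theorem norm_Lp_sq {f : Lp 𝕜 2 muI} {g : ℝ → 𝕜} (h : f =ᵐ[muI] g) :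
    ‖f‖ ^ 2 = ∫ t in I, ‖g t‖ ^ 2 := by
  rw [← @inner_self_eq_norm_sq 𝕜, L2.inner_def, ← integral_re]
  · refine integral_congr_ae ?_
    filter_upwards [h] with t ht
    rw [ht, inner_self_eq_norm_sq]
  · exact L2.integrable_inner f f

/-- Integration against a bounded real kernel is a bounded functional on `L²(I)`. -/
theorem exists_inner_eq {k : ℝ → ℝ} (hk : Measurable k) (hb : ∀ t ∈ I, |k t| ≤ 1) :
    ∃ K : Lp 𝕜 2 muI, ‖K‖ ≤ (measureUnivNNReal muI : ℝ) ^ (2 : ℝ≥0∞).toReal⁻¹ ∧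
      ∀ (f : Lp 𝕜 2 muI) (g : ℝ → 𝕜), f =ᵐ[muI] g →
        inner 𝕜 K f = ∫ t in I, (k t : 𝕜) * g t := by
  have hbd : ∀ᵐ t ∂muI, ‖(k t : 𝕜)‖ ≤ 1 := by
    filter_upwards [ae_restrict_mem measurableSet_Ioo] with t ht
    rw [RCLike.norm_ofReal]
    exact hb t ht
  have hm : MemLp (fun t => (k t : 𝕜)) 2 muI :=
    MemLp.of_bound (RCLike.measurable_ofReal.comp hk).aestronglyMeasurable 1 hbd
  refine ⟨hm.toLp, ?_, fun f g hfg => ?_⟩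
  · have := Lp.norm_le_of_ae_bound (f := hm.toLp) zero_le_one (by
      filter_upwards [hm.coeFn_toLp, hbd] with t h1 h2
      rwa [h1])
    simpa using this
  · rw [L2.inner_def]
    refine integral_congr_ae ?_
    filter_upwards [hm.coeFn_toLp, hfg] with t h1 h2
    rw [h1, h2, RCLike.inner_apply, RCLike.conj_ofReal, mul_comm]

theorem setIntegral_kernel {t : ℝ} (ht : t ∈ I) (κ : ℝ → ℝ) (g : ℝ → 𝕜) :
    ∫ s in I, (((Ioi t).indicator κ s : ℝ) : 𝕜) * g s = ∫ s in t..1, (κ s : 𝕜) * g s := by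
  have e : (fun s => (((Ioi t).indicator κ s : ℝ) : 𝕜) * g s)
      = (Ioi t).indicator fun s => (κ s : 𝕜) * g s := by
    ext s
    by_cases hs : s ∈ Ioi t <;> simp [hs]
  rw [e, setIntegral_indicator measurableSet_Ioi, intervalIntegral.integral_of_le ht.2.le,
    integral_Ioc_eq_integral_Ioo]
  congr 2
  ext s
  simp only [mem_inter_iff, mem_Ioo, mem_Ioi]
  constructor
  · rintro ⟨⟨-, h1⟩, h2⟩
    exact ⟨h2, h1⟩
  · rintro ⟨h1, h2⟩
    exact ⟨⟨ht.1.trans h1, h2⟩, h1⟩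

/-- Point evaluations of `ω ∂_t u` and `u` are functionals of `ω ∂_t² u`, bounded uniformly in the
point. -/
theorem exists_eval_kernels {t : ℝ} (ht : t ∈ I) :
    ∃ K₁ K₂ : Lp 𝕜 2 muI, ‖K₁‖ ≤ (measureUnivNNReal muI : ℝ) ^ (2 : ℝ≥0∞).toReal⁻¹ ∧
      ‖K₂‖ ≤ (measureUnivNNReal muI : ℝ) ^ (2 : ℝ≥0∞).toReal⁻¹ ∧
      ∀ (u : H2 𝕜) (U P g : ℝ → 𝕜), Rep (u : Fn 𝕜) U P g →
        ((1 + t : ℝ) : 𝕜) * P t = - inner 𝕜 K₁ (secondDeriv 𝕜 u) ∧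
        U t = inner 𝕜 K₂ (secondDeriv 𝕜 u) := by
  have hpt := one_add_pos ht
  -- The kernels are read off from `P(t) = -∫_t^1 g/ω` and `U(t) = (1+t) P(t) + ∫_t^1 g`. For `s >
  -- t` the ratio `(1+t)/(1+s)` lies in `(0, 1)`, so both kernels are bounded by `1` whatever `t`
  -- is.
  obtain ⟨K₁, hK₁, h₁⟩ := exists_inner_eq (𝕜 := 𝕜)
    (k := (Ioi t).indicator fun s => (1 + t) * (1 + s)⁻¹)
    (Measurable.indicator (by fun_prop) measurableSet_Ioi) fun s hs => by
      by_cases hst : s ∈ Ioi t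
      · have hts : t < s := hst
        have hps := one_add_pos hs
        rw [indicator_of_mem hst, abs_of_pos (by positivity), ← div_eq_mul_inv, div_le_one hps]
        linarith
      · rw [indicator_of_notMem hst]
        norm_num
  obtain ⟨K₂, hK₂, h₂⟩ := exists_inner_eq (𝕜 := 𝕜)
    (k := (Ioi t).indicator fun s => 1 - (1 + t) * (1 + s)⁻¹)
    (Measurable.indicator (by fun_prop) measurableSet_Ioi) fun s hs => by
      by_cases hst : s ∈ Ioi t
      · have hts : t < s := hst
        have hps := one_add_pos hs
        have h1 : (1 + t) * (1 + s)⁻¹ ≤ 1 := by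
          rw [← div_eq_mul_inv, div_le_one hps]
          linarith
        have h2 : 0 < (1 + t) * (1 + s)⁻¹ := by positivity
        rw [indicator_of_mem hst, abs_of_nonneg (by linarith)]
        linarith
      · rw [indicator_of_notMem hst]
        norm_num
  refine ⟨K₁, K₂, hK₁, hK₂, fun u U P g hr => ?_⟩
  have i1 := HalfDatum.intervalIntegrable hr.datum.half.mem ht
  have i2 : IntervalIntegrable g volume t 1 := intervalIntegrable_mono
    (intervalIntegrable_of_integrable (integrable_of_memLp_two hr.datum.half.mem))
    (mem_Icc_of_mem_I ht) (right_mem_Icc.mpr (by norm_num))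
  have e1 : ((1 + t : ℝ) : 𝕜) * P t = - inner 𝕜 K₁ (secondDeriv 𝕜 u) := by
    rw [h₁ _ g (secondDeriv_ae hr), setIntegral_kernel ht, hr.datum.half.eq_neg_integral ht,
      mul_neg, ← intervalIntegral.integral_const_mul]
    congr 2
    ext s
    push_cast
    ring
  refine ⟨e1, ?_⟩
  rw [hr.datum.eq_add_integral ht, e1, h₁ _ g (secondDeriv_ae hr), h₂ _ g (secondDeriv_ae hr),
    setIntegral_kernel ht, setIntegral_kernel ht, neg_add_eq_sub, ← intervalIntegral.integral_sub i2]
  · congr 1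
    ext s
    push_cast
    ring
  · refine (i1.const_mul ((1 + t : ℝ) : 𝕜)).congr fun s _ => ?_
    push_cast
    ring

theorem Rep.eq_zero {u : H2 𝕜} (h : secondDeriv 𝕜 u = 0) : u = 0 := by
  obtain ⟨U, P, g, hr⟩ := exists_rep u.2
  refine Subtype.ext (AEEqFun.ext ?_)
  filter_upwards [hr.eq₀, ae_restrict_mem measurableSet_Ioo,
    AEEqFun.coeFn_zero (μ := muI) (β := 𝕜)] with t h0 ht hz
  obtain ⟨K₁, K₂, -, -, hK⟩ := exists_eval_kernels (𝕜 := 𝕜) ht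
  rw [h0, (hK u U P g hr).2, h, inner_zero_right]
  exact hz.symm

theorem secondDeriv_injective : Function.Injective (secondDeriv 𝕜) := by
  rw [← LinearMap.ker_eq_bot, LinearMap.ker_eq_bot']
  exact fun u hu => Rep.eq_zero hu

/-- The range consists exactly of the mean-zero functions, the kernel of a continuous functional.
Its completeness is what the direct method needs for the continuous problem. -/
theorem isClosed_range_secondDeriv :
    IsClosed ((LinearMap.range (secondDeriv 𝕜) : Submodule 𝕜 (Lp 𝕜 2 muI)) : Set (Lp 𝕜 2 muI)) := by
  obtain ⟨K, -, hK⟩ := exists_inner_eq (𝕜 := 𝕜) (k := fun _ => 1) measurable_const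
    fun _ _ => by norm_num
  have e : ((LinearMap.range (secondDeriv 𝕜) : Submodule 𝕜 (Lp 𝕜 2 muI)) : Set (Lp 𝕜 2 muI))
      = {f | inner 𝕜 K f = 0} := by
    ext f
    constructor
    · rintro ⟨u, rfl⟩
      obtain ⟨U, P, g, hr⟩ := exists_rep u.2
      change inner 𝕜 K (secondDeriv 𝕜 u) = 0
      rw [hK _ g (secondDeriv_ae hr), ← hr.datum.integral_eq_zero]
      simp
    · intro hf
      have hf' : inner 𝕜 K f = 0 := hf
      rw [hK f f (ae_eq_refl _)] at hf'
      obtain ⟨U, P, hd⟩ := exists_datum (Lp.memLp f) (by simpa using hf')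
      obtain ⟨u, hu, hr⟩ := hd.exists_mem
      refine ⟨⟨u, hu⟩, ?_⟩
      exact Lp.ext (secondDeriv_ae (u := ⟨u, hu⟩) hr)
  rw [e]
  exact isClosed_eq (continuous_const.inner continuous_id) continuous_const

end Representation

/-! ### Weighted inner products. -/

section L2Form

variable {𝕜 : Type*} [RCLike 𝕜]

theorem wInner_congr {p : ℤ} {f f' g g' : ℝ → 𝕜} (hf : f =ᵐ[muI] f') (hg : g =ᵐ[muI] g') :
    wInner p f g = wInner p f' g' := by
  refine integral_congr_ae ?_
  filter_upwards [hf, hg] with t h1 h2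
  rw [h1, h2]

/-- Splitting `ω²` evenly between the two factors reduces weighted statements to plain `L²(I)`. -/
theorem wInner_two (f g : ℝ → 𝕜) :
    wInner 2 f g = wInner 0 (fun t => ((1 + t : ℝ) : 𝕜) * f t)
      (fun t => ((1 + t : ℝ) : 𝕜) * g t) := by
  refine integral_congr_ae (Eventually.of_forall fun t => ?_)
  simp only [zpow_two_eq, zpow_zero, RCLike.ofReal_one, one_mul, map_mul, RCLike.conj_ofReal,
    RCLike.ofReal_pow]
  ring

theorem wInner_zero_eq (f g : ℝ → 𝕜) : wInner 0 f g = ∫ t in I, f t * conj (g t) := by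
  simp [wInner]

theorem wInner_conj (p : ℤ) (f g : ℝ → 𝕜) : conj (wInner p f g) = wInner p g f := by
  rw [wInner, wInner, ← integral_conj]
  refine integral_congr_ae (Eventually.of_forall fun t => ?_)
  simp only [map_mul, RCLike.conj_conj, RCLike.conj_ofReal]
  ring

theorem wInner_real_mul (p : ℤ) (ρ : ℝ → ℝ) (f g : ℝ → 𝕜) :
    wInner p (fun t => (ρ t : 𝕜) * f t) g = wInner p f (fun t => (ρ t : 𝕜) * g t) := by
  refine integral_congr_ae (Eventually.of_forall fun t => ?_)
  simp only [map_mul, RCLike.conj_ofReal]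
  ring

theorem wInner_smul_left (p : ℤ) (c : 𝕜) (f g : ℝ → 𝕜) :
    wInner p (fun t => c * f t) g = c * wInner p f g := by
  rw [wInner, wInner, ← integral_const_mul]
  refine integral_congr_ae (Eventually.of_forall fun t => ?_)
  simp only
  ring

theorem wInner_zero_add_left {f₁ f₂ g : ℝ → 𝕜} (h1 : MemLp f₁ 2 muI) (h2 : MemLp f₂ 2 muI)
    (h : MemLp g 2 muI) :
    wInner 0 (fun t => f₁ t + f₂ t) g = wInner 0 f₁ g + wInner 0 f₂ g := by
  rw [wInner_zero_eq, wInner_zero_eq, wInner_zero_eq,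
    ← integral_add (integrable_mul_conj h1 h) (integrable_mul_conj h2 h)]
  exact integral_congr_ae (Eventually.of_forall fun t => add_mul _ _ _)

theorem wInner_two_add_left {f₁ f₂ g : ℝ → 𝕜}
    (h1 : MemLp (fun t => ((1 + t : ℝ) : 𝕜) * f₁ t) 2 muI)
    (h2 : MemLp (fun t => ((1 + t : ℝ) : 𝕜) * f₂ t) 2 muI)
    (h : MemLp (fun t => ((1 + t : ℝ) : 𝕜) * g t) 2 muI) :
    wInner 2 (fun t => f₁ t + f₂ t) g = wInner 2 f₁ g + wInner 2 f₂ g := by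
  rw [wInner_two, wInner_two, wInner_two, ← wInner_zero_add_left h1 h2 h]
  simp only [mul_add]

theorem re_wInner_zero_mul {f : ℝ → 𝕜} (ρ : ℝ → ℝ)
    (hf : MemLp f 2 muI) (hρ : MemLp (fun t => (ρ t : 𝕜) * f t) 2 muI) :
    RCLike.re (wInner 0 (fun t => (ρ t : 𝕜) * f t) f) = ∫ t in I, ρ t * ‖f t‖ ^ 2 := by
  rw [wInner_zero_eq, ← integral_re (integrable_mul_conj hρ hf)]
  refine integral_congr_ae (Eventually.of_forall fun t => ?_)
  simp only
  rw [mul_assoc, RCLike.re_ofReal_mul, RCLike.mul_conj, ← RCLike.ofReal_pow, RCLike.ofReal_re]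

theorem re_wInner_zero_self {f : ℝ → 𝕜} (hf : MemLp f 2 muI) :
    RCLike.re (wInner 0 f f) = ∫ t in I, ‖f t‖ ^ 2 := by
  rw [wInner_zero_eq, ← integral_re (integrable_mul_conj hf hf)]
  exact integral_congr_ae (Eventually.of_forall fun t => reInner_self (f t))

theorem memLp_real_mul {f : ℝ → 𝕜} (hf : MemLp f 2 muI) {ρ : ℝ → ℝ} (hρ : AEMeasurable ρ muI)
    {C : ℝ} (hC : ∀ᵐ t ∂muI, |ρ t| ≤ C) : MemLp (fun t => (ρ t : 𝕜) * f t) 2 muI := by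
  refine hf.of_le_mul (c := C)
    ((RCLike.measurable_ofReal.comp_aemeasurable hρ).aestronglyMeasurable.mul
      hf.aestronglyMeasurable) ?_
  filter_upwards [hC] with t ht
  rw [norm_mul, RCLike.norm_ofReal]
  exact mul_le_mul_of_nonneg_right ht (norm_nonneg _)

theorem memLp_weight_mul {f : ℝ → 𝕜} (hf : MemLp f 2 muI) :
    MemLp (fun t => ((1 + t : ℝ) : 𝕜) * f t) 2 muI := by
  refine memLp_real_mul (C := 2) hf (by fun_prop) ?_
  filter_upwards [ae_restrict_mem measurableSet_Ioo] with t ht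
  rw [abs_of_pos (one_add_pos ht)]
  linarith [ht.2]

end L2Form

/-! ### The forms `A` and `B`: coercivity, boundedness, weak continuity. -/

section Forms

variable {𝕜 : Type*} [RCLike 𝕜]

namespace Rep

variable {u : Fn 𝕜} {U P g : ℝ → 𝕜}

theorem weight_quot {t : ℝ} (ht : t ∈ I) : ((1 + t : ℝ) : 𝕜) * Datum.quot U t = U t :=
  weight_mul_inv ht _

theorem memLp₀ (h : Rep u U P g) : MemLp U 2 muI := by
  refine (memLp_weight_mul h.datum.memLp_quot).ae_eq ?_
  filter_upwards [ae_restrict_mem measurableSet_Ioo] with t ht using weight_quot ht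

end Rep

theorem memLp_self {u : Fn 𝕜} (hu : u ∈ H2 𝕜) : MemLp u 2 muI := by
  obtain ⟨U, P, g, h⟩ := exists_rep hu
  exact h.memLp₀.ae_eq h.eq₀.symm

theorem memLp_wderiv {u : Fn 𝕜} (hu : u ∈ H2 𝕜) : MemLp (wderiv u) 2 muI := by
  obtain ⟨U, P, g, h⟩ := exists_rep hu
  exact h.datum.half.memLp.ae_eq h.eq₁.symm

/-- After multiplication by `ω`, each of the three terms of `L_l u` is square integrable. -/
theorem Rep.weight_L {u : Fn 𝕜} {U P g : ℝ → 𝕜} (h : Rep u U P g) (l : ℕ) :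
    ∀ᵐ t ∂muI, ((1 + t : ℝ) : 𝕜) * L l u t =
      g t + (2 : ℝ) * P t - ((l * (l + 1) : ℝ) : 𝕜) * Datum.quot U t := by
  filter_upwards [h.eq₀, h.eq₁, h.eq₂, ae_restrict_mem measurableSet_Ioo] with t h0 h1 h2 ht
  have hp := (one_add_pos ht).ne'
  have hp' : ((1 + t : ℝ) : 𝕜) ≠ 0 := by exact_mod_cast hp
  rw [L, h0, h1, mul_sub, mul_add, h2, Datum.quot]
  rw [← mul_assoc, ← mul_assoc, ← mul_assoc, ← RCLike.ofReal_mul, ← RCLike.ofReal_mul,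
    ← RCLike.ofReal_mul]
  congr 3
  · congr 1
    field_simp
  · field_simp

theorem memLp_weight_L (l : ℕ) {u : Fn 𝕜} (hu : u ∈ H2 𝕜) :
    MemLp (fun t => ((1 + t : ℝ) : 𝕜) * L l u t) 2 muI := by
  obtain ⟨U, P, g, h⟩ := exists_rep hu
  refine MemLp.ae_eq ((h.weight_L l).mono fun t ht => ht.symm) ?_
  exact (h.datum.half.mem.add (h.datum.half.memLp.const_mul _)).sub
    (h.datum.memLp_quot.const_mul _)

theorem L_add (l : ℕ) {u v : Fn 𝕜} (hu : u ∈ H2 𝕜) (hv : v ∈ H2 𝕜) :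
    ∀ᵐ t ∂muI, L l (u + v) t = L l u t + L l v t := by
  obtain ⟨h1, h2⟩ := wderiv_add hu hv
  filter_upwards [AEEqFun.coeFn_add u v, AEEqFun.coeFn_add (wderiv u) (wderiv v),
    AEEqFun.coeFn_add (wderiv (wderiv u)) (wderiv (wderiv v))] with t e0 e1 e2
  rw [L, h2, h1, e0, e1, e2, L, L, Pi.add_apply, Pi.add_apply, Pi.add_apply]
  ring

theorem L_smul (l : ℕ) (c : 𝕜) {u : Fn 𝕜} (hu : u ∈ H2 𝕜) :
    ∀ᵐ t ∂muI, L l (c • u) t = c * L l u t := by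
  obtain ⟨h1, h2⟩ := wderiv_smul c hu
  filter_upwards [AEEqFun.coeFn_smul c u, AEEqFun.coeFn_smul c (wderiv u),
    AEEqFun.coeFn_smul c (wderiv (wderiv u))] with t e0 e1 e2
  rw [L, h2, h1, e0, e1, e2, L, Pi.smul_apply, Pi.smul_apply, Pi.smul_apply]
  simp only [smul_eq_mul]
  ring

/-- The function `(L_l + s) u`. -/
noncomputable def shiftL (l : ℕ) (s : ℝ) (u : Fn 𝕜) (t : ℝ) : 𝕜 := L l u t + (s : 𝕜) * u t

theorem memLp_weight_shiftL (l : ℕ) (s : ℝ) {u : Fn 𝕜} (hu : u ∈ H2 𝕜) :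
    MemLp (fun t => ((1 + t : ℝ) : 𝕜) * shiftL l s u t) 2 muI := by
  refine ((memLp_weight_L l hu).add ((memLp_weight_mul (memLp_self hu)).const_mul
    (s : 𝕜))).ae_eq (Eventually.of_forall fun t => ?_)
  simp only [Pi.add_apply, shiftL]
  ring

theorem shiftL_add (l : ℕ) (s : ℝ) {u v : Fn 𝕜} (hu : u ∈ H2 𝕜) (hv : v ∈ H2 𝕜) :
    shiftL l s (u + v) =ᵐ[muI] fun t => shiftL l s u t + shiftL l s v t := by
  filter_upwards [AEEqFun.coeFn_add u v, L_add l hu hv] with t e0 e1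
  rw [shiftL, e0, e1, shiftL, shiftL, Pi.add_apply]
  ring

theorem shiftL_smul (l : ℕ) (s : ℝ) (c : 𝕜) {u : Fn 𝕜} (hu : u ∈ H2 𝕜) :
    shiftL l s (c • u) =ᵐ[muI] fun t => c * shiftL l s u t := by
  filter_upwards [AEEqFun.coeFn_smul c u, L_smul l c hu] with t e0 e1
  rw [shiftL, e0, e1, shiftL, Pi.smul_apply, smul_eq_mul]
  ring

/-- The coefficient `1 / (n - 1)` is measurable and bounded above and below. -/
structure Coeff (ρ : ℝ → ℝ) (ρ₀ ρ₁ : ℝ) : Prop where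
  meas : AEMeasurable ρ muI
  pos : 0 < ρ₀
  le : ρ₀ ≤ ρ₁
  lower : ∀ᵐ t ∂muI, ρ₀ ≤ ρ t
  upper : ∀ᵐ t ∂muI, ρ t ≤ ρ₁

theorem Coeff.memLp_mul {ρ : ℝ → ℝ} {ρ₀ ρ₁ : ℝ} (hρ : Coeff ρ ρ₀ ρ₁) {f : ℝ → 𝕜}
    (hf : MemLp f 2 muI) : MemLp (fun t => (ρ t : 𝕜) * f t) 2 muI := by
  refine memLp_real_mul hf hρ.meas (C := ρ₁) ?_
  filter_upwards [hρ.lower, hρ.upper] with t h1 h2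
  rw [abs_of_pos (hρ.pos.trans_le h1)]
  exact h2

theorem coeff_of_bounds {n : ℝ → ℝ} (hn : AEMeasurable n muI) {α nstar : ℝ} (hα : 0 < α)
    (hbound : ∀ᵐ t ∂muI, 1 + α ≤ n t ∧ n t ≤ nstar) :
    Coeff (fun t => 1 / (n t - 1)) (1 / (nstar - 1)) (1 / α) := by
  -- `I` has positive measure, so the bounds on `n` hold at some point; this gives `α ≤ nstar - 1`,
  -- hence a positive lower bound for the coefficient.
  have hne : (ae muI).NeBot := by
    rw [ae_neBot]
    intro h
    have := congrArg (fun μ : Measure ℝ => μ univ) h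
    simp [muI, I] at this
    norm_num at this
  obtain ⟨t, ht1, ht2⟩ := hbound.exists
  have hs : α ≤ nstar - 1 := by linarith
  refine ⟨?_, ?_, ?_, ?_, ?_⟩
  · simp only [one_div]
    exact (hn.sub_const 1).inv
  · exact one_div_pos.mpr (hα.trans_le hs)
  · exact one_div_le_one_div_of_le hα hs
  · filter_upwards [hbound] with s hs
    exact one_div_le_one_div_of_le (by linarith) (by linarith)
  · filter_upwards [hbound] with s hs
    exact one_div_le_one_div_of_le hα (by linarith)

theorem A_eq (l : ℕ) (R τ : ℝ) (n : ℝ → ℝ) (u v : Fn 𝕜) :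
    A l R τ n u v = wInner 2 (fun t => ((1 / (n t - 1) : ℝ) : 𝕜) * shiftL l (R ^ 2 / 4 * τ) u t)
      (shiftL l (R ^ 2 / 4 * τ) v) + ((τ ^ 2 * (R ^ 2 / 4) ^ 2 : ℝ) : 𝕜) * wInner 2 u v := rfl

theorem memLp_weight_coeff_mul {ρ : ℝ → ℝ} {ρ₀ ρ₁ : ℝ} (hρ : Coeff ρ ρ₀ ρ₁) {f : ℝ → 𝕜}
    (hf : MemLp (fun t => ((1 + t : ℝ) : 𝕜) * f t) 2 muI) :
    MemLp (fun t => ((1 + t : ℝ) : 𝕜) * ((ρ t : 𝕜) * f t)) 2 muI :=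
  (hρ.memLp_mul hf).ae_eq (Eventually.of_forall fun _ => mul_left_comm _ _ _)

theorem re_A (l : ℕ) (R τ : ℝ) {n : ℝ → ℝ} {ρ₀ ρ₁ : ℝ}
    (hρ : Coeff (fun t => 1 / (n t - 1)) ρ₀ ρ₁) {u : Fn 𝕜} (hu : u ∈ H2 𝕜) :
    RCLike.re (A l R τ n u u) =
      (∫ t in I, 1 / (n t - 1) * ‖((1 + t : ℝ) : 𝕜) * shiftL l (R ^ 2 / 4 * τ) u t‖ ^ 2) +
      (R ^ 2 / 4 * τ) ^ 2 * ∫ t in I, ‖((1 + t : ℝ) : 𝕜) * u t‖ ^ 2 := by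
  have hF := memLp_weight_shiftL l (R ^ 2 / 4 * τ) hu
  rw [A_eq, map_add, RCLike.re_ofReal_mul, wInner_two, wInner_two,
    re_wInner_zero_self (memLp_weight_mul (memLp_self hu))]
  simp_rw [mul_left_comm ((1 + _ : ℝ) : 𝕜) (((1 / (n _ - 1) : ℝ)) : 𝕜)]
  rw [re_wInner_zero_mul _ hF (hρ.memLp_mul hF)]
  ring

/-- The a priori estimate `‖ω ∂_t² u‖ ≤ ‖ω L_l u‖`. -/
theorem Datum.integral_sq_le {U P g : ℝ → 𝕜} (h : Datum U P g) {a : ℝ} (ha : 2 ≤ a) :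
    ∫ t in I, ‖g t‖ ^ 2 ≤
      ∫ t in I, ‖g t + (2 : ℝ) * P t - (a : 𝕜) * Datum.quot U t‖ ^ 2 := by
  set q := Datum.quot U with hq
  have hP := h.half.memLp
  have hg := h.half.mem
  have hQ : MemLp q 2 muI := h.memLp_quot
  have i1 : Integrable (fun t => ‖P t‖ ^ 2 + 2 * reInner (g t) (P t)) muI :=
    (integrable_sq hP).add ((integrable_reInner hg hP).const_mul 2)
  have i2 : Integrable (fun t => 2 * reInner (P t) (q t) - ‖q t‖ ^ 2) muI :=
    ((integrable_reInner hP hQ).const_mul 2).sub (integrable_sq hQ)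
  have i3 : Integrable (fun t => reInner (g t) (q t) + ‖P t‖ ^ 2) muI :=
    (integrable_reInner hg hQ).add (integrable_sq hP)
  -- The square is arranged so that the three groups with cross terms integrate to zero by the
  -- identities for `P`, `U/ω` and the mixed product. The remainder is nonnegative because `a ≥ 2`.
  have expand : ∀ t, ‖g t + (2 : ℝ) * P t - (a : 𝕜) * q t‖ ^ 2 =
      ‖g t‖ ^ 2 + 2 * (‖P t‖ ^ 2 + 2 * reInner (g t) (P t))
      - 2 * a * (reInner (g t) (q t) + ‖P t‖ ^ 2)
      - 2 * a * (2 * reInner (P t) (q t) - ‖q t‖ ^ 2)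
      + ((2 + 2 * a) * ‖P t‖ ^ 2 + (a ^ 2 - 2 * a) * ‖q t‖ ^ 2) := by
    intro t
    have e1 := reInner_comm (P t) (g t)
    have e2 := reInner_comm (q t) (g t)
    have e3 := reInner_comm (q t) (P t)
    have key : reInner (g t + (2 : ℝ) * P t - (a : 𝕜) * q t) (g t + (2 : ℝ) * P t - (a : 𝕜) * q t)
        = reInner (g t) (g t) + 2 * reInner (g t) (P t) - a * reInner (g t) (q t)
        + 2 * (reInner (P t) (g t) + 2 * reInner (P t) (P t) - a * reInner (P t) (q t))
        - a * (reInner (q t) (g t) + 2 * reInner (q t) (P t) - a * reInner (q t) (q t)) := by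
      have r : ∀ (c : ℝ) (z : 𝕜), RCLike.re ((c : 𝕜) * z) = c * RCLike.re z :=
        fun c z => RCLike.re_ofReal_mul c z
      have : (g t + (2 : ℝ) * P t - (a : 𝕜) * q t) * conj (g t + (2 : ℝ) * P t - (a : 𝕜) * q t)
        = g t * conj (g t) + ((2 : ℝ) : 𝕜) * (g t * conj (P t)) - (a : 𝕜) * (g t * conj (q t))
        + ((2 : ℝ) : 𝕜) * (P t * conj (g t) + ((2 : ℝ) : 𝕜) * (P t * conj (P t))
            - (a : 𝕜) * (P t * conj (q t)))
        - (a : 𝕜) * (q t * conj (g t) + ((2 : ℝ) : 𝕜) * (q t * conj (P t))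
            - (a : 𝕜) * (q t * conj (q t))) := by
        simp only [map_sub, map_add, map_mul, RCLike.conj_ofReal]
        ring
      simp only [reInner]
      rw [this]
      simp only [map_sub, map_add, r]
    rw [reInner_self, reInner_self, reInner_self, reInner_self, e1, e2, e3] at key
    rw [key]
    ring
  have iP := integrable_sq hP
  have iQ := integrable_sq hQ
  have ig := integrable_sq hg
  simp_rw [expand]
  have j1 : Integrable (fun t => ‖g t‖ ^ 2 + 2 * (‖P t‖ ^ 2 + 2 * reInner (g t) (P t))) muI :=
    ig.add (i1.const_mul 2)
  have j2 : Integrable (fun t => ‖g t‖ ^ 2 + 2 * (‖P t‖ ^ 2 + 2 * reInner (g t) (P t))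
      - 2 * a * (reInner (g t) (q t) + ‖P t‖ ^ 2)) muI := j1.sub (i3.const_mul _)
  have j3 : Integrable (fun t => ‖g t‖ ^ 2 + 2 * (‖P t‖ ^ 2 + 2 * reInner (g t) (P t))
      - 2 * a * (reInner (g t) (q t) + ‖P t‖ ^ 2)
      - 2 * a * (2 * reInner (P t) (q t) - ‖q t‖ ^ 2)) muI := j2.sub (i2.const_mul _)
  have j4 : Integrable (fun t => (2 + 2 * a) * ‖P t‖ ^ 2 + (a ^ 2 - 2 * a) * ‖q t‖ ^ 2) muI :=
    (iP.const_mul _).add (iQ.const_mul _)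
  rw [integral_add j3 j4, integral_sub j2 (i2.const_mul _), integral_sub j1 (i3.const_mul _),
    integral_add ig (i1.const_mul 2), integral_const_mul, integral_const_mul, integral_const_mul,
    h.half.integral_identity, h.integral_identity_quot, h.integral_identity_mixed]
  have hnn : 0 ≤ ∫ t in I, ((2 + 2 * a) * ‖P t‖ ^ 2 + (a ^ 2 - 2 * a) * ‖q t‖ ^ 2) := by
    refine integral_nonneg fun t => ?_
    have : 0 ≤ a ^ 2 - 2 * a := by nlinarith
    positivity
  linarith

/-- Young's inequality in `integral_identity`, where no boundary terms remain, gives `∫ (‖P‖²/2 -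
2‖g‖²) ≤ 0`. -/
theorem HalfDatum.integral_sq_le {P g : ℝ → 𝕜} (h : HalfDatum P g) :
    ∫ t in I, ‖P t‖ ^ 2 ≤ 4 * ∫ t in I, ‖g t‖ ^ 2 := by
  have iP := integrable_sq h.memLp
  have ig := integrable_sq h.mem
  have h1 : ∫ t in I, (1 / 2 * ‖P t‖ ^ 2 - 2 * ‖g t‖ ^ 2) ≤
      ∫ t in I, (‖P t‖ ^ 2 + 2 * reInner (g t) (P t)) := by
    refine integral_mono ((iP.const_mul _).sub (ig.const_mul _))
      (iP.add ((integrable_reInner h.mem h.memLp).const_mul 2)) fun t => ?_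
    have := (abs_le.mp (abs_reInner_le (g t) (P t))).1
    simp only
    nlinarith [sq_nonneg (‖P t‖ - 2 * ‖g t‖)]
  rw [h.integral_identity, integral_sub (iP.const_mul _) (ig.const_mul _), integral_const_mul,
    integral_const_mul] at h1
  linarith

theorem Datum.integral_quot_sq_le {U P g : ℝ → 𝕜} (h : Datum U P g) :
    ∫ t in I, ‖Datum.quot U t‖ ^ 2 ≤ 4 * ∫ t in I, ‖P t‖ ^ 2 := by
  have iP := integrable_sq h.half.memLp
  have iQ := integrable_sq h.memLp_quot
  have h1 : ∫ t in I, (2 * reInner (P t) (Datum.quot U t) - ‖Datum.quot U t‖ ^ 2) ≤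
      ∫ t in I, (2 * ‖P t‖ ^ 2 - 1 / 2 * ‖Datum.quot U t‖ ^ 2) := by
    refine integral_mono (((integrable_reInner h.half.memLp h.memLp_quot).const_mul 2).sub iQ)
      ((iP.const_mul _).sub (iQ.const_mul _)) fun t => ?_
    have := (abs_le.mp (abs_reInner_le (P t) (Datum.quot U t))).2
    simp only
    nlinarith [sq_nonneg (‖Datum.quot U t‖ - 2 * ‖P t‖)]
  rw [h.integral_identity_quot, integral_sub (iP.const_mul _) (iQ.const_mul _),
    integral_const_mul, integral_const_mul] at h1
  linarith

theorem norm_add_sq_le_two (x y : 𝕜) : ‖x + y‖ ^ 2 ≤ 2 * ‖x‖ ^ 2 + 2 * ‖y‖ ^ 2 := by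
  nlinarith [norm_add_le x y, norm_nonneg (x + y), sq_nonneg (‖x‖ - ‖y‖)]

theorem two_le_mul_succ {l : ℕ} (hl : 1 ≤ l) : (2 : ℝ) ≤ l * (l + 1) := by
  have : (1 : ℝ) ≤ l := by exact_mod_cast hl
  nlinarith

/-- With `s = R²τ/4`, write `ω L_l u = ω (L_l + s) u - s ω u`; the two terms of `A` control the two
summands for every real `τ`, including zero. The a priori estimate then passes from `ω L_l u` to `ω
u''`. -/
theorem A_coercive {l : ℕ} (hl : 1 ≤ l) (R τ : ℝ) {n : ℝ → ℝ} {ρ₀ ρ₁ : ℝ}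
    (hρ : Coeff (fun t => 1 / (n t - 1)) ρ₀ ρ₁) (u : H2 𝕜) :
    ‖secondDeriv 𝕜 u‖ ^ 2 ≤ (2 / ρ₀ + 2) * RCLike.re (A l R τ n (u : Fn 𝕜) u) := by
  obtain ⟨U, P, g, h⟩ := exists_rep u.2
  set s := R ^ 2 / 4 * τ with hs
  have hρ0 := hρ.pos
  have hF := memLp_weight_shiftL l s u.2
  have hU := memLp_weight_mul (memLp_self u.2)
  have i1 : Integrable (fun t => 1 / (n t - 1) * ‖((1 + t : ℝ) : 𝕜) * shiftL l s u t‖ ^ 2) muI := by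
    refine (integrable_reInner (hρ.memLp_mul hF) hF).congr (Eventually.of_forall fun t => ?_)
    simp only
    rw [reInner_smul_left, reInner_self]
  have i2 := integrable_sq hU
  rw [norm_Lp_sq (secondDeriv_ae h), re_A l R τ hρ u.2, ← hs]
  refine (h.datum.integral_sq_le (two_le_mul_succ hl)).trans ?_
  have e : ∫ t in I, ‖g t + (2 : ℝ) * P t - ((l * (l + 1) : ℝ) : 𝕜) * Datum.quot U t‖ ^ 2
      = ∫ t in I, ‖((1 + t : ℝ) : 𝕜) * L l (u : Fn 𝕜) t‖ ^ 2 := by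
    refine integral_congr_ae ?_
    filter_upwards [h.weight_L l] with t ht
    rw [ht]
  rw [e, ← integral_const_mul, ← integral_add i1 (i2.const_mul _), ← integral_const_mul]
  refine integral_mono_ae (integrable_sq (memLp_weight_L l u.2))
    ((i1.add (i2.const_mul _)).const_mul _) ?_
  filter_upwards [hρ.lower] with t ht
  have e1 : ((1 + t : ℝ) : 𝕜) * L l (u : Fn 𝕜) t = ((1 + t : ℝ) : 𝕜) * shiftL l s u t
      + ((-s : ℝ) : 𝕜) * (((1 + t : ℝ) : 𝕜) * (u : Fn 𝕜) t) := by
    rw [shiftL, RCLike.ofReal_neg]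
    ring
  rw [e1]
  refine (norm_add_sq_le_two _ _).trans ?_
  set x := ‖((1 + t : ℝ) : 𝕜) * shiftL l s u t‖ ^ 2 with hx
  rw [norm_mul (((-s : ℝ)) : 𝕜), RCLike.norm_ofReal, abs_neg, mul_pow, sq_abs]
  set y := ‖((1 + t : ℝ) : 𝕜) * (u : Fn 𝕜) t‖ ^ 2 with hy
  have hx0 : 0 ≤ x := by positivity
  have hy0 : 0 ≤ y := by positivity
  have h1 : ρ₀ * x ≤ 1 / (n t - 1) * x := mul_le_mul_of_nonneg_right ht hx0
  have h2 : 0 ≤ 1 / (n t - 1) * x := (by positivity : 0 ≤ ρ₀ * x).trans h1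
  have h3 : 2 * x ≤ 2 / ρ₀ * (1 / (n t - 1) * x) := by
    calc 2 * x = 2 / ρ₀ * (ρ₀ * x) := by field_simp
      _ ≤ _ := by gcongr
  have h4 : 0 ≤ 2 / ρ₀ * (s ^ 2 * y) := by positivity
  nlinarith

theorem A_bounded (l : ℕ) (R τ : ℝ) {n : ℝ → ℝ} {ρ₀ ρ₁ : ℝ}
    (hρ : Coeff (fun t => 1 / (n t - 1)) ρ₀ ρ₁) :
    ∃ C, 0 ≤ C ∧ ∀ u : H2 𝕜, RCLike.re (A l R τ n (u : Fn 𝕜) u) ≤ C * ‖secondDeriv 𝕜 u‖ ^ 2 := by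
  set s := R ^ 2 / 4 * τ with hs
  set a : ℝ := l * (l + 1) with ha
  have hρ1 : 0 < ρ₁ := hρ.pos.trans_le hρ.le
  -- The factor `4` comes from splitting `ω (L_l + s) u` into four terms. In units of `‖g‖²`,
  -- Hardy's inequalities give `‖P‖² ≤ 4` and `‖U/ω‖² ≤ 16`, and `ω ≤ 2` gives `‖ω u‖² = ‖ω² (U/ω)‖²
  -- ≤ 16 · 16`.
  refine ⟨ρ₁ * (4 * (1 + 4 * 4 + a ^ 2 * 16 + s ^ 2 * 256)) + s ^ 2 * 256, by positivity,
    fun u => ?_⟩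
  obtain ⟨U, P, g, h⟩ := exists_rep u.2
  have hF := memLp_weight_shiftL l s u.2
  have hU := memLp_weight_mul (memLp_self u.2)
  have i1 : Integrable (fun t => 1 / (n t - 1) * ‖((1 + t : ℝ) : 𝕜) * shiftL l s u t‖ ^ 2) muI := by
    refine (integrable_reInner (hρ.memLp_mul hF) hF).congr (Eventually.of_forall fun t => ?_)
    simp only
    rw [reInner_smul_left, reInner_self]
  have i2 := integrable_sq hU
  have ig := integrable_sq h.datum.half.mem
  have iP := integrable_sq h.datum.half.memLp
  have iQ := integrable_sq h.datum.memLp_quot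
  rw [norm_Lp_sq (secondDeriv_ae h), re_A l R τ hρ u.2, ← hs]
  set G := ∫ t in I, ‖g t‖ ^ 2 with hG
  have hPG := h.datum.half.integral_sq_le
  have hQG := h.datum.integral_quot_sq_le
  have hUq : ∀ᵐ t ∂muI, ‖((1 + t : ℝ) : 𝕜) * (u : Fn 𝕜) t‖ ^ 2 ≤ 16 * ‖Datum.quot U t‖ ^ 2 := by
    filter_upwards [h.eq₀, ae_restrict_mem measurableSet_Ioo] with t h0 ht
    have hp := one_add_pos ht
    rw [h0, ← Rep.weight_quot (U := U) ht, norm_mul, norm_mul, RCLike.norm_ofReal, abs_of_pos hp,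
      ← mul_assoc, mul_pow]
    refine mul_le_mul_of_nonneg_right ?_ (by positivity)
    have h2 : 1 + t ≤ 2 := by linarith [ht.2]
    calc ((1 + t) * (1 + t)) ^ 2 ≤ (2 * 2) ^ 2 := by gcongr
      _ = 16 := by norm_num
  have hU' : ∫ t in I, ‖((1 + t : ℝ) : 𝕜) * (u : Fn 𝕜) t‖ ^ 2 ≤ 256 * G := by
    have := integral_mono_ae i2 (iQ.const_mul 16) hUq
    rw [integral_const_mul] at this
    linarith
  have hF' : ∫ t in I, 1 / (n t - 1) * ‖((1 + t : ℝ) : 𝕜) * shiftL l s u t‖ ^ 2 ≤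
      ρ₁ * (4 * (1 + 4 * 4 + a ^ 2 * 16 + s ^ 2 * 256)) * G := by
    have iR : Integrable (fun t => ρ₁ * (4 * (‖g t‖ ^ 2 + 4 * ‖P t‖ ^ 2 +
        a ^ 2 * ‖Datum.quot U t‖ ^ 2 + s ^ 2 * ‖((1 + t : ℝ) : 𝕜) * (u : Fn 𝕜) t‖ ^ 2))) muI :=
      ((((ig.add (iP.const_mul 4)).add (iQ.const_mul _)).add
        (i2.const_mul _)).const_mul 4).const_mul ρ₁
    have h1 := integral_mono_ae i1 iR (by
      filter_upwards [h.weight_L l, hρ.upper] with t h0 h1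
      refine mul_le_mul h1 ?_ (by positivity) hρ1.le
      have e1 : ((1 + t : ℝ) : 𝕜) * shiftL l s u t =
          (g t + ((2 : ℝ) : 𝕜) * P t) + (((-a : ℝ) : 𝕜) * Datum.quot U t
            + (s : 𝕜) * (((1 + t : ℝ) : 𝕜) * (u : Fn 𝕜) t)) := by
        rw [shiftL, mul_add, h0, RCLike.ofReal_neg]
        ring
      rw [e1]
      have n1 := norm_add_sq_le_two (g t + ((2 : ℝ) : 𝕜) * P t) (((-a : ℝ) : 𝕜) * Datum.quot U t
            + (s : 𝕜) * (((1 + t : ℝ) : 𝕜) * (u : Fn 𝕜) t))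
      have n2 := norm_add_sq_le_two (g t) (((2 : ℝ) : 𝕜) * P t)
      have n3 := norm_add_sq_le_two (((-a : ℝ) : 𝕜) * Datum.quot U t)
        ((s : 𝕜) * (((1 + t : ℝ) : 𝕜) * (u : Fn 𝕜) t))
      rw [norm_mul ((2 : ℝ) : 𝕜), RCLike.norm_ofReal, mul_pow, sq_abs] at n2
      rw [norm_mul ((-a : ℝ) : 𝕜), norm_mul (s : 𝕜), RCLike.norm_ofReal, RCLike.norm_ofReal,
        mul_pow, mul_pow, sq_abs, sq_abs] at n3
      linarith)
    have j1 : Integrable (fun t => ‖g t‖ ^ 2 + 4 * ‖P t‖ ^ 2) muI := ig.add (iP.const_mul 4)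
    have j2 : Integrable (fun t => ‖g t‖ ^ 2 + 4 * ‖P t‖ ^ 2 + a ^ 2 * ‖Datum.quot U t‖ ^ 2) muI :=
      j1.add (iQ.const_mul _)
    rw [integral_const_mul, integral_const_mul, integral_add j2 (i2.const_mul _),
      integral_add j1 (iQ.const_mul _), integral_add ig (iP.const_mul 4),
      integral_const_mul, integral_const_mul, integral_const_mul] at h1
    refine h1.trans ?_
    rw [mul_assoc, mul_assoc]
    refine mul_le_mul_of_nonneg_left ?_ hρ1.le
    refine mul_le_mul_of_nonneg_left ?_ (by norm_num)
    have m1 := mul_le_mul_of_nonneg_left hU' (sq_nonneg s)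
    have m2 := mul_le_mul_of_nonneg_left (hQG.trans (mul_le_mul_of_nonneg_left hPG
      (by norm_num : (0 : ℝ) ≤ 4))) (sq_nonneg a)
    linarith
  have m1 := mul_le_mul_of_nonneg_left hU' (sq_nonneg s)
  linarith

theorem A_posForm {l : ℕ} (hl : 1 ≤ l) (R τ : ℝ) {n : ℝ → ℝ} {ρ₀ ρ₁ : ℝ}
    (hρ : Coeff (fun t => 1 / (n t - 1)) ρ₀ ρ₁) :
    PosForm (A (𝕜 := 𝕜) l R τ n) (H2 𝕜) := by
  refine ⟨fun u hu v hv w hw => ?_, fun c u hu w hw => ?_, fun u hu v hv => ?_, fun u hu h0 => ?_⟩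
  · rw [A_eq, A_eq, A_eq, wInner_congr (AEEqFun.coeFn_add u v) (ae_eq_refl w)]
    have e : (fun t => ((1 / (n t - 1) : ℝ) : 𝕜) * shiftL l (R ^ 2 / 4 * τ) (u + v) t) =ᵐ[muI]
        fun t => ((1 / (n t - 1) : ℝ) : 𝕜) * shiftL l (R ^ 2 / 4 * τ) u t
          + ((1 / (n t - 1) : ℝ) : 𝕜) * shiftL l (R ^ 2 / 4 * τ) v t := by
      filter_upwards [shiftL_add l (R ^ 2 / 4 * τ) hu hv] with t ht
      rw [ht, mul_add]
    rw [wInner_congr e (ae_eq_refl _), wInner_two_add_left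
      (memLp_weight_coeff_mul hρ (memLp_weight_shiftL l _ hu))
      (memLp_weight_coeff_mul hρ (memLp_weight_shiftL l _ hv)) (memLp_weight_shiftL l _ hw)]
    have e2 : wInner 2 (⇑u + ⇑v) w = wInner 2 u w + wInner 2 v w :=
      wInner_two_add_left (memLp_weight_mul (memLp_self hu)) (memLp_weight_mul (memLp_self hv))
        (memLp_weight_mul (memLp_self hw))
    rw [e2]
    ring
  · rw [A_eq, A_eq, wInner_congr (AEEqFun.coeFn_smul c u) (ae_eq_refl w)]
    have e : (fun t => ((1 / (n t - 1) : ℝ) : 𝕜) * shiftL l (R ^ 2 / 4 * τ) (c • u) t) =ᵐ[muI]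
        fun t => c * (((1 / (n t - 1) : ℝ) : 𝕜) * shiftL l (R ^ 2 / 4 * τ) u t) := by
      filter_upwards [shiftL_smul l (R ^ 2 / 4 * τ) c hu] with t ht
      rw [ht, mul_left_comm]
    have e2 : wInner 2 (c • ⇑u) w = c * wInner 2 u w := wInner_smul_left 2 c u w
    rw [wInner_congr e (ae_eq_refl _), wInner_smul_left, e2]
    ring
  · rw [A_eq, A_eq, map_add, map_mul, RCLike.conj_ofReal, wInner_conj, wInner_conj,
      ← wInner_real_mul]
  -- Definiteness follows from coercivity and the injectivity of `u ↦ ω u''`.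
  · have h1 := A_coercive hl R τ hρ ⟨u, hu⟩
    have h2 : 0 < ‖secondDeriv 𝕜 ⟨u, hu⟩‖ := norm_pos_iff.mpr fun h =>
      h0 (congrArg Subtype.val (Rep.eq_zero h))
    have h3 : 0 < 2 / ρ₀ + 2 := by
      have := hρ.pos
      positivity
    by_contra! hn
    nlinarith [mul_nonneg_of_nonpos_of_nonpos hn (neg_nonpos.mpr h3.le), pow_pos h2 2]

theorem re_B (l : ℕ) (R : ℝ) {u : Fn 𝕜} (hu : u ∈ H2 𝕜) :
    RCLike.re (B l R u u) = R ^ 2 / 4 * ((∫ t in I, ‖((1 + t : ℝ) : 𝕜) * wderiv u t‖ ^ 2)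
      + l * (l + 1) * ∫ t in I, ‖u t‖ ^ 2) := by
  rw [B, RCLike.re_ofReal_mul, map_add, RCLike.re_ofReal_mul, wInner_two,
    re_wInner_zero_self (memLp_weight_mul (memLp_wderiv hu)), re_wInner_zero_self (memLp_self hu)]

theorem B_posForm {l : ℕ} (hl : 1 ≤ l) {R : ℝ} (hR : 0 < R) :
    PosForm (B (𝕜 := 𝕜) l R) (H2 𝕜) := by
  refine ⟨fun u hu v hv w hw => ?_, fun c u hu w hw => ?_, fun u hu v hv => ?_, fun u hu h0 => ?_⟩
  · rw [B, B, B, (wderiv_add hu hv).1, wInner_congr (AEEqFun.coeFn_add u v) (ae_eq_refl w),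
      wInner_congr (AEEqFun.coeFn_add (wderiv u) (wderiv v)) (ae_eq_refl (wderiv w))]
    have e1 : wInner 2 (⇑(wderiv u) + ⇑(wderiv v)) (wderiv w)
        = wInner 2 (wderiv u) (wderiv w) + wInner 2 (wderiv v) (wderiv w) :=
      wInner_two_add_left (memLp_weight_mul (memLp_wderiv hu))
        (memLp_weight_mul (memLp_wderiv hv)) (memLp_weight_mul (memLp_wderiv hw))
    have e2 : wInner 0 (⇑u + ⇑v) w = wInner 0 u w + wInner 0 v w :=
      wInner_zero_add_left (memLp_self hu) (memLp_self hv) (memLp_self hw)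
    rw [e1, e2]
    ring
  · rw [B, B, (wderiv_smul c hu).1, wInner_congr (AEEqFun.coeFn_smul c u) (ae_eq_refl w),
      wInner_congr (AEEqFun.coeFn_smul c (wderiv u)) (ae_eq_refl (wderiv w))]
    have e1 : wInner 2 (c • ⇑(wderiv u)) (wderiv w) = c * wInner 2 (wderiv u) (wderiv w) :=
      wInner_smul_left 2 c _ _
    have e2 : wInner 0 (c • ⇑u) w = c * wInner 0 u w := wInner_smul_left 0 c u w
    rw [e1, e2]
    ring
  · simp only [B, map_mul, map_add, RCLike.conj_ofReal, wInner_conj]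
  · rw [re_B l R hu]
    have h1 : 0 ≤ ∫ t in I, ‖((1 + t : ℝ) : 𝕜) * wderiv u t‖ ^ 2 :=
      integral_nonneg fun t => by positivity
    have h2 : 0 ≤ ∫ t in I, ‖u t‖ ^ 2 := integral_nonneg fun t => by positivity
    have h3 : ∫ t in I, ‖u t‖ ^ 2 ≠ 0 := by
      intro h
      rw [integral_eq_zero_iff_of_nonneg (fun t => by positivity)
        (integrable_sq (memLp_self hu))] at h
      refine h0 (AEEqFun.ext ?_)
      filter_upwards [h, AEEqFun.coeFn_zero (μ := muI) (β := 𝕜)] with t h4 h5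
      rw [h5]
      simpa using h4
    have h4 : 0 < ∫ t in I, ‖u t‖ ^ 2 := lt_of_le_of_ne h2 (Ne.symm h3)
    have h5 := two_le_mul_succ hl
    have h6 : 0 < (l : ℝ) * (l + 1) * ∫ t in I, ‖u t‖ ^ 2 := mul_pos (by linarith) h4
    exact mul_pos (by positivity) (by linarith)

/-- The form `B` is weakly sequentially continuous. -/
theorem B_tendsto_zero (l : ℕ) (R : ℝ) (x : ℕ → H2 𝕜) {K : ℝ}
    (hK : ∀ n, ‖secondDeriv 𝕜 (x n)‖ ≤ K)
    (hx : ∀ y, Tendsto (fun n => inner 𝕜 y (secondDeriv 𝕜 (x n))) atTop (𝓝 0)) :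
    Tendsto (fun n => RCLike.re (B l R (x n : Fn 𝕜) (x n))) atTop (𝓝 0) := by
  choose U P g hr using fun n => exists_rep (x n).2
  set C : ℝ := (measureUnivNNReal muI : ℝ) ^ (2 : ℝ≥0∞).toReal⁻¹ with hC
  have hK0 : 0 ≤ K := (norm_nonneg _).trans (hK 0)
  -- If the values of `f n` are functionals of `ω x_n''` bounded uniformly in the point, they tend
  -- to zero pointwise and are dominated by the constant `C K` on the bounded interval `I`.
  have dom : ∀ f : ℕ → ℝ → 𝕜, (∀ n, AEStronglyMeasurable (f n) muI) →
      (∀ t ∈ I, ∃ k : Lp 𝕜 2 muI, ‖k‖ ≤ C ∧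
        ∀ n, ‖f n t‖ = ‖(inner 𝕜 k (secondDeriv 𝕜 (x n)) : 𝕜)‖) →
      Tendsto (fun n => ∫ t in I, ‖f n t‖ ^ 2) atTop (𝓝 0) := by
    intro f hf hk
    rw [← integral_zero ℝ ℝ (μ := muI)]
    refine tendsto_integral_of_dominated_convergence (fun _ => (C * K) ^ 2)
      (fun n => (hf n).norm.pow 2) (integrable_const _) (fun n => ?_) ?_
    · filter_upwards [ae_restrict_mem measurableSet_Ioo] with t ht
      obtain ⟨k, h1, h2⟩ := hk t ht
      rw [Real.norm_of_nonneg (by positivity), h2]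
      gcongr
      exact (norm_inner_le_norm _ _).trans
        (mul_le_mul h1 (hK n) (norm_nonneg _) ((norm_nonneg k).trans h1))
    · filter_upwards [ae_restrict_mem measurableSet_Ioo] with t ht
      obtain ⟨k, h1, h2⟩ := hk t ht
      simp only [h2]
      simpa using (hx k).norm.pow 2
  have t1 : Tendsto (fun n => ∫ t in I, ‖((1 + t : ℝ) : 𝕜) * P n t‖ ^ 2) atTop (𝓝 0) := by
    refine dom _ (fun n =>
      (memLp_weight_mul (hr n).datum.half.memLp).aestronglyMeasurable) fun t ht => ?_
    obtain ⟨K₁, K₂, h1, h2, h3⟩ := exists_eval_kernels (𝕜 := 𝕜) ht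
    refine ⟨K₁, h1, fun n => ?_⟩
    rw [(h3 (x n) _ _ _ (hr n)).1, norm_neg]
  have t2 : Tendsto (fun n => ∫ t in I, ‖U n t‖ ^ 2) atTop (𝓝 0) := by
    refine dom _ (fun n => (hr n).memLp₀.aestronglyMeasurable) fun t ht => ?_
    obtain ⟨K₁, K₂, h1, h2, h3⟩ := exists_eval_kernels (𝕜 := 𝕜) ht
    refine ⟨K₂, h2, fun n => ?_⟩
    rw [(h3 (x n) _ _ _ (hr n)).2]
  have t3 := (t1.add (t2.const_mul ((l : ℝ) * (l + 1)))).const_mul (R ^ 2 / 4)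
  simp only [mul_zero, add_zero] at t3
  refine t3.congr fun n => ?_
  rw [re_B l R (x n).2]
  congr 2
  · refine integral_congr_ae ?_
    filter_upwards [(hr n).eq₁] with t ht
    rw [ht]
  · congr 1
    refine integral_congr_ae ?_
    filter_upwards [(hr n).eq₀] with t ht
    rw [ht]

/-- Stated for any subspace of `H2` with complete image under `u ↦ ω u''`, so that it covers the
continuous and the discrete problem at once. -/
theorem hasMinimizers {l : ℕ} (hl : 1 ≤ l) {R : ℝ} (hR : 0 < R) (τ : ℝ) {n : ℝ → ℝ} {ρ₀ ρ₁ : ℝ}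
    (hρ : Coeff (fun t => 1 / (n t - 1)) ρ₀ ρ₁) {V : Submodule 𝕜 (Fn 𝕜)} (hV : V ≤ H2 𝕜)
    (hc : CompleteSpace
      (LinearMap.range (secondDeriv 𝕜 ∘ₗ Submodule.inclusion hV) : Submodule 𝕜 (Lp 𝕜 2 muI))) :
    HasMinimizers (A (𝕜 := 𝕜) l R τ n) (B l R) V := by
  have hinj : Function.Injective (secondDeriv 𝕜 ∘ₗ Submodule.inclusion hV) :=
    secondDeriv_injective.comp (Submodule.inclusion_injective hV)
  obtain ⟨C, hC0, hC⟩ := A_bounded (𝕜 := 𝕜) l R τ hρ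
  set D := max C (2 / ρ₀ + 2) with hD
  have haV := (A_posForm (𝕜 := 𝕜) hl R τ hρ).mono hV
  have : Fact ((2 : ℝ≥0∞) ≠ ⊤) := ⟨by simp⟩
  have hsep : SecondCountableTopology (Lp 𝕜 2 muI) := inferInstance
  refine hasMinimizers_of_weak haV ((B_posForm hl hR).mono hV)
    (LinearEquiv.ofInjective _ hinj) (C := D) (hC0.trans (le_max_left _ _)) (fun v => ?_)
    (fun v => ?_) fun x K hK hx => ?_
  · refine (A_coercive hl R τ hρ (Submodule.inclusion hV v)).trans ?_
    exact mul_le_mul_of_nonneg_right (le_max_right _ _) (haV.nonneg v.2)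
  · refine (hC (Submodule.inclusion hV v)).trans ?_
    exact mul_le_mul_of_nonneg_right (le_max_left _ _) (by positivity)
  · refine B_tendsto_zero l R (fun n => Submodule.inclusion hV (x n)) (K := K) hK fun y => ?_
    set S : Submodule 𝕜 (Lp 𝕜 2 muI) :=
      LinearMap.range (secondDeriv 𝕜 ∘ₗ Submodule.inclusion hV) with hS
    -- Weak convergence is known only against vectors of the image `S`; an arbitrary `y` in `L²(I)`
    -- is replaced by its projection onto `S`.
    refine (hx (S.orthogonalProjectionOnto y)).congr fun n => ?_
    exact Submodule.inner_orthogonalProjectionOnto_eq_of_mem_right (K := S)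
      (LinearEquiv.ofInjective _ hinj (x n)) y

end Forms

end TEMode

/-! ### The eigenvalue estimate. -/

theorem theorem3 {𝕜 : Type*} [RCLike 𝕜] (l : ℕ) (hl : 1 ≤ l) (R : ℝ) (hR : 0 < R) (τ : ℝ)
    (n : ℝ → ℝ) (hn : AEMeasurable n TEMode.muI) (α nstar : ℝ) (hα : 0 < α)
    (hbound : ∀ᵐ t ∂TEMode.muI, 1 + α ≤ n t ∧ n t ≤ nstar)
    (N m : ℕ) (hm : 1 ≤ m) (hmN : m ≤ Module.finrank 𝕜 (TEMode.XN 𝕜 N)) :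
    -- every eigenvalue of the continuous and of the discrete problem is real and positive
    (∀ V ∈ ({TEMode.H2 𝕜, TEMode.XN 𝕜 N} : Set (Submodule 𝕜 (TEMode.Fn 𝕜))),
      ∀ (μ : 𝕜) (w : TEMode.Fn 𝕜), w ≠ 0 →
        TEMode.IsEigen (TEMode.A l R τ n) (TEMode.B l R) V μ w → ∃ x : ℝ, 0 < x ∧ μ = (x : 𝕜)) ∧
    -- the first `m` eigenpairs of both problems and the projection exist
    (∃ (lam : Fin m → ℝ) (u : Fin m → TEMode.Fn 𝕜),
      TEMode.IsFirstEigenpairs (TEMode.A l R τ n) (TEMode.B l R) (TEMode.H2 𝕜) lam u) ∧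
    (∃ (lamN : Fin m → ℝ) (uN : Fin m → TEMode.Fn 𝕜),
      TEMode.IsFirstEigenpairs (TEMode.A l R τ n) (TEMode.B l R) (TEMode.XN 𝕜 N) lamN uN) ∧
    (∃! Pi : TEMode.H2 𝕜 → TEMode.XN 𝕜 N,
      TEMode.IsOrthProj (TEMode.A l R τ n) (TEMode.H2 𝕜) (TEMode.XN 𝕜 N) Pi) ∧
    -- the estimate, for every choice of the eigenfunctions
    ∀ (lam : Fin m → ℝ) (u : Fin m → TEMode.Fn 𝕜),
      TEMode.IsFirstEigenpairs (TEMode.A l R τ n) (TEMode.B l R) (TEMode.H2 𝕜) lam u →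
    ∀ (lamN : Fin m → ℝ) (uN : Fin m → TEMode.Fn 𝕜),
      TEMode.IsFirstEigenpairs (TEMode.A l R τ n) (TEMode.B l R) (TEMode.XN 𝕜 N) lamN uN →
    ∀ Pi : TEMode.H2 𝕜 → TEMode.XN 𝕜 N,
      TEMode.IsOrthProj (TEMode.A l R τ n) (TEMode.H2 𝕜) (TEMode.XN 𝕜 N) Pi →
    0 < lam ⟨m - 1, by omega⟩ ∧
    lam ⟨m - 1, by omega⟩ ≤ lamN ⟨m - 1, by omega⟩ ∧
    ∃ M : ENNReal,
      IsGreatest {q : ENNReal | ∃ v : TEMode.H2 𝕜,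
        (v : TEMode.Fn 𝕜) ∈ Submodule.span 𝕜 (Set.range u) ∧ v ≠ 0 ∧
        q = ENNReal.ofReal (RCLike.re (TEMode.B l R (v : TEMode.Fn 𝕜) v)) /
          ENNReal.ofReal (RCLike.re (TEMode.B l R (Pi v : TEMode.Fn 𝕜) (Pi v)))} M ∧
      ENNReal.ofReal (lamN ⟨m - 1, by omega⟩) ≤ ENNReal.ofReal (lam ⟨m - 1, by omega⟩) * M := by
  have hρ := TEMode.coeff_of_bounds hn hα hbound
  have ha := TEMode.A_posForm (𝕜 := 𝕜) hl R τ hρ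
  have hb := TEMode.B_posForm (𝕜 := 𝕜) hl hR
  have hW : TEMode.XN 𝕜 N ≤ TEMode.H2 𝕜 := inf_le_right
  -- `finrank` is zero for an infinite dimensional space, so `1 ≤ m ≤ finrank` already forces finite
  -- dimension.
  have hfin : FiniteDimensional 𝕜 (TEMode.XN 𝕜 N) :=
    Module.finite_of_finrank_pos (lt_of_lt_of_le hm hmN)
  have hminV : TEMode.HasMinimizers (TEMode.A (𝕜 := 𝕜) l R τ n) (TEMode.B l R) (TEMode.H2 𝕜) := by
    refine TEMode.hasMinimizers hl hR τ hρ le_rfl ?_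
    have e : TEMode.secondDeriv 𝕜 ∘ₗ Submodule.inclusion (le_refl (TEMode.H2 𝕜))
        = TEMode.secondDeriv 𝕜 := LinearMap.ext fun _ => rfl
    rw [e]
    exact TEMode.isClosed_range_secondDeriv.isComplete.completeSpace_coe
  have hminW : TEMode.HasMinimizers (TEMode.A (𝕜 := 𝕜) l R τ n) (TEMode.B l R)
      (TEMode.XN 𝕜 N) :=
    TEMode.hasMinimizers hl hR τ hρ hW (FiniteDimensional.complete 𝕜 _)
  let e := Module.finBasis 𝕜 (TEMode.XN 𝕜 N)
  -- These `m` vectors of `X_N` lie in both spaces and show that each problem has room for `m`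
  -- eigenpairs.
  have hli : LinearIndependent 𝕜 fun i : Fin m => ((e (Fin.castLE hmN i)) : TEMode.Fn 𝕜) :=
    (e.linearIndependent.map' (TEMode.XN 𝕜 N).subtype (Submodule.ker_subtype _)).comp _
      (Fin.castLE_injective hmN)
  refine ⟨?_, ?_, ?_, TEMode.existsUnique_isOrthProj ha hW, ?_⟩
  · intro V hV μ w hw h
    have hVle : V ≤ TEMode.H2 𝕜 := by
      rcases hV with rfl | rfl
      · exact le_rfl
      · exact hW
    exact ⟨_, h.eq_ofReal (ha.mono hVle) (hb.mono hVle) hw⟩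
  · exact TEMode.exists_isFirstEigenpairs ha hb hminV (fun i => hW (e _).2) hli
  · exact TEMode.exists_isFirstEigenpairs (ha.mono hW) (hb.mono hW) hminW (fun i => (e _).2) hli
  · intro lam u hu lamN uN huN Pi hPi
    exact TEMode.ritz_eigenvalue_bounds ha hb hW hminV hminW hm hu huN hPi
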